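/- \textbf{Proposition.} Let $S$ be a smooth complex surface and let $\mathcal H$ be a singular Riccati foliation on $\mathbb P(T_S)$: in local coordinates $(x,y)$ on $S$, with fibre coordinate $z$ representing the direction $\partial_x+z\partial_y$, it is given by $$dz+\alpha z^2+\beta z+\gamma=0,\qquad d\alpha+\alpha\wedge\beta=0,\quad d\beta+2\alpha\wedge\gamma=0,\quad d\gamma+\beta\wedge\gamma=0,$$ with $\alpha,\beta,\gamma$ meromorphic $1$-forms; its polar divisor $D$ is given by their poles. Assume that $\mathcal H$ is torsion-free, i.e. $d\kappa=0$ in all local coordinates, where $\kappa=(2\gamma_2-\beta_1)dx+(\beta_2-2\alpha_1)dy$ and $\alpha=\alpha_1dx+\alpha_2dy$, etc. Let $p\in D$ be a smooth point of the support $|D|$, and let $(x,y)$ be local coordinates centred at $p$ with $|D|=\{y=0\}$. Assume that $\mathcal H$ is regular-singular at $p$: near $p$ it is induced by a flat meromorphic connection $\nabla=d+\theta$ on $T_S$ with poles along $|D|$ (i.e. $\alpha=-\theta_{12}$, $\beta=\theta_{22}-\theta_{11}$, $\gamma=\theta_{21}$), which a meromorphic gauge transformation, invertible outside $|D|$, transforms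 into a connection with logarithmic poles along $|D|$. Let $U$ be a polydisc $\{|x|<r,\ |y|<r\}$ in these coordinates. (0) On the universal covering of $U\setminus D$ there is exactly one complex vector space $V=\mathbb C\langle\omega_0,\omega_\infty\rangle$ of closed holomorphic $1$-forms (multivalued closed $1$-forms on $U\setminus D$) such that $\omega_0\wedge\omega_\infty$ vanishes nowhere and the kernel of every nonzero $\omega\in V$ is a leaf of $\mathcal H$. It is preserved by the monodromy around $D$. (1) The projective monodromy, i.e. the action of the monodromy around $D$ on $\mathbb P(V)$, has at least one fixed point. (2) Let $\omega\in V\setminus\{0\}$ represent a fixed point of the projective monodromy. Then $\omega$ has multiplicative monodromy: it is multiplied by a constant $c\in\mathbb C^*$ under continuation around $D$. Moreover the foliation $\mathcal F_\omega=\ker\omega$ extends as a (possibly singular) holomorphic foliation on a neighbourhood of $p$: it is defined there by a holomorphic $1$-form without zeros outside $p$. (3) If moreover the extended foliation $\mathcal F_\omega$ is smooth at $p$ and transversal to $D$ at $p$, then $\omega$ extends as a closed, non-vanishing holomorphic $1$-form on a neighbourhood of $p$. -/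

import Mathlib

open scoped ContDiff Manifold Topology

noncomputable section

namespace AffineSurface

/-- The model space of a complex surface, with coordinates `(x, y)`. With the sup norm of a product,
`Metric.ball 0 r` is the polydisc `|x| < r`, `|y| < r`. -/
abbrev E := ℂ × ℂ

/-- Differential `1`-forms on (open subsets of) `ℂ²`. -/
abbrev OneForm := E → (E →L[ℂ] ℂ)

/-- The exterior derivative of a `1`-form: `dη(X, Y) = X·η(Y) - Y·η(X)` for constant `X`, `Y`. -/
def extD (η : OneForm) (c X Y : E) : ℂ :=
  fderiv ℂ η c X Y - fderiv ℂ η c Y X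

/-- The wedge product of two `1`-forms at a point. -/
def wedge (η ξ : E →L[ℂ] ℂ) (X Y : E) : ℂ := η X * ξ Y - η Y * ξ X

/-- The determinant of two vectors. -/
def det2 (v w : E) : ℂ := v.1 * w.2 - v.2 * w.1

/-- The form `κ = (2γ₂ - β₁) dx + (β₂ - 2α₁) dy`, the trace of the unique torsion-free linear
connection on the tangent bundle lifting the Riccati equation `dz + α z² + β z + γ = 0`. -/
def kappa (α β γ : OneForm) : OneForm := fun c =>
  (2 * γ c (0, 1) - β c (1, 0)) • ContinuousLinearMap.fst ℂ ℂ ℂ +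
    (β c (0, 1) - 2 * α c (1, 0)) • ContinuousLinearMap.snd ℂ ℂ ℂ

/-- The homogeneous form `α z₂² + β z₁ z₂ + γ z₁²` of the Riccati equation
`dz + α z² + β z + γ = 0`, where `(z₁ : z₂) = (1 : z)`. A vector field `v` spans a leaf iff
`v₁ dv₂ - v₂ dv₁ + quad(v) = 0`. -/
def quad (α β γ : OneForm) (c X v : E) : ℂ :=
  α c X * v.2 ^ 2 + β c X * (v.1 * v.2) + γ c X * v.1 ^ 2

/-- A singular Riccati foliation on the projectivized tangent bundle `ℙ(T_S)` of a complex surface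
`S`. In every holomorphic chart `e = (x, y)`, and in the coordinate `z` on the fibres such that `z`
represents the direction `∂_x + z ∂_y`, it is given by `dz + α z² + β z + γ = 0` with meromorphic
`1`-forms `α, β, γ`. The set `polar` is the support of the polar divisor: the set of the points at
which `α, β, γ` are not all holomorphic. (Values of the forms at polar points are irrelevant.) -/
structure RiccatiFoliation (S : Type*) [TopologicalSpace S] [ChartedSpace E S]
    [IsManifold 𝓘(ℂ, E) ω S] where
  polar : Set S
  α : OpenPartialHomeomorph S E → OneForm
  β : OpenPartialHomeomorph S E → OneForm
  γ : OpenPartialHomeomorph S E → OneForm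
  /-- the coefficients are holomorphic outside of the polar locus -/
  analytic : ∀ e ∈ IsManifold.maximalAtlas 𝓘(ℂ, E) ω S, ∀ q ∈ e.source, q ∉ polar →
    AnalyticAt ℂ (α e) (e q) ∧ AnalyticAt ℂ (β e) (e q) ∧ AnalyticAt ℂ (γ e) (e q)
  /-- the coefficients are meromorphic everywhere: locally quotients by some nonzero `h` -/
  meromorphic : ∀ e ∈ IsManifold.maximalAtlas 𝓘(ℂ, E) ω S, ∀ q ∈ e.source,
    ∃ h : E → ℂ, AnalyticAt ℂ h (e q) ∧ ¬ (∀ᶠ c in 𝓝 (e q), h c = 0) ∧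
    ∃ a b g : OneForm, AnalyticAt ℂ a (e q) ∧ AnalyticAt ℂ b (e q) ∧ AnalyticAt ℂ g (e q) ∧
      ∀ᶠ c in 𝓝 (e q), e.symm c ∉ polar →
        h c • α e c = a c ∧ h c • β e c = b c ∧ h c • γ e c = g c
  /-- at a polar point, the coefficients do not all extend holomorphically -/
  pole : ∀ e ∈ IsManifold.maximalAtlas 𝓘(ℂ, E) ω S, ∀ q ∈ e.source, q ∈ polar →
    ¬ ∃ a b g : OneForm, AnalyticAt ℂ a (e q) ∧ AnalyticAt ℂ b (e q) ∧ AnalyticAt ℂ g (e q) ∧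
      ∀ᶠ c in 𝓝 (e q), e.symm c ∉ polar → α e c = a c ∧ β e c = b c ∧ γ e c = g c
  /-- Frobenius integrability -/
  frobenius : ∀ e ∈ IsManifold.maximalAtlas 𝓘(ℂ, E) ω S, ∀ q ∈ e.source, q ∉ polar → ∀ X Y : E,
    extD (α e) (e q) X Y + wedge (α e (e q)) (β e (e q)) X Y = 0 ∧
    extD (β e) (e q) X Y + 2 * wedge (α e (e q)) (γ e (e q)) X Y = 0 ∧
    extD (γ e) (e q) X Y + wedge (β e (e q)) (γ e (e q)) X Y = 0
  /-- Two charts define the same foliation of `ℙ(T_S)`: with `G` the change of charts and `P` its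
  derivative, which acts on directions by `v ↦ P v`, the equation in the second chart
  pulls back to `det P` times the equation in the first one. -/
  compat : ∀ e ∈ IsManifold.maximalAtlas 𝓘(ℂ, E) ω S,
    ∀ f ∈ IsManifold.maximalAtlas 𝓘(ℂ, E) ω S, ∀ q ∈ e.source, q ∈ f.source → q ∉ polar →
    ∀ G : E → E, G = (fun c => f (e.symm c)) → ∀ P : E →L[ℂ] E, P = fderiv ℂ G (e q) →
    ∀ X v : E,
      quad (α f) (β f) (γ f) (f q) (P X) (P v) +
          det2 (P v) (fderiv ℂ (fderiv ℂ G) (e q) X v) =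
        P.det * quad (α e) (β e) (γ e) (e q) X v

/-- The map `(x, s) ↦ (x, exp s)`: the universal covering of `{y ≠ 0}`. -/
def coverMap (c : E) : E := (c.1, Complex.exp c.2)

/-- The universal covering of the polydisc of radius `r` minus `{y = 0}`. -/
def coverDomain (r : ℝ) : Set E := coverMap ⁻¹' Metric.ball 0 r

/-- The pull-back of a `1`-form to the universal covering. -/
def pullback (η : OneForm) (c : E) : E →L[ℂ] ℂ := (η (coverMap c)).comp (fderiv ℂ coverMap c)

/-- The linear monodromy around `{y = 0}`: the pull-back of `1`-forms on the universal covering by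
the deck transformation `(x, s) ↦ (x, s + 2πi)`. -/
def monodromy : OneForm →ₗ[ℂ] OneForm :=
  LinearMap.funLeft ℂ (E →L[ℂ] ℂ) (fun c : E => c + (0, 2 * Real.pi * Complex.I))

theorem monodromy_injective : Function.Injective monodromy :=
  LinearMap.funLeft_injective_of_surjective ℂ _ _ (add_right_surjective _)

theorem monodromy_restrict_injective (V : Submodule ℂ OneForm) (hV : ∀ w ∈ V, monodromy w ∈ V) :
    Function.Injective (monodromy.restrict hV) := by
  intro a b h
  apply Subtype.ext
  apply monodromy_injective
  exact congrArg Subtype.val h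

/-- The projective monodromy, acting on the lines of `V`. -/
def projMonodromy (V : Submodule ℂ OneForm) (hV : ∀ w ∈ V, monodromy w ∈ V) :
    Projectivization ℂ V → Projectivization ℂ V :=
  Projectivization.map (monodromy.restrict hV) (monodromy_restrict_injective V hV)

/-- A vector field spanning, in the coordinates `(x, y)`, the kernel of the multivalued
`1`-form `w` (a `1`-form on the universal covering). -/
def kerVec (w : OneForm) (c : E) : E := fderiv ℂ coverMap c (w c (0, 1), - w c (1, 0))

/-- `f` is meromorphic at `0` with poles only along `{y = 0}`. -/
def MeromorphicAlong {F : Type*} [NormedAddCommGroup F] [NormedSpace ℂ F] (f : E → F) : Prop :=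
  ∃ (n : ℕ) (g : E → F), AnalyticAt ℂ g 0 ∧ ∀ᶠ c in 𝓝 (0 : E), c.2 ≠ 0 → c.2 ^ n • f c = g c

/-- The meromorphic connection `d + θ` is flat on a neighbourhood of `0`. -/
def IsFlatConnection (θ : Fin 2 → Fin 2 → OneForm) : Prop :=
  ∀ᶠ c in 𝓝 (0 : E), c.2 ≠ 0 → ∀ (i j : Fin 2) (X Y : E),
    extD (θ i j) c X Y + ∑ k, wedge (θ i k c) (θ k j c) X Y = 0

/-- The meromorphic connection `d + θ`, with poles along `{y = 0}`, is regular-singular at `0`: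
some meromorphic gauge transformation `G`, invertible outside of `{y = 0}`, transforms it into a
connection `d + θ'` with logarithmic poles, where `θ' = A dy/y + B dx` with `A`, `B` holomorphic and
`G θ' = θ G + dG`. -/
def IsRegularSingularConnection (θ : Fin 2 → Fin 2 → OneForm) : Prop :=
  ∃ G A B : Fin 2 → Fin 2 → E → ℂ,
    (∀ i j, MeromorphicAlong (G i j)) ∧
    (∀ᶠ c in 𝓝 (0 : E), c.2 ≠ 0 → G 0 0 c * G 1 1 c - G 0 1 c * G 1 0 c ≠ 0) ∧
    (∀ i j, AnalyticAt ℂ (A i j) 0) ∧ (∀ i j, AnalyticAt ℂ (B i j) 0) ∧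
    ∀ᶠ c in 𝓝 (0 : E), c.2 ≠ 0 → ∀ (i j : Fin 2) (X : E),
      ∑ k, G i k c * (A k j c * (X.2 / c.2) + B k j c * X.1) =
        ∑ k, θ i k c X * G k j c + fderiv ℂ (G i j) c X

namespace RiccatiFoliation

variable {S : Type*} [TopologicalSpace S] [ChartedSpace E S] [IsManifold 𝓘(ℂ, E) ω S]

/-- The torsion `dκ` of the foliation vanishes identically. -/
def IsTorsionFree (H : RiccatiFoliation S) : Prop :=
  ∀ e ∈ IsManifold.maximalAtlas 𝓘(ℂ, E) ω S, ∀ q ∈ e.source, q ∉ H.polar →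
    ∀ X Y : E, extD (kappa (H.α e) (H.β e) (H.γ e)) (e q) X Y = 0

/-- `e = (x, y)` is a holomorphic chart centred at `p` in which the support of the polar divisor is
`{y = 0}`. Such a chart exists iff `p` is a smooth point of the support of the polar divisor. -/
structure IsAdaptedChart (H : RiccatiFoliation S) (p : S) (e : OpenPartialHomeomorph S E) :
    Prop where
  mem_atlas : e ∈ IsManifold.maximalAtlas 𝓘(ℂ, E) ω S
  mem_source : p ∈ e.source
  center : e p = 0
  polar_iff : ∀ q ∈ e.source, q ∈ H.polar ↔ (e q).2 = 0

/-- The structure is regular-singular at the centre of the adapted chart `e`: near this point it is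
induced by a flat meromorphic connection `d + θ` on the tangent bundle (in the frame `∂_x, ∂_y`)
with poles along the polar locus, which is regular-singular. -/
def IsRegularSingularIn (H : RiccatiFoliation S) (e : OpenPartialHomeomorph S E) : Prop :=
  ∃ θ : Fin 2 → Fin 2 → OneForm,
    (∀ i j, MeromorphicAlong (θ i j)) ∧ IsFlatConnection θ ∧
    (∀ᶠ c in 𝓝 (0 : E), c.2 ≠ 0 →
      H.α e c = - θ 0 1 c ∧ H.β e c = θ 1 1 c - θ 0 0 c ∧ H.γ e c = θ 1 0 c) ∧
    IsRegularSingularConnection θ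

/-- `V` is the space `ℂ⟨ω₀, ω_∞⟩` of multivalued closed `1`-forms, on the polydisc of radius `r` minus
`{y = 0}`, which defines the pencil of foliations given by the leaves of `H`. Multivalued forms
are forms on the universal covering, set to `0` elsewhere. -/
structure IsFlatPencil (H : RiccatiFoliation S) (e : OpenPartialHomeomorph S E) (r : ℝ)
    (V : Submodule ℂ OneForm) : Prop where
  span : ∃ w₀ w₁ : OneForm, V = Submodule.span ℂ {w₀, w₁} ∧
    ∀ c ∈ coverDomain r, wedge (w₀ c) (w₁ c) (1, 0) (0, 1) ≠ 0
  analytic : ∀ w ∈ V, AnalyticOnNhd ℂ w (coverDomain r)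
  support : ∀ w ∈ V, ∀ c ∉ coverDomain r, w c = 0
  closed : ∀ w ∈ V, ∀ c ∈ coverDomain r, ∀ X Y : E, extD w c X Y = 0
  /-- the kernel of every form of `V` is a leaf of `H` -/
  leaf : ∀ w ∈ V, ∀ c ∈ coverDomain r, ∀ X : E,
    det2 (kerVec w c) (fderiv ℂ (kerVec w) c X) +
      quad (H.α e) (H.β e) (H.γ e) (coverMap c) (fderiv ℂ coverMap c X) (kerVec w c) = 0

end RiccatiFoliation

/-- The holomorphic `1`-form `η`, without zeros outside of the origin, defines on the polydisc of
radius `ρ` a (possibly singular) holomorphic foliation extending the foliation `ker w`, where `w` is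
a multivalued `1`-form. -/
def ExtendsFoliation (w η : OneForm) (ρ : ℝ) : Prop :=
  AnalyticOnNhd ℂ η (Metric.ball 0 ρ) ∧ (∀ c ∈ Metric.ball (0 : E) ρ, c ≠ 0 → η c ≠ 0) ∧
    ∀ c ∈ coverDomain ρ, ∀ X : E, w c X = 0 ↔ pullback η c X = 0

/-- The foliation `ker η` is smooth at `0` and transversal there to `{y = 0}`. -/
def IsTransversal (η : OneForm) : Prop := η 0 (1, 0) ≠ 0

end AffineSurface

end

/-! A Riccati foliation prescribes a linear connection up to its trace, and exactly one choice of
trace, `kappa`, makes the connection torsion-free. The Frobenius equations give flatness of the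
trace-free part and `dκ = 0` gives flatness of the trace. On the cotangent bundle, the absence of
torsion says that parallel `1`-forms are closed, and their kernels are leaves. Conversely, let two
independent closed forms, together with their sum, have leaves as kernels. They differ from parallel
forms by a common scalar form `p`, and closedness gives `p ∧ w₀ = p ∧ w₁ = 0`, so `p = 0`
(`isParallelAt_of_pencil`). Hence `V` is the space of parallel forms. It is two-dimensional because
the universal covering, in the coordinates `(x, s)` with `y = exp s`, is convex and a flat
connection on it is trivial (`exists_parallel_section`). The coefficients are invariant under the
deck transformation, so the monodromy preserves `V`. A fixed point of the projective monodromy is an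
eigenvector.

For the extension of the foliation, let `ω` be an eigenform and `v` a vector field spanning its
kernel. The regular-singular connection `d + θ` and the torsion-free one induce the same foliation,
so they differ by a closed scalar form `ψ`. With `u = exp (-∫ ψ)`, the multivalued field `σ = u v`
is flat for `d + θ`. Regularity gives moderate growth (`exists_moderate_bound_of_gauge`), and the
monodromy of `σ` is multiplicative. Therefore `σ = y ^ μ g`, with `g` holomorphic and not
identically zero on `{y = 0}` (`exists_eq_exp_smul_of_moderate`). The field `g` spans the extended
foliation. It vanishes only at isolated points of `{y = 0}`, and a smaller polydisc contains at most
one of them, the origin.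

In the transversal case `ω = F (dx + q dy)` with `q` holomorphic, and closedness is the transport
equation `F_y = (q F)_x`. Integration along characteristics bounds both `F` and `1 / F` near `{y =
0}` on sectors (`exists_bound_of_transport`). So `F = y ^ μ g` with `g` holomorphic; the transport
equation restricted to `{y = 0}` gives `μ g = 0`, hence `μ = 0`, and the bound on `1 / F` excludes
zeros of `g`.

The analytic tools, namely Osgood's lemma, Riemann extension and the solution of flat systems, all
rest on Cauchy's formula on a bidisc. -/

open scoped ContDiff Manifold Topology

noncomputable section

namespace AffineSurface

open MeasureTheory Metric Set

/-! ### Cauchy's formula on bidiscs and Osgood's lemma. -/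

section SeveralComplexVariables

variable {F : Type*} [NormedAddCommGroup F] [NormedSpace ℂ F]

/-- Integration against a continuous vector-valued function, as a functional on `C(K, ℂ)`. -/
def integralAgainst {K : Type*} [TopologicalSpace K] [CompactSpace K] [SecondCountableTopology K]
    [MeasurableSpace K] [BorelSpace K] (μ : Measure K) [IsFiniteMeasure μ] (ψ : C(K, F)) :
    C(K, ℂ) →L[ℂ] F :=
  LinearMap.mkContinuous
    { toFun := fun h => ∫ p, h p • ψ p ∂μ
      map_add' := by
        intro h k
        simp only [ContinuousMap.add_apply, add_smul]
        exact integral_add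
          (Continuous.integrable_of_hasCompactSupport (by fun_prop) (HasCompactSupport.of_compactSpace _))
          (Continuous.integrable_of_hasCompactSupport (by fun_prop) (HasCompactSupport.of_compactSpace _))
      map_smul' := by
        intro a h
        simp only [ContinuousMap.smul_apply, smul_assoc, RingHom.id_apply]
        exact integral_smul a _ }
    (‖ψ‖ * μ.real univ) (by
      intro h
      have := norm_integral_le_of_norm_le_const (μ := μ) (f := fun p => h p • ψ p) (C := ‖h‖ * ‖ψ‖)
        (Filter.Eventually.of_forall fun p => by
          rw [norm_smul]
          exact mul_le_mul (h.norm_coe_le_norm p) (ψ.norm_coe_le_norm p) (norm_nonneg _)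
            (norm_nonneg _))
      calc _ ≤ _ := this
        _ = _ := by ring)

theorem integralAgainst_apply {K : Type*} [TopologicalSpace K] [CompactSpace K]
    [SecondCountableTopology K] [MeasurableSpace K] [BorelSpace K] (μ : Measure K)
    [IsFiniteMeasure μ] (ψ : C(K, F)) (h : C(K, ℂ)) :
    integralAgainst μ ψ h = ∫ p, h p • ψ p ∂μ := rfl

theorem inverse_apply_of_forall_ne_zero {K : Type*} [TopologicalSpace K] [CompactSpace K]
    (f : C(K, ℂ)) (hf : ∀ p, f p ≠ 0) (p : K) : Ring.inverse f p = (f p)⁻¹ := by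
  have hu : IsUnit f := (ContinuousMap.isUnit_iff_forall_ne_zero f).2 hf
  have h := congrArg (fun g : C(K, ℂ) => g p) (Ring.mul_inverse_cancel f hu)
  exact eq_inv_of_mul_eq_one_right h

/-- Differentiation under the integral is avoided: the kernel is a product of inverses in the Banach
algebra `C(K, ℂ)`, where inversion is analytic, and integration against `ψ` is a continuous linear
map. -/
theorem analyticAt_integral_cauchyKernel {K : Type*} [TopologicalSpace K] [CompactSpace K]
    [SecondCountableTopology K] [MeasurableSpace K] [BorelSpace K] (μ : Measure K)
    [IsFiniteMeasure μ] (a b : C(K, ℂ)) (ψ : C(K, F)) (c : E) (ha : ∀ p, a p ≠ c.1)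
    (hb : ∀ p, b p ≠ c.2) :
    AnalyticAt ℂ (fun c : E => ∫ p, ((a p - c.1)⁻¹ * (b p - c.2)⁻¹) • ψ p ∂μ) c := by
  have key : ∀ (l : E →L[ℂ] ℂ) (d : C(K, ℂ)), (∀ p, d p ≠ l c) →
      AnalyticAt ℂ (fun c : E => Ring.inverse (d - algebraMap ℂ C(K, ℂ) (l c))) c ∧
      ∀ᶠ c' in 𝓝 c, ∀ p, Ring.inverse (d - algebraMap ℂ C(K, ℂ) (l c')) p = (d p - l c')⁻¹ := by
    intro l d hd
    have hu : IsUnit (d - algebraMap ℂ C(K, ℂ) (l c)) :=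
      (ContinuousMap.isUnit_iff_forall_ne_zero _).2 fun p => sub_ne_zero.2 (hd p)
    have hA : AnalyticAt ℂ (fun c : E => d - algebraMap ℂ C(K, ℂ) (l c)) c :=
      analyticAt_const.sub
        (((Algebra.linearMap ℂ C(K, ℂ)).toContinuousLinearMap.comp l).analyticAt c)
    refine ⟨?_, ?_⟩
    · exact AnalyticAt.fun_comp (g := Ring.inverse) (f := fun c : E => d - algebraMap ℂ C(K, ℂ) (l c))
        (analyticAt_inverse (𝕜 := ℂ) hu.unit) hA
    · filter_upwards [hA.continuousAt.eventually (Units.isOpen.mem_nhds hu)] with c' hc' p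
      have := (ContinuousMap.isUnit_iff_forall_ne_zero _).1 hc'
      rw [inverse_apply_of_forall_ne_zero _ this]
      rfl
  obtain ⟨h1, h1'⟩ := key (ContinuousLinearMap.fst ℂ ℂ ℂ) a ha
  obtain ⟨h2, h2'⟩ := key (ContinuousLinearMap.snd ℂ ℂ ℂ) b hb
  refine AnalyticAt.congr (((integralAgainst μ ψ).analyticAt _).fun_comp (h1.mul h2)) ?_
  filter_upwards [h1', h2'] with c' e1 e2
  rw [integralAgainst_apply]
  refine integral_congr_ae (Filter.Eventually.of_forall fun p => ?_)
  simp only [Pi.mul_apply, ContinuousMap.mul_apply, e1, e2]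
  rfl

/-- The parameter space of a circle. -/
abbrev Angle : Type := Icc (0 : ℝ) (2 * Real.pi)

/-- Lebesgue measure on the parameter space of a circle. -/
def angleMeasure : Measure Angle := Measure.comap Subtype.val volume

instance : IsFiniteMeasure angleMeasure := by
  refine ⟨?_⟩
  rw [angleMeasure, comap_subtype_coe_apply measurableSet_Icc, image_univ, Subtype.range_coe]
  exact measure_Icc_lt_top

/-- The density of the normalised Cauchy integral on the circle `C(z, R)`. -/
def cauchyDensity (R : ℝ) (t : Angle) : ℂ :=
  (2 * Real.pi * Complex.I)⁻¹ * (circleMap 0 R t * Complex.I)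

theorem continuous_cauchyDensity (R : ℝ) : Continuous (cauchyDensity R) := by
  unfold cauchyDensity
  exact continuous_const.mul
    (((continuous_circleMap 0 R).comp continuous_subtype_val).mul continuous_const)

/-- This puts Cauchy integrals over a compact space with a continuous density, the setting of
`integralAgainst`. -/
theorem circleIntegral_eq_integral_angle (f : ℂ → F) (z : ℂ) (R : ℝ) :
    (2 * Real.pi * Complex.I : ℂ)⁻¹ • (∮ w in C(z, R), f w) =
      ∫ t : Angle, cauchyDensity R t • f (circleMap z R t) ∂angleMeasure := by
  rw [circleIntegral, intervalIntegral.integral_of_le (by positivity),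
    ← integral_Icc_eq_integral_Ioc, ← integral_smul,
    ← integral_subtype_comap (μ := volume) (s := Icc (0 : ℝ) (2 * Real.pi)) measurableSet_Icc
      (fun t => (2 * Real.pi * Complex.I : ℂ)⁻¹ • deriv (circleMap z R) t • f (circleMap z R t))]
  refine integral_congr_ae (Filter.Eventually.of_forall fun t => ?_)
  simp only [cauchyDensity, deriv_circleMap, smul_smul]

theorem circleMap_ne_of_mem_ball {z w : ℂ} {R : ℝ} (hw : w ∈ ball z R) (t : ℝ) :
    circleMap z R t ≠ w := by
  intro h
  have hR : 0 < R := pos_of_mem_ball hw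
  have := circleMap_mem_sphere z hR.le t
  rw [h, mem_sphere] at this
  rw [mem_ball] at hw
  linarith

/-- The Cauchy formula over a polydisc, for separately holomorphic functions. -/
theorem eq_integral_cauchyKernel [CompleteSpace F] {g : E → F} {z : E} {R : ℝ}
    (hg : ContinuousOn g (closedBall z R))
    (h1 : ∀ c ∈ closedBall z R, DifferentiableAt ℂ (fun x => g (x, c.2)) c.1)
    (h2 : ∀ c ∈ closedBall z R, DifferentiableAt ℂ (fun y => g (c.1, y)) c.2)
    {c : E} (hc : c ∈ ball z R) :
    g c = ∫ p : Angle × Angle, ((circleMap z.1 R p.1 - c.1)⁻¹ * (circleMap z.2 R p.2 - c.2)⁻¹) •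
      (cauchyDensity R p.1 * cauchyDensity R p.2) • g (circleMap z.1 R p.1, circleMap z.2 R p.2)
        ∂(angleMeasure.prod angleMeasure) := by
  have hR : 0 < R := pos_of_mem_ball hc
  have hball : ∀ {a b : ℂ}, a ∈ closedBall z.1 R → b ∈ closedBall z.2 R →
      ((a, b) : E) ∈ closedBall z R := by
    intro a b ha hb
    rw [← Prod.eta z, ← closedBall_prod_same]
    exact ⟨ha, hb⟩
  have hc' : c.1 ∈ ball z.1 R ∧ c.2 ∈ ball z.2 R := by
    rw [← Prod.eta z, ← ball_prod_same] at hc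
    exact hc
  -- Cauchy's formula in `x` with `y` fixed, then in `y` for each `x` on the circle; Fubini
  -- assembles the two.
  have s1 : g c = ∫ t : Angle, cauchyDensity R t •
      (circleMap z.1 R t - c.1)⁻¹ • g (circleMap z.1 R t, c.2) ∂angleMeasure := by
    rw [← circleIntegral_eq_integral_angle (fun w => (w - c.1)⁻¹ • g (w, c.2)) z.1 R]
    rw [Complex.two_pi_I_inv_smul_circleIntegral_sub_inv_smul_of_differentiable_on_off_countable
      countable_empty hc'.1]
    · exact fun x hx => (h1 (x, c.2)
        (hball hx (ball_subset_closedBall hc'.2))).continuousAt.continuousWithinAt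
    · exact fun x hx => h1 (x, c.2)
        (hball (ball_subset_closedBall hx.1) (ball_subset_closedBall hc'.2))
  have s2 : ∀ x ∈ closedBall z.1 R, g (x, c.2) = ∫ t : Angle, cauchyDensity R t •
      (circleMap z.2 R t - c.2)⁻¹ • g (x, circleMap z.2 R t) ∂angleMeasure := by
    intro x hx
    rw [← circleIntegral_eq_integral_angle (fun w => (w - c.2)⁻¹ • g (x, w)) z.2 R]
    rw [Complex.two_pi_I_inv_smul_circleIntegral_sub_inv_smul_of_differentiable_on_off_countable
      countable_empty hc'.2]
    · exact fun y hy => (h2 (x, y) (hball hx hy)).continuousAt.continuousWithinAt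
    · exact fun y hy => h2 (x, y) (hball hx (ball_subset_closedBall hy.1))
  have hcont : Continuous fun p : Angle × Angle =>
      ((circleMap z.1 R p.1 - c.1)⁻¹ * (circleMap z.2 R p.2 - c.2)⁻¹) •
      (cauchyDensity R p.1 * cauchyDensity R p.2) •
        g (circleMap z.1 R p.1, circleMap z.2 R p.2) := by
    have k1 : Continuous fun p : Angle × Angle => circleMap z.1 R p.1 :=
      (continuous_circleMap _ _).comp (continuous_subtype_val.comp continuous_fst)
    have k2 : Continuous fun p : Angle × Angle => circleMap z.2 R p.2 :=
      (continuous_circleMap _ _).comp (continuous_subtype_val.comp continuous_snd)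
    refine Continuous.smul (Continuous.mul ?_ ?_) (Continuous.smul ?_ ?_)
    · exact (k1.sub continuous_const).inv₀ fun p => sub_ne_zero.2 (circleMap_ne_of_mem_ball hc'.1 _)
    · exact (k2.sub continuous_const).inv₀ fun p => sub_ne_zero.2 (circleMap_ne_of_mem_ball hc'.2 _)
    · exact ((continuous_cauchyDensity R).comp continuous_fst).mul
        ((continuous_cauchyDensity R).comp continuous_snd)
    · exact hg.comp_continuous (k1.prodMk k2) fun p =>
        hball (circleMap_mem_closedBall _ hR.le _) (circleMap_mem_closedBall _ hR.le _)
  have hint := hcont.integrable_of_hasCompactSupport (μ := angleMeasure.prod angleMeasure)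
    (HasCompactSupport.of_compactSpace _)
  rw [integral_prod _ hint, s1]
  refine integral_congr_ae (Filter.Eventually.of_forall fun t => ?_)
  simp only
  rw [s2 _ (circleMap_mem_closedBall _ hR.le _), ← integral_smul, ← integral_smul]
  refine integral_congr_ae (Filter.Eventually.of_forall fun u => ?_)
  simp only [smul_smul]
  congr 1
  ring

/-- An integral over a compact space of separately holomorphic functions, depending continuously on
the parameter, is analytic. -/
theorem analyticOnNhd_integral_of_separately [CompleteSpace F] {T : Type*} [TopologicalSpace T]
    [CompactSpace T] [SecondCountableTopology T] [MeasurableSpace T] [BorelSpace T] (μ : Measure T)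
    [IsFiniteMeasure μ] {U : Set E} (hU : IsOpen U) {G : T → E → F}
    (hG : ContinuousOn (fun q : T × E => G q.1 q.2) (univ ×ˢ U))
    (h1 : ∀ t, ∀ c ∈ U, DifferentiableAt ℂ (fun x => G t (x, c.2)) c.1)
    (h2 : ∀ t, ∀ c ∈ U, DifferentiableAt ℂ (fun y => G t (c.1, y)) c.2) :
    AnalyticOnNhd ℂ (fun c => ∫ t, G t c ∂μ) U := by
  intro z hz
  obtain ⟨R, hR, hRU⟩ := nhds_basis_closedBall.mem_iff.1 (hU.mem_nhds hz)
  have hball : ∀ t u : ℝ, ((circleMap z.1 R t, circleMap z.2 R u) : E) ∈ U := by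
    intro t u
    apply hRU
    rw [← Prod.eta z, ← closedBall_prod_same]
    exact ⟨circleMap_mem_closedBall _ hR.le _, circleMap_mem_closedBall _ hR.le _⟩
  -- Each `G t` is replaced by its Cauchy integral over a fixed torus. Then `c` occurs only in the
  -- kernel, and `T` is one more compact factor of the parameter space.
  have k1 : Continuous fun p : T × (Angle × Angle) => circleMap z.1 R p.2.1 :=
    (continuous_circleMap _ _).comp
      (continuous_subtype_val.comp (continuous_fst.comp continuous_snd))
  have k2 : Continuous fun p : T × (Angle × Angle) => circleMap z.2 R p.2.2 :=
    (continuous_circleMap _ _).comp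
      (continuous_subtype_val.comp (continuous_snd.comp continuous_snd))
  let a : C(T × (Angle × Angle), ℂ) := ⟨_, k1⟩
  let b : C(T × (Angle × Angle), ℂ) := ⟨_, k2⟩
  let ψ : C(T × (Angle × Angle), F) :=
    ⟨fun p => (cauchyDensity R p.2.1 * cauchyDensity R p.2.2) •
      G p.1 (circleMap z.1 R p.2.1, circleMap z.2 R p.2.2), by
      refine Continuous.smul ?_ ?_
      · exact ((continuous_cauchyDensity R).comp (continuous_fst.comp continuous_snd)).mul
          ((continuous_cauchyDensity R).comp (continuous_snd.comp continuous_snd))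
      · exact hG.comp_continuous (continuous_fst.prodMk (k1.prodMk k2))
          fun p => ⟨mem_univ _, hball _ _⟩⟩
  have hmem : ∀ c ∈ ball z R, c.1 ∈ ball z.1 R ∧ c.2 ∈ ball z.2 R := by
    intro c hc
    rw [← Prod.eta z, ← ball_prod_same] at hc
    exact hc
  have hz' := hmem z (mem_ball_self hR)
  refine (analyticAt_integral_cauchyKernel (μ.prod (angleMeasure.prod angleMeasure)) a b ψ z
    (fun p => circleMap_ne_of_mem_ball hz'.1 _) (fun p => circleMap_ne_of_mem_ball hz'.2 _)).congr ?_
  filter_upwards [ball_mem_nhds z hR] with c hc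
  have hc' := hmem c hc
  have hcont : Continuous fun p : T × (Angle × Angle) =>
      ((a p - c.1)⁻¹ * (b p - c.2)⁻¹) • ψ p := by
    refine Continuous.smul (Continuous.mul ?_ ?_) ψ.continuous
    · exact (a.continuous.sub continuous_const).inv₀
        fun p => sub_ne_zero.2 (circleMap_ne_of_mem_ball hc'.1 _)
    · exact (b.continuous.sub continuous_const).inv₀
        fun p => sub_ne_zero.2 (circleMap_ne_of_mem_ball hc'.2 _)
  rw [integral_prod _ (hcont.integrable_of_hasCompactSupport (HasCompactSupport.of_compactSpace _))]
  refine integral_congr_ae (Filter.Eventually.of_forall fun t => ?_)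
  refine (eq_integral_cauchyKernel (g := G t) ?_ (fun _ hc => h1 t _ (hRU hc))
    (fun _ hc => h2 t _ (hRU hc)) hc).symm
  exact hG.comp (f := fun c : E => (t, c)) (by fun_prop) fun c hc => ⟨mem_univ _, hRU hc⟩

/-- **Osgood's lemma**: continuous and separately holomorphic functions are analytic. -/
theorem analyticOnNhd_of_separately [CompleteSpace F] {U : Set E} (hU : IsOpen U) {g : E → F}
    (hg : ContinuousOn g U) (h1 : ∀ c ∈ U, DifferentiableAt ℂ (fun x => g (x, c.2)) c.1)
    (h2 : ∀ c ∈ U, DifferentiableAt ℂ (fun y => g (c.1, y)) c.2) : AnalyticOnNhd ℂ g U := by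
  -- For a Dirac mass on a point the integral is `g` itself.
  have := analyticOnNhd_integral_of_separately (T := Unit) (Measure.dirac ()) hU (G := fun _ => g)
    (hg.comp continuous_snd.continuousOn fun q hq => hq.2) (fun _ => h1) (fun _ => h2)
  simpa using this

theorem differentiableAt_fst_slice {g : E → F} {c : E} (h : DifferentiableAt ℂ g c) :
    DifferentiableAt ℂ (fun x => g (x, c.2)) c.1 :=
  DifferentiableAt.comp (f := fun x : ℂ => ((x, c.2) : E)) c.1 h (by fun_prop)

theorem differentiableAt_snd_slice {g : E → F} {c : E} (h : DifferentiableAt ℂ g c) :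
    DifferentiableAt ℂ (fun y => g (c.1, y)) c.2 :=
  DifferentiableAt.comp (f := fun y : ℂ => ((c.1, y) : E)) c.2 h (by fun_prop)

theorem analyticOnNhd_of_differentiableOn [CompleteSpace F] {U : Set E} (hU : IsOpen U) {g : E → F}
    (hg : DifferentiableOn ℂ g U) : AnalyticOnNhd ℂ g U :=
  analyticOnNhd_of_separately hU hg.continuousOn
    (fun _ hc => differentiableAt_fst_slice (hg.differentiableAt (hU.mem_nhds hc)))
    (fun _ hc => differentiableAt_snd_slice (hg.differentiableAt (hU.mem_nhds hc)))

end SeveralComplexVariables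

/-! ### Riemann extension over `{y = 0}` and division by powers of `y`. -/

section Extension

variable {F : Type*} [NormedAddCommGroup F] [NormedSpace ℂ F]

theorem mem_ball_prod_iff {z c : E} {R : ℝ} :
    c ∈ ball z R ↔ c.1 ∈ ball z.1 R ∧ c.2 ∈ ball z.2 R := by
  rw [← Prod.eta z, ← ball_prod_same]
  rfl

theorem mem_closedBall_prod_iff {z c : E} {R : ℝ} :
    c ∈ closedBall z R ↔ c.1 ∈ closedBall z.1 R ∧ c.2 ∈ closedBall z.2 R := by
  rw [← Prod.eta z, ← closedBall_prod_same]
  rfl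

theorem isOpen_snd_ne_zero : IsOpen {c : E | c.2 ≠ 0} :=
  isOpen_ne_fun continuous_snd continuous_const

/-- **Riemann's extension theorem** over `{y = 0}`. -/
theorem exists_analytic_extension [CompleteSpace F] {U : Set E} (hU : IsOpen U) {g : E → F}
    (hg : ∀ c ∈ U, c.2 ≠ 0 → AnalyticAt ℂ g c)
    (hb : ∀ c ∈ U, c.2 = 0 → ∃ C : ℝ, ∀ᶠ c' in 𝓝 c, c'.2 ≠ 0 → ‖g c'‖ ≤ C) :
    ∃ G : E → F, AnalyticOnNhd ℂ G U ∧ ∀ c ∈ U, c.2 ≠ 0 → G c = g c := by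
  -- The extension is defined slice by slice, as the limit in `y` with `x` fixed.
  let G : E → F := fun c => Filter.limUnder (𝓝[≠] c.2) (fun y => g (c.1, y))
  have hGg : ∀ c ∈ U, c.2 ≠ 0 → G c = g c := by
    intro c hc hc2
    refine Filter.Tendsto.limUnder_eq ?_
    exact (differentiableAt_snd_slice (hg c hc hc2).differentiableAt).continuousAt.tendsto.mono_left
      nhdsWithin_le_nhds
  refine ⟨G, fun c hc => ?_, hGg⟩
  rcases ne_or_eq c.2 0 with hc2 | hc2
  · refine (hg c hc hc2).congr ?_
    filter_upwards [hU.mem_nhds hc, isOpen_snd_ne_zero.mem_nhds hc2] with c' h1 h2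
    exact (hGg c' h1 h2).symm
  obtain ⟨C, hC⟩ := hb c hc hc2
  obtain ⟨R, hR, hRU⟩ := nhds_basis_closedBall.mem_iff.1 (Filter.inter_mem (hU.mem_nhds hc) hC)
  have hmem : ∀ c' ∈ ball c R, ∀ w ∈ closedBall (0 : ℂ) R, ((c'.1, w) : E) ∈ closedBall c R := by
    intro c' hc' w hw
    rw [mem_ball_prod_iff] at hc'
    rw [mem_closedBall_prod_iff, hc2]
    exact ⟨ball_subset_closedBall hc'.1, hw⟩
  have hsphere : ∀ t : Angle, circleMap 0 R t ≠ 0 := fun t => by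
    rw [Ne, circleMap_eq_center_iff]
    exact hR.ne'
  -- On each slice the singularity is removable, so `G` is a Cauchy integral over `|y| = R`. This
  -- circle avoids `{y = 0}`, where `g` is not known to be regular, so the integrand is holomorphic
  -- in `c'`.
  have hformula : ∀ c' ∈ ball c R,
      ∫ t : Angle, cauchyDensity R t • (circleMap 0 R t - c'.2)⁻¹ • g (c'.1, circleMap 0 R t)
        ∂angleMeasure = G c' := by
    intro c' hc'
    have hc'' : c'.2 ∈ ball 0 R := by
      rw [mem_ball_prod_iff, hc2] at hc'
      exact hc'.2
    set H : ℂ → F := Function.update (fun w => g (c'.1, w)) 0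
      (Filter.limUnder (𝓝[≠] 0) fun w => g (c'.1, w)) with hH
    have hHd : DifferentiableOn ℂ H (closedBall 0 R) := by
      refine Complex.differentiableOn_update_limUnder_of_bddAbove (closedBall_mem_nhds 0 hR) ?_ ?_
      · intro w hw
        exact (differentiableAt_snd_slice (c := (c'.1, w))
          (hg _ (hRU (hmem c' hc' w hw.1)).1 hw.2).differentiableAt).differentiableWithinAt
      · refine ⟨C, ?_⟩
        rintro _ ⟨w, hw, rfl⟩
        exact (hRU (hmem c' hc' w hw.1)).2 hw.2
    have hval : H c'.2 = G c' := by
      rcases eq_or_ne c'.2 0 with h0 | h0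
      · rw [h0, hH, Function.update_self]
        simp only [G, h0]
      · rw [hH, Function.update_of_ne h0, hGg c' ?_ h0]
        exact (hRU (ball_subset_closedBall hc')).1
    rw [← hval, ← Complex.two_pi_I_inv_smul_circleIntegral_sub_inv_smul_of_differentiable_on_off_countable
      countable_empty hc'' hHd.continuousOn
      (fun x hx => hHd.differentiableAt (closedBall_mem_nhds_of_mem hx.1)),
      circleIntegral_eq_integral_angle]
    refine integral_congr_ae (Filter.Eventually.of_forall fun t => ?_)
    simp only [hH]
    rw [Function.update_of_ne (hsphere t)]
  have hopen : IsOpen (U ∩ {c | c.2 ≠ 0}) := hU.inter isOpen_snd_ne_zero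
  have hgo : ContinuousOn g (U ∩ {c | c.2 ≠ 0}) := fun c hc =>
    (hg c hc.1 hc.2).continuousAt.continuousWithinAt
  have hUc : ∀ c' ∈ ball c R, ∀ t : Angle,
      ((c'.1, circleMap 0 R t) : E) ∈ U ∩ {c | c.2 ≠ 0} := fun c' hc' t =>
    ⟨(hRU (hmem c' hc' _ (circleMap_mem_closedBall 0 hR.le t))).1, hsphere t⟩
  have hne : ∀ c' ∈ ball c R, ∀ t : Angle, circleMap 0 R t - c'.2 ≠ 0 := fun c' hc' t => by
    rw [mem_ball_prod_iff, hc2] at hc'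
    exact sub_ne_zero.2 (circleMap_ne_of_mem_ball hc'.2 _)
  have hd : ∀ t : Angle, ∀ c' ∈ ball c R, DifferentiableAt ℂ (fun c' : E =>
      cauchyDensity R t • (circleMap 0 R t - c'.2)⁻¹ • g (c'.1, circleMap 0 R t)) c' := by
    intro t c' hc'
    refine DifferentiableAt.const_smul (DifferentiableAt.smul ?_ ?_) _
    · exact DifferentiableAt.inv (by fun_prop) (hne c' hc' t)
    · have := (hg _ (hUc c' hc' t).1 (hUc c' hc' t).2).differentiableAt
      exact DifferentiableAt.comp (f := fun c' : E => ((c'.1, circleMap 0 R t) : E)) c' this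
        (by fun_prop)
  have hcirc : Continuous fun q : Angle × E => circleMap 0 R q.1 :=
    (continuous_circleMap _ _).comp (continuous_subtype_val.comp continuous_fst)
  have key := analyticOnNhd_integral_of_separately angleMeasure (isOpen_ball (x := c) (ε := R))
    (G := fun (t : Angle) (c' : E) =>
      cauchyDensity R t • (circleMap 0 R t - c'.2)⁻¹ • g (c'.1, circleMap 0 R t)) ?_
    (fun t c' hc' => differentiableAt_fst_slice (hd t c' hc'))
    (fun t c' hc' => differentiableAt_snd_slice (hd t c' hc'))
  · refine (key c (mem_ball_self hR)).congr ?_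
    filter_upwards [ball_mem_nhds c hR] with c' hc'
    exact hformula c' hc'
  · refine ContinuousOn.smul ?_ (ContinuousOn.smul ?_ ?_)
    · exact ((continuous_cauchyDensity R).comp continuous_fst).continuousOn
    · exact ContinuousOn.inv₀ (hcirc.sub (by fun_prop)).continuousOn fun q hq => hne q.2 hq.2 q.1
    · exact hgo.comp (f := fun q : Angle × E => ((q.2.1, circleMap 0 R q.1) : E))
        ((by fun_prop : Continuous fun q : Angle × E => q.2.1).prodMk hcirc).continuousOn
        fun q hq => hUc q.2 hq.2 q.1

/-- A holomorphic function vanishing on `{y = 0}` is divisible by `y`. -/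
theorem exists_eq_snd_smul [CompleteSpace F] {U : Set E} (hU : IsOpen U) {h : E → F}
    (hh : AnalyticOnNhd ℂ h U) (h0 : ∀ c ∈ U, c.2 = 0 → h c = 0) :
    ∃ h' : E → F, AnalyticOnNhd ℂ h' U ∧ ∀ c ∈ U, h c = c.2 • h' c := by
  obtain ⟨h', hh', e⟩ := exists_analytic_extension (g := fun c => c.2⁻¹ • h c) hU
    (fun c hc hc2 => (analyticAt_snd.inv hc2).smul (hh c hc)) (by
      intro c hc hc2
      -- Comparing `c'` with its projection to `{y = 0}`, at distance `|y|`, bounds the quotient by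
      -- a Lipschitz constant.
      obtain ⟨K, s, hs, hK⟩ := ((hh c hc).contDiffAt (n := 1)).exists_lipschitzOnWith
      have hproj : ContinuousAt (fun c' : E => ((c'.1, 0) : E)) c := by fun_prop
      have hc0 : ((c.1, 0) : E) = c := by rw [← hc2]
      have hs' : ∀ s ∈ 𝓝 c, s ∈ 𝓝 ((c.1, 0) : E) := fun s hs => by rwa [hc0]
      refine ⟨K, ?_⟩
      filter_upwards [hs, hproj (hs' s hs), hproj (hs' U (hU.mem_nhds hc))] with c' h1 h2 h3 hne
      have := hK.dist_le_mul c' h1 _ h2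
      rw [h0 _ h3 rfl, dist_zero_right] at this
      have hd : dist c' ((c'.1, 0) : E) = ‖c'.2‖ := by
        rw [Prod.dist_eq]
        simp
      rw [hd] at this
      rw [norm_smul, norm_inv, inv_mul_le_iff₀ (norm_pos_iff.2 hne)]
      linarith)
  refine ⟨h', hh', fun c hc => ?_⟩
  rcases eq_or_ne c.2 0 with hc2 | hc2
  · rw [h0 c hc hc2, hc2, zero_smul]
  · rw [e c hc hc2, smul_inv_smul₀ hc2]

/-- The largest power of `y` can be factored out of a nonzero holomorphic function. -/
theorem exists_eq_pow_snd_smul [CompleteSpace F] {ε : ℝ} {h : E → F}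
    (hh : AnalyticOnNhd ℂ h (ball 0 ε)) (hne : ∃ c ∈ ball (0 : E) ε, h c ≠ 0) :
    ∃ (k : ℕ) (h' : E → F), AnalyticOnNhd ℂ h' (ball 0 ε) ∧
      (∀ c ∈ ball (0 : E) ε, h c = c.2 ^ k • h' c) ∧
      ∃ x : ℂ, ((x, 0) : E) ∈ ball (0 : E) ε ∧ h' (x, 0) ≠ 0 := by
  -- Otherwise division by `y` never stops, and `h` has infinite order in `y` at `y = 0` on every
  -- vertical slice.
  by_contra! hcon
  have hall : ∀ k : ℕ, ∃ h' : E → F, AnalyticOnNhd ℂ h' (ball 0 ε) ∧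
      ∀ c ∈ ball (0 : E) ε, h c = c.2 ^ k • h' c := by
    intro k
    induction k with
    | zero => exact ⟨h, hh, fun c _ => by simp⟩
    | succ k ih =>
      obtain ⟨h', hh', e⟩ := ih
      obtain ⟨h'', hh'', e'⟩ := exists_eq_snd_smul isOpen_ball hh' (by
        intro c hc hc2
        have hc0 : ((c.1, 0) : E) = c := by rw [← hc2]
        rw [← hc0]
        exact hcon k h' hh' e c.1 (by rwa [hc0]))
      refine ⟨h'', hh'', fun c hc => ?_⟩
      rw [e c hc, e' c hc, pow_succ, mul_smul]
  obtain ⟨c, hc, hcne⟩ := hne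
  have hc' := mem_ball_prod_iff.1 hc
  have hε : 0 < ε := pos_of_mem_ball hc
  have hslice : ∀ {g : E → F}, AnalyticOnNhd ℂ g (ball 0 ε) →
      AnalyticOnNhd ℂ (fun y => g (c.1, y)) (ball 0 ε) := by
    intro g hg y hy
    exact AnalyticAt.fun_comp (g := g) (f := fun y : ℂ => ((c.1, y) : E))
      (hg (c.1, y) (mem_ball_prod_iff.2 ⟨hc'.1, hy⟩)) (analyticAt_const.prod analyticAt_id)
  have htop : analyticOrderAt (fun y => h (c.1, y)) 0 = ⊤ := by
    refine ENat.eq_top_iff_forall_ge.2 fun k => ?_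
    obtain ⟨h', hh', e⟩ := hall k
    refine (natCast_le_analyticOrderAt (hslice hh 0 (mem_ball_self hε))).2
      ⟨fun y => h' (c.1, y), hslice hh' 0 (mem_ball_self hε), ?_⟩
    filter_upwards [ball_mem_nhds 0 hε] with y hy
    rw [sub_zero]
    exact e (c.1, y) (mem_ball_prod_iff.2 ⟨hc'.1, hy⟩)
  have hzero := (hslice hh).eqOn_zero_of_preconnected_of_eventuallyEq_zero
    (convex_ball 0 ε).isPreconnected (mem_ball_self hε) (analyticOrderAt_eq_top.1 htop)
  exact hcne (hzero hc'.2)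

end Extension

/-! ### Parallel sections of a flat connection over a star-shaped domain. -/

section ParallelSections

variable {W : Type*} [NormedAddCommGroup W] [NormedSpace ℂ W]

/-- The point at time `t` of the segment from `c₀` to `c`. -/
def ray (c₀ : E) (t : ℝ) (c : E) : E := c₀ + (t : ℂ) • (c - c₀)

@[simp] theorem ray_zero (c₀ c : E) : ray c₀ 0 c = c₀ := by simp [ray]

@[simp] theorem ray_one (c₀ c : E) : ray c₀ 1 c = c := by simp [ray]

theorem ray_sub (c₀ : E) (t : ℝ) (c : E) : ray c₀ t c - c₀ = (t : ℂ) • (c - c₀) := by simp [ray]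

theorem ray_ray (c₀ : E) (s t : ℝ) (c : E) : ray c₀ s (ray c₀ t c) = ray c₀ (s * t) c := by
  rw [ray, ray_sub, ray, smul_smul, Complex.ofReal_mul]

theorem continuous_ray (c₀ : E) : Continuous fun q : ℝ × E => ray c₀ q.1 q.2 := by
  unfold ray
  exact continuous_const.add ((Complex.continuous_ofReal.comp continuous_fst).smul
    (continuous_snd.sub continuous_const))

theorem hasDerivAt_ray (c₀ c : E) (t : ℝ) : HasDerivAt (fun t => ray c₀ t c) (c - c₀) t := by
  have h := (Complex.ofRealCLM.hasDerivAt (x := t)).smul_const (c - c₀)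
  simpa [ray] using h.const_add c₀

theorem ray_mem {U : Set E} {c₀ c : E} (hU : StarConvex ℝ c₀ U) (hc : c ∈ U) {t : ℝ}
    (ht : t ∈ Icc (0 : ℝ) 1) : ray c₀ t c ∈ U :=
  hU.add_smul_sub_mem hc ht.1 ht.2

theorem integral_unitInterval (f : ℝ → W) :
    ∫ t : unitInterval, f t = ∫ t in (0 : ℝ)..1, f t := by
  rw [unitInterval.volume_def, integral_subtype_comap measurableSet_Icc,
    intervalIntegral.integral_of_le zero_le_one]
  exact integral_Icc_eq_integral_Ioc

/-- One step of Picard's iteration along the segments from `c₀`. -/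
def picardStep (N : E → E →L[ℂ] W →L[ℂ] W) (c₀ : E) (f : E → W) (c : E) : W :=
  ∫ t in (0 : ℝ)..1, N (ray c₀ t c) (c - c₀) (f (ray c₀ t c))

/-- Picard's iteration along the segments from `c₀`. -/
def picardIterate (N : E → E →L[ℂ] W →L[ℂ] W) (c₀ : E) (v : W) : ℕ → E → W
  | 0 => fun _ => v
  | k + 1 => picardStep N c₀ (picardIterate N c₀ v k)

theorem analyticOnNhd_picardStep [CompleteSpace W] {U : Set E} (hU : IsOpen U) {c₀ : E}
    (hstar : StarConvex ℝ c₀ U) {N : E → E →L[ℂ] W →L[ℂ] W} (hN : AnalyticOnNhd ℂ N U) {f : E → W}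
    (hf : AnalyticOnNhd ℂ f U) : AnalyticOnNhd ℂ (picardStep N c₀ f) U := by
  have hd : ∀ t : unitInterval, ∀ c ∈ U, DifferentiableAt ℂ
      (fun c => N (ray c₀ t c) (c - c₀) (f (ray c₀ t c))) c := by
    intro t c hc
    have hm := ray_mem hstar hc t.2
    have hr : DifferentiableAt ℂ (ray c₀ t) c := by unfold ray; fun_prop
    have h1 := (hN _ hm).differentiableAt.comp c hr
    have h2 := (hf _ hm).differentiableAt.comp c hr
    exact (h1.clm_apply (by fun_prop : DifferentiableAt ℂ (fun c => c - c₀) c)).clm_apply h2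
  have hr : Continuous fun q : unitInterval × E => ray c₀ q.1 q.2 :=
    (continuous_ray c₀).comp ((continuous_subtype_val.comp continuous_fst).prodMk continuous_snd)
  have hr' : MapsTo (fun q : unitInterval × E => ray c₀ q.1 q.2) (univ ×ˢ U) U :=
    fun q hq => ray_mem hstar hq.2 q.1.2
  have := analyticOnNhd_integral_of_separately (volume : Measure unitInterval) hU
    (G := fun t c => N (ray c₀ t c) (c - c₀) (f (ray c₀ t c)))
    (((hN.continuousOn.comp hr.continuousOn hr').clm_apply
      (continuous_snd.sub continuous_const).continuousOn).clm_apply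
      (hf.continuousOn.comp hr.continuousOn hr'))
    (fun t c hc => differentiableAt_fst_slice (hd t c hc))
    (fun t c hc => differentiableAt_snd_slice (hd t c hc))
  convert this using 1
  ext c
  exact (integral_unitInterval _).symm

theorem analyticOnNhd_picardIterate [CompleteSpace W] {U : Set E} (hU : IsOpen U) {c₀ : E}
    (hstar : StarConvex ℝ c₀ U) {N : E → E →L[ℂ] W →L[ℂ] W} (hN : AnalyticOnNhd ℂ N U) (v : W)
    (k : ℕ) : AnalyticOnNhd ℂ (picardIterate N c₀ v k) U := by
  induction k with
  | zero => exact analyticOnNhd_const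
  | succ k ih => exact analyticOnNhd_picardStep hU hstar hN ih

/-- The exponential estimate of Picard's iteration. It is stated along a whole segment for the sake
of the induction: the segment from `c₀` to one of its own points is the same segment reparametrised
(`ray_ray`). -/
theorem norm_picardIterate_le {N : E → E →L[ℂ] W →L[ℂ] W} {c₀ c : E} {M D : ℝ} (hM : 0 ≤ M)
    (hN : ∀ t ∈ Icc (0 : ℝ) 1, ‖N (ray c₀ t c)‖ ≤ M) (hD : ‖c - c₀‖ ≤ D) (v : W) (k : ℕ) :
    ∀ t ∈ Icc (0 : ℝ) 1, ‖picardIterate N c₀ v k (ray c₀ t c)‖ ≤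
      ‖v‖ * (M * D * t) ^ k / k.factorial := by
  have hD0 : 0 ≤ D := (norm_nonneg _).trans hD
  induction k with
  | zero => intro t _; simp [picardIterate]
  | succ k ih =>
    intro t ht
    have hbound : ∀ s ∈ Ioc (0 : ℝ) 1,
        ‖N (ray c₀ s (ray c₀ t c)) (ray c₀ t c - c₀)
          (picardIterate N c₀ v k (ray c₀ s (ray c₀ t c)))‖ ≤
        ‖v‖ * (M * D * t) ^ (k + 1) / k.factorial * s ^ k := by
      intro s hs
      have hst : s * t ∈ Icc (0 : ℝ) 1 :=
        ⟨mul_nonneg hs.1.le ht.1, mul_le_one₀ hs.2 ht.1 ht.2⟩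
      rw [ray_ray, ray_sub]
      calc _ ≤ ‖N (ray c₀ (s * t) c)‖ * ‖(t : ℂ) • (c - c₀)‖ *
            ‖picardIterate N c₀ v k (ray c₀ (s * t) c)‖ := by
            refine (ContinuousLinearMap.le_opNorm _ _).trans ?_
            gcongr
            exact ContinuousLinearMap.le_opNorm _ _
        _ ≤ M * (t * D) * (‖v‖ * (M * D * (s * t)) ^ k / k.factorial) := by
            have h1 : ‖(t : ℂ) • (c - c₀)‖ ≤ t * D := by
              rw [norm_smul, Complex.norm_real, Real.norm_of_nonneg ht.1]
              exact mul_le_mul_of_nonneg_left hD ht.1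
            have h2 := ih _ hst
            have h3 := hN _ hst
            have := ht.1
            gcongr
        _ = _ := by
            rw [show M * D * (s * t) = (M * D * t) * s by ring, mul_pow _ s]
            ring
    have := intervalIntegral.norm_integral_le_of_norm_le (μ := volume)
      (g := fun s => ‖v‖ * (M * D * t) ^ (k + 1) / k.factorial * s ^ k) zero_le_one
      (Filter.Eventually.of_forall hbound) (Continuous.intervalIntegrable (by fun_prop) _ _)
    refine this.trans (le_of_eq ?_)
    rw [intervalIntegral.integral_const_mul, integral_pow, Nat.factorial_succ]
    have : (k.factorial : ℝ) ≠ 0 := by exact_mod_cast k.factorial_ne_zero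
    push_cast
    field_simp
    simp

/-- On a compact neighbourhood, the connection form is bounded along the segments from `c₀`. -/
theorem exists_bound_on_rays {V : Type*} [NormedAddCommGroup V] {U : Set E} (hU : IsOpen U) {c₀ : E}
    (hstar : StarConvex ℝ c₀ U) {N : E → V} (hN : ContinuousOn N U) {c₁ : E} (hc₁ : c₁ ∈ U) :
    ∃ δ > 0, ∃ M D : ℝ, 0 ≤ M ∧ ball c₁ δ ⊆ U ∧ ∀ c ∈ ball c₁ δ, ‖c - c₀‖ ≤ D ∧
      ∀ t ∈ Icc (0 : ℝ) 1, ‖N (ray c₀ t c)‖ ≤ M := by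
  obtain ⟨δ, hδ, hδU⟩ := nhds_basis_closedBall.mem_iff.1 (hU.mem_nhds hc₁)
  have hK : IsCompact ((Icc (0 : ℝ) 1) ×ˢ closedBall c₁ δ) :=
    isCompact_Icc.prod (isCompact_closedBall c₁ δ)
  have hr : MapsTo (fun q : ℝ × E => ray c₀ q.1 q.2) ((Icc (0 : ℝ) 1) ×ˢ closedBall c₁ δ) U :=
    fun q hq => ray_mem hstar (hδU hq.2) hq.1
  obtain ⟨M, hM⟩ := hK.exists_bound_of_continuousOn
    (hN.comp (continuous_ray c₀).continuousOn hr)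
  obtain ⟨D, hD⟩ := (isCompact_closedBall c₁ δ).exists_bound_of_continuousOn
    (f := fun c : E => c - c₀) (by fun_prop)
  refine ⟨δ, hδ, M, D, ?_, ball_subset_closedBall.trans hδU, fun c hc => ⟨?_, fun t ht => ?_⟩⟩
  · exact (norm_nonneg _).trans (hM (0, c₁) ⟨⟨le_rfl, zero_le_one⟩, mem_closedBall_self hδ.le⟩)
  · exact hD c (ball_subset_closedBall hc)
  · exact hM (t, c) ⟨ht, ball_subset_closedBall hc⟩

theorem summable_picard_bound (M D v : ℝ) :
    Summable fun k : ℕ => v * (M * D * 1) ^ k / k.factorial := by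
  simp only [mul_div_assoc]
  exact (Real.summable_pow_div_factorial _).mul_left _

/-- The sum of Picard's iteration. -/
def picardSum (N : E → E →L[ℂ] W →L[ℂ] W) (c₀ : E) (v : W) (c : E) : W :=
  ∑' k, picardIterate N c₀ v k c

/-- The series converges locally uniformly, so the sum is continuous and holomorphic in each
variable separately; Osgood's lemma applies. -/
theorem analyticOnNhd_picardSum [CompleteSpace W] {U : Set E} (hU : IsOpen U) {c₀ : E}
    (hstar : StarConvex ℝ c₀ U) {N : E → E →L[ℂ] W →L[ℂ] W} (hN : AnalyticOnNhd ℂ N U) (v : W) :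
    AnalyticOnNhd ℂ (picardSum N c₀ v) U := by
  intro c₁ hc₁
  obtain ⟨δ, hδ, M, D, hM0, hδU, hM⟩ := exists_bound_on_rays hU hstar hN.continuousOn hc₁
  have hle : ∀ k, ∀ c ∈ ball c₁ δ, ‖picardIterate N c₀ v k c‖ ≤
      ‖v‖ * (M * D * 1) ^ k / k.factorial := by
    intro k c hc
    have := norm_picardIterate_le hM0 (hM c hc).2 (hM c hc).1 v k 1 ⟨zero_le_one, le_rfl⟩
    rwa [ray_one] at this
  have hs := summable_picard_bound M D ‖v‖
  have han := fun k => (analyticOnNhd_picardIterate hU hstar hN v k).mono hδU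
  refine analyticOnNhd_of_separately isOpen_ball
    (continuousOn_tsum (fun k => (han k).continuousOn) hs hle) ?_ ?_ c₁ (mem_ball_self hδ)
  · intro c hc
    have hc' := mem_ball_prod_iff.1 hc
    have hm : ∀ x ∈ ball c₁.1 δ, ((x, c.2) : E) ∈ ball c₁ δ := fun x hx =>
      mem_ball_prod_iff.2 ⟨hx, hc'.2⟩
    refine (Complex.differentiableOn_tsum_of_summable_norm hs (U := ball c₁.1 δ)
      (F := fun k x => picardIterate N c₀ v k (x, c.2)) (fun k x hx => ?_) isOpen_ball
      (fun k x hx => hle k _ (hm x hx))).differentiableAt (isOpen_ball.mem_nhds hc'.1)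
    exact (differentiableAt_fst_slice (c := (x, c.2))
      (han k _ (hm x hx)).differentiableAt).differentiableWithinAt
  · intro c hc
    have hc' := mem_ball_prod_iff.1 hc
    have hm : ∀ y ∈ ball c₁.2 δ, ((c.1, y) : E) ∈ ball c₁ δ := fun y hy =>
      mem_ball_prod_iff.2 ⟨hc'.1, hy⟩
    refine (Complex.differentiableOn_tsum_of_summable_norm hs (U := ball c₁.2 δ)
      (F := fun k y => picardIterate N c₀ v k (c.1, y)) (fun k y hy => ?_) isOpen_ball
      (fun k y hy => hle k _ (hm y hy))).differentiableAt (isOpen_ball.mem_nhds hc'.2)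
    exact (differentiableAt_snd_slice (c := (c.1, y))
      (han k _ (hm y hy)).differentiableAt).differentiableWithinAt

/-- Termwise integration, dominated by the exponential series, turns the recursion into the integral
equation. -/
theorem picardSum_eq [CompleteSpace W] {U : Set E} (hU : IsOpen U) {c₀ : E}
    (hstar : StarConvex ℝ c₀ U) {N : E → E →L[ℂ] W →L[ℂ] W} (hN : AnalyticOnNhd ℂ N U) (v : W)
    {c : E} (hc : c ∈ U) :
    picardSum N c₀ v c = v + picardStep N c₀ (picardSum N c₀ v) c := by
  obtain ⟨δ, hδ, M, D, hM0, hδU, hM⟩ := exists_bound_on_rays hU hstar hN.continuousOn hc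
  obtain ⟨hD, hMc⟩ := hM c (mem_ball_self hδ)
  have hD0 : 0 ≤ D := (norm_nonneg _).trans hD
  have hs := summable_picard_bound M D ‖v‖
  have hle : ∀ k, ∀ t ∈ Icc (0 : ℝ) 1, ‖picardIterate N c₀ v k (ray c₀ t c)‖ ≤
      ‖v‖ * (M * D * 1) ^ k / k.factorial := by
    intro k t ht
    refine (norm_picardIterate_le hM0 hMc hD v k t ht).trans ?_
    have := ht.1
    have := ht.2
    gcongr
  have hsum : ∀ t ∈ Icc (0 : ℝ) 1, Summable fun k => picardIterate N c₀ v k (ray c₀ t c) :=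
    fun t ht => Summable.of_norm_bounded hs fun k => hle k t ht
  have hcont : ∀ k, ContinuousOn
      (fun t : ℝ => N (ray c₀ t c) (c - c₀) (picardIterate N c₀ v k (ray c₀ t c))) (Icc 0 1) := by
    intro k
    have hr : ContinuousOn (fun t : ℝ => ray c₀ t c) (Icc 0 1) :=
      ((continuous_ray c₀).comp (continuous_id.prodMk continuous_const)).continuousOn
    have hr' : MapsTo (fun t : ℝ => ray c₀ t c) (Icc 0 1) U := fun t ht => ray_mem hstar hc ht
    exact ((hN.continuousOn.comp hr hr').clm_apply continuousOn_const).clm_apply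
      ((analyticOnNhd_picardIterate hU hstar hN v k).continuousOn.comp hr hr')
  have h01 : uIoc (0 : ℝ) 1 = Ioc 0 1 := uIoc_of_le zero_le_one
  have key := intervalIntegral.hasSum_integral_of_dominated_convergence (μ := volume) (a := 0)
    (b := 1) (F := fun k t => N (ray c₀ t c) (c - c₀) (picardIterate N c₀ v k (ray c₀ t c)))
    (f := fun t => N (ray c₀ t c) (c - c₀) (picardSum N c₀ v (ray c₀ t c)))
    (fun k _ => M * D * (‖v‖ * (M * D * 1) ^ k / k.factorial)) ?_ ?_ ?_ ?_ ?_
  · have h1 : Summable fun k => picardIterate N c₀ v k c := by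
      simpa using hsum 1 ⟨zero_le_one, le_rfl⟩
    rw [picardSum, h1.tsum_eq_zero_add]
    congr 1
    exact key.tsum_eq
  · intro k
    rw [h01]
    exact ((hcont k).mono Ioc_subset_Icc_self).aestronglyMeasurable measurableSet_Ioc
  · refine fun k => Filter.Eventually.of_forall fun t ht => ?_
    rw [h01] at ht
    have ht' := Ioc_subset_Icc_self ht
    have h1 := hMc t ht'
    have h2 := hle k t ht'
    calc _ ≤ ‖N (ray c₀ t c)‖ * ‖c - c₀‖ * ‖picardIterate N c₀ v k (ray c₀ t c)‖ := by
          refine (ContinuousLinearMap.le_opNorm _ _).trans ?_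
          gcongr
          exact ContinuousLinearMap.le_opNorm _ _
      _ ≤ _ := by gcongr
  · exact Filter.Eventually.of_forall fun t _ => hs.mul_left _
  · exact intervalIntegrable_const
  · refine Filter.Eventually.of_forall fun t ht => ?_
    rw [h01] at ht
    exact (N (ray c₀ t c) (c - c₀)).hasSum (hsum t (Ioc_subset_Icc_self ht)).hasSum

theorem hasDerivAt_comp_ray {V : Type*} [NormedAddCommGroup V] [NormedSpace ℂ V] {f : E → V}
    {c₀ c : E} {t : ℝ} (hf : DifferentiableAt ℂ f (ray c₀ t c)) :
    HasDerivAt (fun t => f (ray c₀ t c)) (fderiv ℂ f (ray c₀ t c) (c - c₀)) t := by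
  have h := hf.hasFDerivAt.restrictScalars ℝ
  exact h.comp_hasDerivAt t (hasDerivAt_ray c₀ c t)

/-- The sum of Picard's iteration is parallel in the radial direction. -/
theorem fderiv_picardSum_radial [CompleteSpace W] {U : Set E} (hU : IsOpen U) {c₀ : E}
    (hstar : StarConvex ℝ c₀ U) {N : E → E →L[ℂ] W →L[ℂ] W} (hN : AnalyticOnNhd ℂ N U) (v : W)
    {c : E} (hc : c ∈ U) :
    fderiv ℂ (picardSum N c₀ v) c (c - c₀) = N c (c - c₀) (picardSum N c₀ v c) := by
  set f := picardSum N c₀ v with hf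
  have hfa := analyticOnNhd_picardSum hU hstar hN v
  set g : ℝ → W := fun t => N (ray c₀ t c) (c - c₀) (f (ray c₀ t c)) with hg
  have hr : ContinuousOn (fun t : ℝ => ray c₀ t c) (Icc 0 1) :=
    ((continuous_ray c₀).comp (continuous_id.prodMk continuous_const)).continuousOn
  have hr' : MapsTo (fun t : ℝ => ray c₀ t c) (Icc 0 1) U := fun t ht => ray_mem hstar hc ht
  have hgc : ContinuousOn g (Icc 0 1) :=
    ((hN.continuousOn.comp hr hr').clm_apply continuousOn_const).clm_apply
      (hfa.continuousOn.comp hr hr')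
  -- The substitution `s ↦ s * t` turns the integral over `[0, 1]` for the point `ray c₀ t c` into
  -- one over `[0, t]`, which can be differentiated in `t`.
  have heq : ∀ t ∈ Icc (0 : ℝ) 1, f (ray c₀ t c) = v + ∫ s in (0 : ℝ)..t, g s := by
    intro t ht
    rw [hf, picardSum_eq hU hstar hN v (hr' ht), picardStep]
    congr 1
    have h := intervalIntegral.smul_integral_comp_mul_right (a := 0) (b := 1) g t
    rw [zero_mul, one_mul] at h
    rw [← h, ← intervalIntegral.integral_smul]
    refine intervalIntegral.integral_congr fun s _ => ?_
    simp only [hg, ray_ray, ray_sub, map_smul, smul_apply]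
    exact (RCLike.real_smul_eq_coe_smul (K := ℂ) t _).symm
  have h1 : HasDerivWithinAt (fun t => f (ray c₀ t c)) (g 1) (Icc 0 1) 1 := by
    have hd := ODE.hasDerivWithinAt_picard_Icc (f := fun t (_ : W) => g t) (α := fun _ => v)
      (u := univ) (t₀ := 0) (tmin := 0) (tmax := 1) ⟨le_rfl, zero_le_one⟩
      (hgc.comp continuous_fst.continuousOn fun q hq => hq.1) continuousOn_const
      (fun _ _ => mem_univ _) v (t := 1) ⟨zero_le_one, le_rfl⟩
    exact hd.congr_of_mem heq ⟨zero_le_one, le_rfl⟩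
  have h2 := (hasDerivAt_comp_ray (f := f) (c₀ := c₀) (c := c) (t := 1)
    (by rw [ray_one]; exact (hfa c hc).differentiableAt)).hasDerivWithinAt (s := Icc 0 1)
  have h3 := UniqueDiffWithinAt.eq_deriv _
    (uniqueDiffOn_Icc zero_lt_one 1 ⟨zero_le_one, le_rfl⟩) h2 h1
  simpa [hg] using h3

set_option synthInstance.maxHeartbeats 100000 in
/-- A flat connection on a trivial bundle over a star-shaped domain has a parallel section with
prescribed value at the centre. -/
theorem exists_parallel_section [CompleteSpace W] {U : Set E} (hU : IsOpen U) {c₀ : E}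
    (hc₀ : c₀ ∈ U) (hstar : StarConvex ℝ c₀ U) {N : E → E →L[ℂ] W →L[ℂ] W}
    (hN : AnalyticOnNhd ℂ N U)
    (hflat : ∀ c ∈ U, ∀ (X Y : E) (w : W), fderiv ℂ N c Y X w + N c X (N c Y w) =
      fderiv ℂ N c X Y w + N c Y (N c X w)) (v : W) :
    ∃ f : E → W, AnalyticOnNhd ℂ f U ∧ f c₀ = v ∧
      ∀ c ∈ U, ∀ X, fderiv ℂ f c X = N c X (f c) := by
  set f := picardSum N c₀ v with hf
  have hfa := analyticOnNhd_picardSum hU hstar hN v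
  rw [← hf] at hfa
  have heuler : ∀ c ∈ U, fderiv ℂ f c (c - c₀) = N c (c - c₀) (f c) :=
    fun c hc => fderiv_picardSum_radial hU hstar hN v hc
  refine ⟨f, hfa, ?_, fun c hc X => ?_⟩
  · rw [hf, picardSum_eq hU hstar hN v hc₀, picardStep]
    simp
  have hfd : ∀ p ∈ U, HasFDerivAt f (fderiv ℂ f p) p := fun p hp =>
    (hfa p hp).differentiableAt.hasFDerivAt
  have hNd : ∀ p ∈ U, HasFDerivAt N (fderiv ℂ N p) p := fun p hp =>
    (hN p hp).differentiableAt.hasFDerivAt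
  have hf2 : ∀ p ∈ U, HasFDerivAt (fderiv ℂ f) (fderiv ℂ (fderiv ℂ f) p) p := fun p hp =>
    (hfa p hp).fderiv.differentiableAt.hasFDerivAt
  -- the derivative of the radial equation
  have hdeuler : ∀ p ∈ U, fderiv ℂ (fderiv ℂ f) p X (p - c₀) + fderiv ℂ f p X =
      fderiv ℂ N p X (p - c₀) (f p) + N p X (f p) + N p (p - c₀) (fderiv ℂ f p X) := by
    intro p hp
    have hid : HasFDerivAt (fun c : E => c - c₀) (ContinuousLinearMap.id ℂ E) p :=
      (hasFDerivAt_id p).sub_const c₀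
    have e1 := (hf2 p hp).clm_apply hid
    have e2 := ((hNd p hp).clm_apply hid).clm_apply (hfd p hp)
    have e3 : (fun c => fderiv ℂ f c (c - c₀)) =ᶠ[𝓝 p] fun c => N c (c - c₀) (f c) := by
      filter_upwards [hU.mem_nhds hp] with c hc using heuler c hc
    have e4 := congrArg (fun L : E →L[ℂ] W => L X) (e1.unique (e2.congr_of_eventuallyEq e3))
    simp only [add_apply, ContinuousLinearMap.comp_apply,
      ContinuousLinearMap.flip_apply, ContinuousLinearMap.id_apply] at e4
    rw [add_comm, e4]
    abel
  have hsymm : ∀ p ∈ U, ∀ Y, fderiv ℂ (fderiv ℂ f) p X Y = fderiv ℂ (fderiv ℂ f) p Y X := by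
    intro p hp Y
    exact ((hfa p hp).contDiffAt.isSymmSndFDerivAt (n := 2) (by simp)) X Y
  -- the defect, along the segment
  let R : E → W := fun p => fderiv ℂ f p X - N p X (f p)
  have hR : ∀ p ∈ U, HasFDerivAt R (fderiv ℂ R p) p ∧ ∀ Y, fderiv ℂ R p Y =
      fderiv ℂ (fderiv ℂ f) p Y X - (fderiv ℂ N p Y X (f p) + N p X (fderiv ℂ f p Y)) := by
    intro p hp
    have e1 := (hf2 p hp).clm_apply (hasFDerivAt_const X p)
    have e2 := ((hNd p hp).clm_apply (hasFDerivAt_const X p)).clm_apply (hfd p hp)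
    have e3 : HasFDerivAt R _ p := e1.sub e2
    refine ⟨e3.differentiableAt.hasFDerivAt, fun Y => ?_⟩
    rw [e3.fderiv]
    simp only [sub_apply, add_apply, ContinuousLinearMap.comp_apply,
      ContinuousLinearMap.flip_apply, ContinuousLinearMap.comp_zero, zero_add]
    abel
  obtain ⟨δ, hδ, M, D, hM0, hδU, hM⟩ := exists_bound_on_rays hU hstar hN.continuousOn hc
  obtain ⟨hD, hMc⟩ := hM c (mem_ball_self hδ)
  -- The differentiated radial equation, the symmetry of the second derivative and flatness combine
  -- into a linear equation for `t • R`. The factor `t` comes from `p - c₀ = t • (c - c₀)`; it makes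
  -- the initial value zero, so that Grönwall's inequality gives `R = 0`.
  have hder : ∀ t ∈ Icc (0 : ℝ) 1, HasDerivAt (fun t : ℝ => (t : ℂ) • R (ray c₀ t c))
      (N (ray c₀ t c) (c - c₀) ((t : ℂ) • R (ray c₀ t c))) t := by
    intro t ht
    have hp := ray_mem hstar hc ht
    have h1 := (Complex.ofRealCLM.hasDerivAt (x := t)).smul
      (hasDerivAt_comp_ray (f := R) (c₀ := c₀) (c := c) (t := t) (hR _ hp).1.differentiableAt)
    convert! h1 using 1
    rw [(hR _ hp).2]
    have hp' := ray_sub c₀ t c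
    set p := ray c₀ t c
    have k1 := hdeuler p hp
    have k2 := heuler p hp
    have k3 := hflat p hp X (p - c₀) (f p)
    rw [hsymm p hp] at k1
    rw [hp'] at k1 k2 k3
    generalize c - c₀ = d at k1 k2 k3 ⊢
    simp only [map_smul, smul_apply] at k1 k2 k3 ⊢
    simp only [R, Complex.ofRealCLM_apply, map_sub, Complex.ofReal_one, one_smul, smul_sub,
      smul_add]
    rw [show (t : ℂ) • N p X (fderiv ℂ f p d) = N p X ((t : ℂ) • fderiv ℂ f p d) from
      (map_smul _ _ _).symm, k2, map_smul]
    linear_combination (norm := module) k3 - k1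
  have hz := eq_zero_of_abs_deriv_le_mul_abs_self_of_eq_zero_right (a := 0) (b := 1) (K := M * D)
    (f := fun t : ℝ => (t : ℂ) • R (ray c₀ t c))
    (f' := fun t => N (ray c₀ t c) (c - c₀) ((t : ℂ) • R (ray c₀ t c)))
    (fun t ht => (hder t ht).continuousAt.continuousWithinAt)
    (fun t ht => (hder t (Ico_subset_Icc_self ht)).hasDerivWithinAt) (by simp) (by
      intro t ht
      have h1 := hMc t (Ico_subset_Icc_self ht)
      calc _ ≤ ‖N (ray c₀ t c)‖ * ‖c - c₀‖ * ‖(t : ℂ) • R (ray c₀ t c)‖ := by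
            refine (ContinuousLinearMap.le_opNorm _ _).trans ?_
            gcongr
            exact ContinuousLinearMap.le_opNorm _ _
        _ ≤ _ := by gcongr) 1 ⟨zero_le_one, le_rfl⟩
  simp only [Complex.ofReal_one, one_smul, ray_one, R] at hz
  exact sub_eq_zero.1 hz

end ParallelSections

/-! ### Closed forms whose kernels are leaves, and parallel forms. -/

section Riccati

/-- A torsion-free Riccati equation with holomorphic coefficients on the open set `Ω`. -/
structure IsTorsionFreeRiccati (α β γ : OneForm) (Ω : Set E) : Prop where
  analytic_α : AnalyticOnNhd ℂ α Ω
  analytic_β : AnalyticOnNhd ℂ β Ω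
  analytic_γ : AnalyticOnNhd ℂ γ Ω
  extD_α : ∀ c ∈ Ω, ∀ X Y : E, extD α c X Y + wedge (α c) (β c) X Y = 0
  extD_β : ∀ c ∈ Ω, ∀ X Y : E, extD β c X Y + 2 * wedge (α c) (γ c) X Y = 0
  extD_γ : ∀ c ∈ Ω, ∀ X Y : E, extD γ c X Y + wedge (β c) (γ c) X Y = 0
  torsion : ∀ c ∈ Ω, ∀ X Y : E, extD (kappa α β γ) c X Y = 0

/-- The first diagonal entry of the connection form on `T^*` lifting the Riccati equation. -/
def connA (α β γ : OneForm) : OneForm := fun c => (1 / 2 : ℂ) • (kappa α β γ c - β c)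

/-- The second diagonal entry of the connection form on `T^*` lifting the Riccati equation. -/
def connE (α β γ : OneForm) : OneForm := fun c => (1 / 2 : ℂ) • (kappa α β γ c + β c)

/-- At `c`, the `1`-form `w` is parallel for the torsion-free connection lifting the Riccati
equation. -/
def IsParallelAt (α β γ w : OneForm) (c : E) : Prop :=
  ∀ X : E, fderiv ℂ w c X (1, 0) = connA α β γ c X * w c (1, 0) + γ c X * w c (0, 1) ∧
    fderiv ℂ w c X (0, 1) = -(α c X) * w c (1, 0) + connE α β γ c X * w c (0, 1)

/-- At `c`, the kernel of the `1`-form `w` is tangent to a solution of the Riccati equation. -/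
def IsLeafAt (α β γ w : OneForm) (c : E) : Prop :=
  ∀ X : E, w c (1, 0) * fderiv ℂ w c X (0, 1) - w c (0, 1) * fderiv ℂ w c X (1, 0) +
    α c X * w c (1, 0) ^ 2 - β c X * (w c (1, 0) * w c (0, 1)) + γ c X * w c (0, 1) ^ 2 = 0

theorem clm_apply_eq (l : E →L[ℂ] ℂ) (X : E) : l X = X.1 * l (1, 0) + X.2 * l (0, 1) := by
  have h : X = X.1 • ((1, 0) : E) + X.2 • ((0, 1) : E) := by ext <;> simp
  conv_lhs => rw [h]
  simp only [map_add, map_smul, smul_eq_mul]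

theorem clm_ext_basis {l l' : E →L[ℂ] ℂ} (h1 : l (1, 0) = l' (1, 0)) (h2 : l (0, 1) = l' (0, 1)) :
    l = l' := by
  ext <;> simp [h1, h2]

theorem fderiv_apply_eq (w : OneForm) (c X Y : E) :
    fderiv ℂ w c X Y = X.1 * (Y.1 * fderiv ℂ w c (1, 0) (1, 0) + Y.2 * fderiv ℂ w c (1, 0) (0, 1)) +
      X.2 * (Y.1 * fderiv ℂ w c (0, 1) (1, 0) + Y.2 * fderiv ℂ w c (0, 1) (0, 1)) := by
  have h : X = X.1 • ((1, 0) : E) + X.2 • ((0, 1) : E) := by ext <;> simp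
  conv_lhs => rw [h]
  simp only [map_add, map_smul, add_apply, smul_apply, smul_eq_mul]
  rw [clm_apply_eq (fderiv ℂ w c (1, 0)) Y, clm_apply_eq (fderiv ℂ w c (0, 1)) Y]

theorem kappa_apply (α β γ : OneForm) (c X : E) : kappa α β γ c X =
    (2 * γ c (0, 1) - β c (1, 0)) * X.1 + (β c (0, 1) - 2 * α c (1, 0)) * X.2 := by
  simp [kappa]

theorem connA_apply (α β γ : OneForm) (c X : E) :
    connA α β γ c X = (kappa α β γ c X - β c X) / 2 := by
  simp only [connA, smul_apply, sub_apply, smul_eq_mul]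
  ring

theorem connE_apply (α β γ : OneForm) (c X : E) :
    connE α β γ c X = (kappa α β γ c X + β c X) / 2 := by
  simp only [connE, smul_apply, add_apply, smul_eq_mul]
  ring

/-- The trace `κ` cancels in `w₁ dw₂ - w₂ dw₁`; only the trace-free part, which is the Riccati
equation, survives. -/
theorem IsParallelAt.isLeafAt {α β γ w : OneForm} {c : E} (h : IsParallelAt α β γ w c) :
    IsLeafAt α β γ w c := by
  intro X
  rw [(h X).1, (h X).2, connA_apply, connE_apply]
  ring

theorem extD_eq_zero_iff (w : OneForm) (c : E) :
    (∀ X Y, extD w c X Y = 0) ↔ fderiv ℂ w c (1, 0) (0, 1) = fderiv ℂ w c (0, 1) (1, 0) := by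
  constructor
  · intro h
    exact sub_eq_zero.1 (h (1, 0) (0, 1))
  · intro h X Y
    rw [extD, fderiv_apply_eq w c X, fderiv_apply_eq w c Y, h]
    ring

/-- This is what the choice of `κ` achieves: the `dy` component of `connA` is `-α₁` and the `dx`
component of `connE` is `γ₂`. -/
theorem IsParallelAt.closed {α β γ w : OneForm} {c : E} (h : IsParallelAt α β γ w c) :
    ∀ X Y, extD w c X Y = 0 := by
  rw [extD_eq_zero_iff, (h (1, 0)).2, (h (0, 1)).1, connA_apply, connE_apply, kappa_apply,
    kappa_apply]
  simp only [mul_one, mul_zero]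
  ring

/-- A pencil of closed forms tangent to solutions of the Riccati equation consists of parallel
forms. -/
theorem isParallelAt_of_pencil {α β γ w₀ w₁ : OneForm} {c : E}
    (hd₀ : DifferentiableAt ℂ w₀ c) (hd₁ : DifferentiableAt ℂ w₁ c)
    (hw : wedge (w₀ c) (w₁ c) (1, 0) (0, 1) ≠ 0) (h₀ : IsLeafAt α β γ w₀ c)
    (h₁ : IsLeafAt α β γ w₁ c) (h₂ : IsLeafAt α β γ (w₀ + w₁) c)
    (hc₀ : ∀ X Y, extD w₀ c X Y = 0) (hc₁ : ∀ X Y, extD w₁ c X Y = 0) :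
    IsParallelAt α β γ w₀ c ∧ IsParallelAt α β γ w₁ c := by
  rw [extD_eq_zero_iff] at hc₀ hc₁
  rw [wedge] at hw
  simp only [IsLeafAt, fderiv_add hd₀ hd₁, Pi.add_apply, add_apply] at h₀ h₁ h₂
  -- the deviation from being parallel is a scalar form `p`
  have key : ∀ X, ∃ p : ℂ,
      (fderiv ℂ w₀ c X (1, 0) = connA α β γ c X * w₀ c (1, 0) + γ c X * w₀ c (0, 1) +
          p * w₀ c (1, 0) ∧
        fderiv ℂ w₀ c X (0, 1) = -(α c X) * w₀ c (1, 0) + connE α β γ c X * w₀ c (0, 1) +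
          p * w₀ c (0, 1)) ∧
      (fderiv ℂ w₁ c X (1, 0) = connA α β γ c X * w₁ c (1, 0) + γ c X * w₁ c (0, 1) +
          p * w₁ c (1, 0) ∧
        fderiv ℂ w₁ c X (0, 1) = -(α c X) * w₁ c (1, 0) + connE α β γ c X * w₁ c (0, 1) +
          p * w₁ c (0, 1)) := by
    intro X
    have e0 := h₀ X
    have e1 := h₁ X
    have e2 := h₂ X
    simp only [connA_apply, connE_apply]
    generalize fderiv ℂ w₀ c X (1, 0) = f₀' at *
    generalize fderiv ℂ w₀ c X (0, 1) = m₀' at *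
    generalize fderiv ℂ w₁ c X (1, 0) = f₁' at *
    generalize fderiv ℂ w₁ c X (0, 1) = m₁' at *
    generalize w₀ c (1, 0) = f₀ at *
    generalize w₀ c (0, 1) = m₀ at *
    generalize w₁ c (1, 0) = f₁ at *
    generalize w₁ c (0, 1) = m₁ at *
    generalize α c X = a at *
    generalize β c X = b at *
    generalize γ c X = g at *
    generalize kappa α β γ c X = k at *
    have hne : f₀ * m₁ - m₀ * f₁ ≠ 0 := by
      intro h
      apply hw
      linear_combination h
    -- The leaf conditions for `w₀` and `w₁` make each deviation proportional to the form itself.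
    -- The polarised condition `e2 - e0 - e1`, coming from `w₀ + w₁`, makes the two factors equal.
    obtain ⟨p, hp⟩ : ∃ p, p * (f₀ * m₁ - m₀ * f₁) = (f₀' - ((k - b) / 2 * f₀ + g * m₀)) * m₁ -
        (m₀' - (-a * f₀ + (k + b) / 2 * m₀)) * f₁ := ⟨_, div_mul_cancel₀ _ hne⟩
    refine ⟨p, ⟨?_, ?_⟩, ?_, ?_⟩
    all_goals apply mul_right_cancel₀ hne
    · linear_combination f₁ * e0 - f₀ * hp
    · linear_combination m₁ * e0 - m₀ * hp
    · linear_combination f₁ * (e2 - e0 - e1) - f₀ * e1 - f₁ * hp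
    · linear_combination m₁ * (e2 - e0 - e1) - m₀ * e1 - m₁ * hp
  obtain ⟨p, hp₀, hp₁⟩ := key (1, 0)
  obtain ⟨q, hq₀, hq₁⟩ := key (0, 1)
  -- The parallel part contributes nothing to the exterior derivative, so closedness reads `(p dx +
  -- q dy) ∧ w₀ = 0`, and likewise for `w₁`. Independence then forces `p = q = 0`.
  have e₀ : p * w₀ c (0, 1) = q * w₀ c (1, 0) := by
    rw [hp₀.2, hq₀.1] at hc₀
    simp only [connA_apply, connE_apply, kappa_apply, mul_one, mul_zero] at hc₀
    linear_combination hc₀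
  have e₁ : p * w₁ c (0, 1) = q * w₁ c (1, 0) := by
    rw [hp₁.2, hq₁.1] at hc₁
    simp only [connA_apply, connE_apply, kappa_apply, mul_one, mul_zero] at hc₁
    linear_combination hc₁
  have hp : p = 0 := by
    refine (mul_eq_zero.1 ?_).resolve_right hw
    linear_combination w₀ c (1, 0) * e₁ - w₁ c (1, 0) * e₀
  have hq : q = 0 := by
    refine (mul_eq_zero.1 ?_).resolve_right hw
    linear_combination w₀ c (0, 1) * e₁ - w₁ c (0, 1) * e₀
  rw [hp] at hp₀ hp₁
  rw [hq] at hq₀ hq₁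
  constructor
  all_goals
    intro X
    constructor
    all_goals
      rw [fderiv_apply_eq]
      simp only [clm_apply_eq (α c) X, clm_apply_eq (γ c) X, clm_apply_eq (connA α β γ c) X,
        clm_apply_eq (connE α β γ c) X, hp₀.1, hp₀.2, hp₁.1, hp₁.2, hq₀.1, hq₀.2, hq₁.1, hq₁.2]
      ring

end Riccati

/-! ### Flatness of the torsion-free connection and existence of parallel forms. -/

section Riccati

variable {α β γ : OneForm} {Ω : Set E}

theorem analyticAt_clm_apply {V V' : Type*} [NormedAddCommGroup V] [NormedSpace ℂ V]
    [NormedAddCommGroup V'] [NormedSpace ℂ V'] {w : E → V →L[ℂ] V'} {c : E} (h : AnalyticAt ℂ w c)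
    (X : V) : AnalyticAt ℂ (fun c => w c X) c :=
  ((ContinuousLinearMap.apply ℂ V' X).analyticAt _).fun_comp h

theorem analyticAt_kappa {c : E} (hα : AnalyticAt ℂ α c) (hβ : AnalyticAt ℂ β c)
    (hγ : AnalyticAt ℂ γ c) : AnalyticAt ℂ (kappa α β γ) c := by
  unfold kappa
  exact (((analyticAt_const.mul (analyticAt_clm_apply hγ _)).sub
    (analyticAt_clm_apply hβ _)).smul analyticAt_const).add
    (((analyticAt_clm_apply hβ _).sub (analyticAt_const.mul
      (analyticAt_clm_apply hα _))).smul analyticAt_const)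

namespace IsTorsionFreeRiccati

variable (h : IsTorsionFreeRiccati α β γ Ω)
include h

theorem analytic_kappa : AnalyticOnNhd ℂ (kappa α β γ) Ω := fun c hc =>
  analyticAt_kappa (h.analytic_α c hc) (h.analytic_β c hc) (h.analytic_γ c hc)

theorem analytic_connA : AnalyticOnNhd ℂ (connA α β γ) Ω := fun c hc =>
  ((h.analytic_kappa c hc).sub (h.analytic_β c hc)).fun_const_smul

theorem analytic_connE : AnalyticOnNhd ℂ (connE α β γ) Ω := fun c hc =>
  ((h.analytic_kappa c hc).add (h.analytic_β c hc)).fun_const_smul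

/-- Half the difference of the closed form `κ` and of `β`, whose differential is given by the
Frobenius equation. The hypothesis `dκ = 0` enters the flatness only through the diagonal entries.
-/
theorem extD_connA {c : E} (hc : c ∈ Ω) (X Y : E) :
    extD (connA α β γ) c X Y = wedge (α c) (γ c) X Y := by
  have h1 : fderiv ℂ (connA α β γ) c =
      (1 / 2 : ℂ) • (fderiv ℂ (kappa α β γ) c - fderiv ℂ β c) := by
    have hk := (h.analytic_kappa c hc).differentiableAt
    have hb := (h.analytic_β c hc).differentiableAt
    exact ((hk.hasFDerivAt.sub hb.hasFDerivAt).const_smul (1 / 2 : ℂ)).fderiv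
  have h2 := h.torsion c hc X Y
  have h3 := h.extD_β c hc X Y
  simp only [extD] at h2 h3 ⊢
  simp only [h1, smul_apply, sub_apply, smul_eq_mul]
  linear_combination h2 / 2 - h3 / 2

theorem extD_connE {c : E} (hc : c ∈ Ω) (X Y : E) :
    extD (connE α β γ) c X Y = -wedge (α c) (γ c) X Y := by
  have h1 : fderiv ℂ (connE α β γ) c =
      (1 / 2 : ℂ) • (fderiv ℂ (kappa α β γ) c + fderiv ℂ β c) := by
    have hk := (h.analytic_kappa c hc).differentiableAt
    have hb := (h.analytic_β c hc).differentiableAt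
    exact ((hk.hasFDerivAt.add hb.hasFDerivAt).const_smul (1 / 2 : ℂ)).fderiv
  have h2 := h.torsion c hc X Y
  have h3 := h.extD_β c hc X Y
  simp only [extD] at h2 h3 ⊢
  simp only [h1, smul_apply, add_apply, smul_eq_mul]
  linear_combination h2 / 2 + h3 / 2

end IsTorsionFreeRiccati

/-- The endomorphism-valued form with matrix entries `a`, `b`, `c`, `d`. -/
def matrixForm (a b c d : OneForm) : E → E →L[ℂ] (ℂ × ℂ) →L[ℂ] (ℂ × ℂ) := fun p =>
  ((a p).smulRight ((ContinuousLinearMap.inl ℂ ℂ ℂ).comp (ContinuousLinearMap.fst ℂ ℂ ℂ)) +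
    (b p).smulRight ((ContinuousLinearMap.inl ℂ ℂ ℂ).comp (ContinuousLinearMap.snd ℂ ℂ ℂ))) +
  ((c p).smulRight ((ContinuousLinearMap.inr ℂ ℂ ℂ).comp (ContinuousLinearMap.fst ℂ ℂ ℂ)) +
    (d p).smulRight ((ContinuousLinearMap.inr ℂ ℂ ℂ).comp (ContinuousLinearMap.snd ℂ ℂ ℂ)))

theorem matrixForm_apply (a b c d : OneForm) (p X : E) (v : ℂ × ℂ) :
    matrixForm a b c d p X v = (a p X * v.1 + b p X * v.2, c p X * v.1 + d p X * v.2) := by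
  ext <;> simp [matrixForm]

theorem hasFDerivAt_smulRight {V : Type*} [NormedAddCommGroup V] [NormedSpace ℂ V] {a : OneForm}
    {p : E} (ha : DifferentiableAt ℂ a p) (v : V) : HasFDerivAt (fun q => (a q).smulRight v)
      (((ContinuousLinearMap.smulRightL ℂ E V).flip v).comp (fderiv ℂ a p)) p :=
  ((ContinuousLinearMap.smulRightL ℂ E V).flip v).hasFDerivAt.comp p ha.hasFDerivAt

theorem analyticAt_smulRight {V : Type*} [NormedAddCommGroup V] [NormedSpace ℂ V] {a : OneForm}
    {p : E} (ha : AnalyticAt ℂ a p) (v : V) : AnalyticAt ℂ (fun q => (a q).smulRight v) p :=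
  (((ContinuousLinearMap.smulRightL ℂ E V).flip v).analyticAt _).fun_comp ha

theorem analyticAt_matrixForm {a b c d : OneForm} {p : E} (ha : AnalyticAt ℂ a p)
    (hb : AnalyticAt ℂ b p) (hc : AnalyticAt ℂ c p) (hd : AnalyticAt ℂ d p) :
    AnalyticAt ℂ (matrixForm a b c d) p :=
  ((analyticAt_smulRight ha _).add (analyticAt_smulRight hb _)).add
    ((analyticAt_smulRight hc _).add (analyticAt_smulRight hd _))

theorem fderiv_matrixForm {a b c d : OneForm} {p : E} (ha : DifferentiableAt ℂ a p)
    (hb : DifferentiableAt ℂ b p) (hc : DifferentiableAt ℂ c p) (hd : DifferentiableAt ℂ d p)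
    (Y X : E) (v : ℂ × ℂ) : fderiv ℂ (matrixForm a b c d) p Y X v =
      (fderiv ℂ a p Y X * v.1 + fderiv ℂ b p Y X * v.2,
        fderiv ℂ c p Y X * v.1 + fderiv ℂ d p Y X * v.2) := by
  have key := ((hasFDerivAt_smulRight ha
      ((ContinuousLinearMap.inl ℂ ℂ ℂ).comp (ContinuousLinearMap.fst ℂ ℂ ℂ))).add
    (hasFDerivAt_smulRight hb
      ((ContinuousLinearMap.inl ℂ ℂ ℂ).comp (ContinuousLinearMap.snd ℂ ℂ ℂ)))).add
    ((hasFDerivAt_smulRight hc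
      ((ContinuousLinearMap.inr ℂ ℂ ℂ).comp (ContinuousLinearMap.fst ℂ ℂ ℂ))).add
    (hasFDerivAt_smulRight hd
      ((ContinuousLinearMap.inr ℂ ℂ ℂ).comp (ContinuousLinearMap.snd ℂ ℂ ℂ))))
  have key' : HasFDerivAt (matrixForm a b c d) _ p := key
  rw [key'.fderiv]
  ext <;> simp

/-- The Frobenius equations and `dκ = 0` together are the flatness of the connection matrix.
Extension by zero outside `Ω` removes the ambiguity of total functions, so that the space of
parallel forms is unique. -/
theorem exists_parallel_form (h : IsTorsionFreeRiccati α β γ Ω) (hΩ : IsOpen Ω)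
    (hconv : Convex ℝ Ω) {c₀ : E} (hc₀ : c₀ ∈ Ω) (l : E →L[ℂ] ℂ) :
    ∃ w : OneForm, AnalyticOnNhd ℂ w Ω ∧ w c₀ = l ∧ (∀ c ∉ Ω, w c = 0) ∧
      ∀ c ∈ Ω, IsParallelAt α β γ w c := by
  classical
  obtain ⟨f, hf, hf0, hfd⟩ := exists_parallel_section (W := ℂ × ℂ) hΩ hc₀
    (hconv.starConvex hc₀)
    (N := matrixForm (connA α β γ) γ (-α) (connE α β γ))
    (fun c hc => analyticAt_matrixForm (h.analytic_connA c hc) (h.analytic_γ c hc)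
      (h.analytic_α c hc).neg (h.analytic_connE c hc)) (by
      intro c hc X Y v
      have e1 := h.extD_connA hc X Y
      have e2 := h.extD_connE hc X Y
      have e3 := h.extD_α c hc X Y
      have e4 := h.extD_γ c hc X Y
      have dA := (h.analytic_connA c hc).differentiableAt
      have dE := (h.analytic_connE c hc).differentiableAt
      have dα := (h.analytic_α c hc).differentiableAt
      have dγ := (h.analytic_γ c hc).differentiableAt
      rw [fderiv_matrixForm dA dγ dα.neg dE, fderiv_matrixForm dA dγ dα.neg dE, fderiv_neg]
      simp only [extD, wedge] at e1 e2 e3 e4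
      simp only [matrixForm_apply, Pi.neg_apply, neg_apply]
      -- In this form the Frobenius equations for `α` and `γ` are the off-diagonal curvature
      -- equations.
      have hβ : ∀ Z, β c Z = connE α β γ c Z - connA α β γ c Z := by
        intro Z
        rw [connA_apply, connE_apply]
        ring
      simp only [hβ] at e3 e4
      ext
      · simp only [Prod.fst_add]
        linear_combination -v.1 * e1 - v.2 * e4
      · simp only [Prod.snd_add]
        linear_combination v.1 * e3 - v.2 * e2) (l (1, 0), l (0, 1))
  set w' : OneForm := fun c => (f c).1 • ContinuousLinearMap.fst ℂ ℂ ℂ +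
    (f c).2 • ContinuousLinearMap.snd ℂ ℂ ℂ with hw'
  have hw'a : AnalyticOnNhd ℂ w' Ω := fun c hc =>
    ((analyticAt_fst.fun_comp (hf c hc)).smul analyticAt_const).add
      ((analyticAt_snd.fun_comp (hf c hc)).smul analyticAt_const)
  have hev : ∀ c ∈ Ω, (fun c => if c ∈ Ω then w' c else 0) =ᶠ[𝓝 c] w' := fun c hc => by
    filter_upwards [hΩ.mem_nhds hc] with c' hc' using if_pos hc'
  refine ⟨fun c => if c ∈ Ω then w' c else 0, fun c hc => (hw'a c hc).congr (hev c hc).symm, ?_,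
    fun c hc => if_neg hc, fun c hc X => ?_⟩
  · simp only [if_pos hc₀]
    exact clm_ext_basis (by simp [hw', hf0]) (by simp [hw', hf0])
  · rw [(hev c hc).fderiv_eq]
    simp only [if_pos hc]
    have hfc := (hf c hc).differentiableAt.hasFDerivAt
    have hd : HasFDerivAt w' _ c := (hfc.fst.smul_const (ContinuousLinearMap.fst ℂ ℂ ℂ)).add
      (hfc.snd.smul_const (ContinuousLinearMap.snd ℂ ℂ ℂ))
    have hX := hfd c hc X
    rw [matrixForm_apply] at hX
    rw [hd.fderiv]
    simp [hX, hw']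

/-- A solution of a homogeneous linear first-order system which vanishes at one point of a convex
open set vanishes identically. -/
theorem eq_zero_of_fderiv_eq_mul {Ω : Set E} (hΩ : IsOpen Ω) (hconv : Convex ℝ Ω) {η : OneForm}
    (hη : ContinuousOn η Ω) {D : E → ℂ} (hD : DifferentiableOn ℂ D Ω)
    (heq : ∀ c ∈ Ω, ∀ X, fderiv ℂ D c X = η c X * D c) {c₁ : E} (hc₁ : c₁ ∈ Ω) (h0 : D c₁ = 0)
    {c : E} (hc : c ∈ Ω) : D c = 0 := by
  have hstar := hconv.starConvex hc₁
  obtain ⟨δ, hδ, M, R, hM0, -, hM⟩ := exists_bound_on_rays hΩ hstar hη hc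
  obtain ⟨hR, hMc⟩ := hM c (mem_ball_self hδ)
  have hder : ∀ t ∈ Icc (0 : ℝ) 1, HasDerivAt (fun t : ℝ => D (ray c₁ t c))
      (η (ray c₁ t c) (c - c₁) * D (ray c₁ t c)) t := by
    intro t ht
    have hm := ray_mem hstar hc ht
    rw [← heq _ hm]
    exact hasDerivAt_comp_ray (hD.differentiableAt (hΩ.mem_nhds hm))
  have := eq_zero_of_abs_deriv_le_mul_abs_self_of_eq_zero_right (a := 0) (b := 1) (K := M * R)
    (fun t ht => (hder t ht).continuousAt.continuousWithinAt)
    (fun t ht => (hder t (Ico_subset_Icc_self ht)).hasDerivWithinAt) (by simpa using h0) (by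
      intro t ht
      rw [norm_mul]
      have h1 := hMc t (Ico_subset_Icc_self ht)
      have h2 := (η (ray c₁ t c)).le_opNorm (c - c₁)
      gcongr
      exact h2.trans (by gcongr)) 1 ⟨zero_le_one, le_rfl⟩
  simpa using this

theorem fderiv_wedge_basis {w₀ w₁ : OneForm} {c : E} (h₀ : DifferentiableAt ℂ w₀ c)
    (h₁ : DifferentiableAt ℂ w₁ c) :
    DifferentiableAt ℂ (fun c => wedge (w₀ c) (w₁ c) (1, 0) (0, 1)) c ∧
    ∀ X, fderiv ℂ (fun c => wedge (w₀ c) (w₁ c) (1, 0) (0, 1)) c X =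
      fderiv ℂ w₀ c X (1, 0) * w₁ c (0, 1) + w₀ c (1, 0) * fderiv ℂ w₁ c X (0, 1) -
        (fderiv ℂ w₀ c X (0, 1) * w₁ c (1, 0) + w₀ c (0, 1) * fderiv ℂ w₁ c X (1, 0)) := by
  have k := fun X : E => hasFDerivAt_const (𝕜 := ℂ) X c
  have hd : HasFDerivAt (fun c => wedge (w₀ c) (w₁ c) (1, 0) (0, 1)) _ c :=
    ((h₀.hasFDerivAt.clm_apply (k (1, 0))).mul (h₁.hasFDerivAt.clm_apply (k (0, 1)))).sub
      ((h₀.hasFDerivAt.clm_apply (k (0, 1))).mul (h₁.hasFDerivAt.clm_apply (k (1, 0))))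
  refine ⟨hd.differentiableAt, fun X => ?_⟩
  rw [hd.fderiv]
  simp only [sub_apply, add_apply, smul_apply, ContinuousLinearMap.comp_zero, zero_add,
    ContinuousLinearMap.flip_apply, smul_eq_mul]
  ring

/-- The determinant `D` of two parallel forms satisfies `dD = κ D`, so it vanishes everywhere or
nowhere. -/
theorem wedge_basis_eq_zero (h : IsTorsionFreeRiccati α β γ Ω) (hΩ : IsOpen Ω)
    (hconv : Convex ℝ Ω) {w₀ w₁ : OneForm} (ha₀ : AnalyticOnNhd ℂ w₀ Ω)
    (ha₁ : AnalyticOnNhd ℂ w₁ Ω) (h₀ : ∀ c ∈ Ω, IsParallelAt α β γ w₀ c)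
    (h₁ : ∀ c ∈ Ω, IsParallelAt α β γ w₁ c) {c₁ : E} (hc₁ : c₁ ∈ Ω)
    (hz : wedge (w₀ c₁) (w₁ c₁) (1, 0) (0, 1) = 0) {c : E} (hc : c ∈ Ω) :
    wedge (w₀ c) (w₁ c) (1, 0) (0, 1) = 0 := by
  have hd := fun c hc => fderiv_wedge_basis (ha₀ c hc).differentiableAt (ha₁ c hc).differentiableAt
  refine eq_zero_of_fderiv_eq_mul hΩ hconv h.analytic_kappa.continuousOn
    (D := fun c => wedge (w₀ c) (w₁ c) (1, 0) (0, 1))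
    (fun c hc => (hd c hc).1.differentiableWithinAt) ?_ hc₁ hz hc
  intro c hc X
  rw [(hd c hc).2]
  simp only [(h₀ c hc X).1, (h₀ c hc X).2, (h₁ c hc X).1, (h₁ c hc X).2, connA_apply, connE_apply,
    wedge]
  ring

end Riccati

/-! ### The plane of parallel forms. -/

section ParallelSpace

variable {α β γ : OneForm} {Ω : Set E}

theorem IsParallelAt.add {w w' : OneForm} {c : E} (hd : DifferentiableAt ℂ w c)
    (hd' : DifferentiableAt ℂ w' c) (h : IsParallelAt α β γ w c) (h' : IsParallelAt α β γ w' c) :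
    IsParallelAt α β γ (w + w') c := by
  intro X
  rw [fderiv_add hd hd']
  simp only [add_apply, Pi.add_apply, (h X).1, (h X).2, (h' X).1, (h' X).2]
  constructor <;> ring

theorem IsParallelAt.smul {w : OneForm} {c : E} (hd : DifferentiableAt ℂ w c)
    (h : IsParallelAt α β γ w c) (a : ℂ) : IsParallelAt α β γ (a • w) c := by
  intro X
  rw [fderiv_const_smul hd]
  simp only [smul_apply, Pi.smul_apply, (h X).1, (h X).2, smul_eq_mul]
  constructor <;> ring

/-- The forms on `Ω`, extended by zero, parallel for the connection lifting the Riccati equation. -/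
def parallelSpace (α β γ : OneForm) (Ω : Set E) : Submodule ℂ OneForm where
  carrier := {w | AnalyticOnNhd ℂ w Ω ∧ (∀ c ∉ Ω, w c = 0) ∧ ∀ c ∈ Ω, IsParallelAt α β γ w c}
  add_mem' := by
    rintro w w' ⟨h1, h2, h3⟩ ⟨h1', h2', h3'⟩
    refine ⟨fun c hc => (h1 c hc).add (h1' c hc), fun c hc => ?_, fun c hc => ?_⟩
    · rw [Pi.add_apply, h2 c hc, h2' c hc, add_zero]
    · exact (h3 c hc).add (h1 c hc).differentiableAt (h1' c hc).differentiableAt (h3' c hc)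
  zero_mem' := by
    refine ⟨fun c _ => analyticAt_const, fun c _ => rfl, fun c _ X => ?_⟩
    have : fderiv ℂ (0 : OneForm) c = 0 := fderiv_const_apply (𝕜 := ℂ) (0 : E →L[ℂ] ℂ)
    rw [this]
    simp
  smul_mem' := by
    rintro a w ⟨h1, h2, h3⟩
    refine ⟨fun c hc => (h1 c hc).const_smul, fun c hc => ?_, fun c hc => ?_⟩
    · rw [Pi.smul_apply, h2 c hc]
      exact smul_zero (A := E →L[ℂ] ℂ) a
    · exact (h3 c hc).smul (h1 c hc).differentiableAt a

/-- The determinants of `w` with `w₀` and with `w₁` vanish at `c₀`, hence everywhere, and only zero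
is proportional to two independent forms. -/
theorem eq_zero_of_mem_parallelSpace (h : IsTorsionFreeRiccati α β γ Ω) (hΩ : IsOpen Ω)
    (hconv : Convex ℝ Ω) {w₀ w₁ w : OneForm} (h₀ : w₀ ∈ parallelSpace α β γ Ω)
    (h₁ : w₁ ∈ parallelSpace α β γ Ω) (hw : w ∈ parallelSpace α β γ Ω)
    (hne : ∀ c ∈ Ω, wedge (w₀ c) (w₁ c) (1, 0) (0, 1) ≠ 0) {c₀ : E} (hc₀ : c₀ ∈ Ω)
    (hz : w c₀ = 0) : w = 0 := by
  funext c
  by_cases hc : c ∈ Ω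
  swap
  · exact hw.2.1 c hc
  have e0 := wedge_basis_eq_zero h hΩ hconv hw.1 h₀.1 hw.2.2 h₀.2.2 hc₀ (by simp [wedge, hz]) hc
  have e1 := wedge_basis_eq_zero h hΩ hconv hw.1 h₁.1 hw.2.2 h₁.2.2 hc₀ (by simp [wedge, hz]) hc
  have hD := hne c hc
  rw [wedge] at e0 e1 hD
  refine clm_ext_basis ((mul_eq_zero.1 ?_).resolve_right hD)
    ((mul_eq_zero.1 ?_).resolve_right hD)
  · linear_combination w₀ c (1, 0) * e1 - w₁ c (1, 0) * e0
  · linear_combination w₀ c (0, 1) * e1 - w₁ c (0, 1) * e0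

theorem parallelSpace_eq_span (h : IsTorsionFreeRiccati α β γ Ω) (hΩ : IsOpen Ω)
    (hconv : Convex ℝ Ω) (hnonempty : Ω.Nonempty) {w₀ w₁ : OneForm}
    (h₀ : w₀ ∈ parallelSpace α β γ Ω) (h₁ : w₁ ∈ parallelSpace α β γ Ω)
    (hne : ∀ c ∈ Ω, wedge (w₀ c) (w₁ c) (1, 0) (0, 1) ≠ 0) :
    parallelSpace α β γ Ω = Submodule.span ℂ {w₀, w₁} := by
  refine le_antisymm (fun w hw => ?_) ?_
  · obtain ⟨c₀, hc₀⟩ := hnonempty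
    have hD := hne c₀ hc₀
    set D := wedge (w₀ c₀) (w₁ c₀) (1, 0) (0, 1) with hDdef
    -- The coefficients come from Cramer's rule at `c₀`; a parallel form vanishing at `c₀` is zero.
    set A := wedge (w c₀) (w₁ c₀) (1, 0) (0, 1) / D with hA
    set B := wedge (w₀ c₀) (w c₀) (1, 0) (0, 1) / D with hB
    have hu := Submodule.sub_mem _ hw
      (Submodule.add_mem _ (Submodule.smul_mem _ A h₀) (Submodule.smul_mem _ B h₁))
    have hz := eq_zero_of_mem_parallelSpace h hΩ hconv h₀ h₁ hu hne hc₀ (by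
      have e1 : A * D = wedge (w c₀) (w₁ c₀) (1, 0) (0, 1) := div_mul_cancel₀ _ hD
      have e2 : B * D = wedge (w₀ c₀) (w c₀) (1, 0) (0, 1) := div_mul_cancel₀ _ hD
      clear_value A B
      refine clm_ext_basis (mul_right_cancel₀ hD ?_) (mul_right_cancel₀ hD ?_)
      all_goals
        simp only [Pi.sub_apply, Pi.add_apply, Pi.smul_apply, sub_apply, add_apply, smul_apply,
          smul_eq_mul, zero_apply]
        rw [wedge] at e1 e2 hDdef
      · linear_combination -(w₀ c₀ (1, 0)) * e1 - w₁ c₀ (1, 0) * e2 + w c₀ (1, 0) * hDdef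
      · linear_combination -(w₀ c₀ (0, 1)) * e1 - w₁ c₀ (0, 1) * e2 + w c₀ (0, 1) * hDdef)
    exact Submodule.mem_span_pair.2 ⟨A, B, (sub_eq_zero.1 hz).symm⟩
  · rw [Submodule.span_le]
    rintro w (rfl | rfl)
    exacts [h₀, h₁]

theorem exists_basis_parallelSpace (h : IsTorsionFreeRiccati α β γ Ω) (hΩ : IsOpen Ω)
    (hconv : Convex ℝ Ω) (hnonempty : Ω.Nonempty) : ∃ w₀ ∈ parallelSpace α β γ Ω,
    ∃ w₁ ∈ parallelSpace α β γ Ω, ∀ c ∈ Ω, wedge (w₀ c) (w₁ c) (1, 0) (0, 1) ≠ 0 := by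
  obtain ⟨c₀, hc₀⟩ := hnonempty
  obtain ⟨w₀, a₀, i₀, s₀, p₀⟩ := exists_parallel_form h hΩ hconv hc₀ (ContinuousLinearMap.fst ℂ ℂ ℂ)
  obtain ⟨w₁, a₁, i₁, s₁, p₁⟩ := exists_parallel_form h hΩ hconv hc₀ (ContinuousLinearMap.snd ℂ ℂ ℂ)
  refine ⟨w₀, ⟨a₀, s₀, p₀⟩, w₁, ⟨a₁, s₁, p₁⟩, fun c hc hz => ?_⟩
  have := wedge_basis_eq_zero h hΩ hconv a₀ a₁ p₀ p₁ hc hz hc₀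
  simp [wedge, i₀, i₁] at this

/-- A nonzero parallel form vanishes nowhere. -/
theorem ne_zero_of_mem_parallelSpace (h : IsTorsionFreeRiccati α β γ Ω) (hΩ : IsOpen Ω)
    (hconv : Convex ℝ Ω) {w : OneForm} (hw : w ∈ parallelSpace α β γ Ω) (hne : w ≠ 0) {c : E}
    (hc : c ∈ Ω) : w c ≠ 0 := by
  obtain ⟨w₀, h₀, w₁, h₁, hD⟩ := exists_basis_parallelSpace h hΩ hconv ⟨c, hc⟩
  exact fun hz => hne (eq_zero_of_mem_parallelSpace h hΩ hconv h₀ h₁ hw hD hc hz)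

end ParallelSpace

/-! ### The universal covering `y = exp s` and its deck transformation. -/

section Cover

theorem hasFDerivAt_coverMap (c : E) : HasFDerivAt coverMap
    ((ContinuousLinearMap.fst ℂ ℂ ℂ).prod (Complex.exp c.2 • ContinuousLinearMap.snd ℂ ℂ ℂ)) c :=
  hasFDerivAt_fst.prodMk (hasFDerivAt_snd.cexp)

theorem fderiv_coverMap_apply (c X : E) :
    fderiv ℂ coverMap c X = (X.1, Complex.exp c.2 * X.2) := by
  rw [(hasFDerivAt_coverMap c).fderiv]
  simp

theorem analyticAt_coverMap (c : E) : AnalyticAt ℂ coverMap c :=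
  analyticAt_fst.prod analyticAt_snd.cexp

theorem continuous_coverMap : Continuous coverMap := by
  unfold coverMap
  fun_prop

theorem coverMap_snd_ne_zero (c : E) : (coverMap c).2 ≠ 0 := Complex.exp_ne_zero _

theorem isOpen_coverDomain (r : ℝ) : IsOpen (coverDomain r) :=
  isOpen_ball.preimage continuous_coverMap

theorem mem_coverDomain {r : ℝ} {c : E} :
    c ∈ coverDomain r ↔ ‖c.1‖ < r ∧ Real.exp c.2.re < r := by
  rw [coverDomain, mem_preimage, mem_ball_prod_iff]
  simp [coverMap, Complex.norm_exp]

theorem coverDomain_mono {r r' : ℝ} (h : r ≤ r') : coverDomain r ⊆ coverDomain r' :=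
  preimage_mono (ball_subset_ball h)

/-- A disc times the half-plane `Re s < log r`. Convexity is the form in which simple connectedness
is used. -/
theorem convex_coverDomain {r : ℝ} (hr : 0 < r) : Convex ℝ (coverDomain r) := by
  have : coverDomain r = ball (0 : ℂ) r ×ˢ {s : ℂ | s.re < Real.log r} := by
    ext c
    rw [mem_coverDomain, mem_prod, mem_ball_zero_iff, mem_ofPred_eq, Real.lt_log_iff_exp_lt hr]
  rw [this]
  exact (convex_ball 0 r).prod (convex_halfSpace_re_lt _)

theorem coverDomain_nonempty {r : ℝ} (hr : 0 < r) : (coverDomain r).Nonempty := by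
  refine ⟨(0, ((Real.log (r / 2) : ℝ) : ℂ)), mem_coverDomain.2 ⟨by simpa using hr, ?_⟩⟩
  rw [Complex.ofReal_re, Real.exp_log (by positivity)]
  linarith

/-- The deck transformation of the universal covering. -/
def deck (c : E) : E := c + (0, 2 * Real.pi * Complex.I)

theorem coverMap_deck (c : E) : coverMap (deck c) = coverMap c := by
  simp [coverMap, deck, Complex.exp_add]

theorem exp_deck (c : E) : Complex.exp (deck c).2 = Complex.exp c.2 :=
  congrArg Prod.snd (coverMap_deck c)

theorem deck_mem_coverDomain {r : ℝ} {c : E} : deck c ∈ coverDomain r ↔ c ∈ coverDomain r := by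
  rw [coverDomain, mem_preimage, coverMap_deck]
  rfl

theorem monodromy_apply (w : OneForm) (c : E) : monodromy w c = w (deck c) := rfl

theorem fderiv_comp_deck {V : Type*} [NormedAddCommGroup V] [NormedSpace ℂ V] (f : E → V) (c : E) :
    fderiv ℂ (fun c => f (deck c)) c = fderiv ℂ f (deck c) :=
  fderiv_comp_add_right _

theorem analyticAt_deck (c : E) : AnalyticAt ℂ deck c := analyticAt_id.add analyticAt_const

theorem pullback_apply (η : OneForm) (c X : E) :
    pullback η c X = η (coverMap c) (X.1, Complex.exp c.2 * X.2) := by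
  rw [pullback, ContinuousLinearMap.comp_apply, fderiv_coverMap_apply]

theorem oneForm_eq (w : OneForm) : w = fun c => w c (1, 0) • ContinuousLinearMap.fst ℂ ℂ ℂ +
    w c (0, 1) • ContinuousLinearMap.snd ℂ ℂ ℂ :=
  funext fun c => clm_ext_basis (by simp) (by simp)

theorem analyticAt_oneForm {w : OneForm} {c : E} (h1 : AnalyticAt ℂ (fun c => w c (1, 0)) c)
    (h2 : AnalyticAt ℂ (fun c => w c (0, 1)) c) : AnalyticAt ℂ w c := by
  rw [oneForm_eq w]
  exact (h1.smul analyticAt_const).add (h2.smul analyticAt_const)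

theorem differentiableAt_oneForm {w : OneForm} {c : E}
    (h1 : DifferentiableAt ℂ (fun c => w c (1, 0)) c)
    (h2 : DifferentiableAt ℂ (fun c => w c (0, 1)) c) : DifferentiableAt ℂ w c := by
  rw [oneForm_eq w]
  exact (h1.smul_const _).add (h2.smul_const _)

theorem pullback_apply_fst (η : OneForm) (c : E) :
    pullback η c (1, 0) = η (coverMap c) (1, 0) := by
  simp [pullback_apply]

theorem pullback_apply_snd (η : OneForm) (c : E) :
    pullback η c (0, 1) = Complex.exp c.2 * η (coverMap c) (0, 1) := by
  rw [pullback_apply, clm_apply_eq]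
  simp

theorem analyticAt_pullback {η : OneForm} {c : E} (hη : AnalyticAt ℂ η (coverMap c)) :
    AnalyticAt ℂ (pullback η) c := by
  have h := fun X => analyticAt_clm_apply (hη.fun_comp (analyticAt_coverMap c)) X
  refine analyticAt_oneForm ?_ ?_
  · simp only [pullback_apply_fst]
    exact h (1, 0)
  · simp only [pullback_apply_snd]
    exact analyticAt_snd.cexp.mul (h (0, 1))

/-- The last term comes from the second derivative of `exp`. It is symmetric in `X` and `Y`, hence
invisible to `extD`. -/
theorem fderiv_pullback {η : OneForm} {c : E} (hη : DifferentiableAt ℂ η (coverMap c)) (X Y : E) :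
    fderiv ℂ (pullback η) c X Y =
      fderiv ℂ η (coverMap c) (X.1, Complex.exp c.2 * X.2) (Y.1, Complex.exp c.2 * Y.2) +
        Complex.exp c.2 * X.2 * Y.2 * η (coverMap c) (0, 1) := by
  have h1 := hη.hasFDerivAt.comp c (hasFDerivAt_coverMap c)
  have h2 : HasFDerivAt (fun c : E => ((Y.1, Complex.exp c.2 * Y.2) : E))
      ((0 : E →L[ℂ] ℂ).prod (Y.2 • Complex.exp c.2 • ContinuousLinearMap.snd ℂ ℂ ℂ)) c :=
    (hasFDerivAt_const _ _).prodMk ((hasFDerivAt_snd.cexp).mul_const Y.2)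
  have h3 := h1.clm_apply h2
  have h4 : DifferentiableAt ℂ (pullback η) c := by
    have h := fun X => h1.differentiableAt.clm_apply (differentiableAt_const X)
    refine differentiableAt_oneForm ?_ ?_
    · simp only [pullback_apply_fst]
      exact h (1, 0)
    · simp only [pullback_apply_snd]
      exact (by fun_prop : DifferentiableAt ℂ (fun c : E => Complex.exp c.2) c).mul (h (0, 1))
  have h5 := h4.hasFDerivAt.clm_apply (hasFDerivAt_const Y c)
  have h6 : (fun c => pullback η c Y) = fun c => η (coverMap c) (Y.1, Complex.exp c.2 * Y.2) :=
    funext fun c => pullback_apply η c Y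
  rw [h6] at h5
  have h7 := congrArg (fun L : E →L[ℂ] ℂ => L X) (h5.unique h3)
  simp only [add_apply, ContinuousLinearMap.comp_apply, ContinuousLinearMap.flip_apply,
    ContinuousLinearMap.prod_apply, smul_apply, zero_apply, map_zero, zero_add,
    ContinuousLinearMap.coe_fst', ContinuousLinearMap.coe_snd', smul_eq_mul] at h7
  rw [h7, Function.comp_apply, clm_apply_eq (η (coverMap c)) (0, _)]
  ring

end Cover

/-! ### The Riccati equation on the universal covering. -/

section CoverRiccati

/-- The polydisc of radius `r` minus `{y = 0}`. -/
def puncturedBall (r : ℝ) : Set E := ball 0 r ∩ {c | c.2 ≠ 0}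

theorem coverMap_mem_puncturedBall {r : ℝ} {c : E} (hc : c ∈ coverDomain r) :
    coverMap c ∈ puncturedBall r := ⟨hc, coverMap_snd_ne_zero c⟩

/-- In the coordinates `(x, s)` on the universal covering, `y = exp s`, the Riccati equation
`dz + α z² + β z + γ = 0` becomes the one with coefficients `coverα α`, `coverβ β`, `coverγ γ`. -/
def coverα (α : OneForm) : OneForm := fun c => Complex.exp c.2 • pullback α c

/-- See `coverα`. -/
def coverβ (β : OneForm) : OneForm := fun c => pullback β c + ContinuousLinearMap.snd ℂ ℂ ℂ

/-- See `coverα`. -/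
def coverγ (γ : OneForm) : OneForm := fun c => Complex.exp (-c.2) • pullback γ c

theorem hasFDerivAt_pullback {η : OneForm} {c : E} (hη : AnalyticAt ℂ η (coverMap c)) :
    HasFDerivAt (pullback η) (fderiv ℂ (pullback η) c) c :=
  (analyticAt_pullback hη).differentiableAt.hasFDerivAt

theorem fderiv_coverα {α : OneForm} {c : E} (hα : AnalyticAt ℂ α (coverMap c)) (X Y : E) :
    fderiv ℂ (coverα α) c X Y =
      Complex.exp c.2 * (fderiv ℂ (pullback α) c X Y + X.2 * pullback α c Y) := by
  have h : HasFDerivAt (coverα α) _ c :=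
    HasFDerivAt.smul (c := fun c : E => Complex.exp c.2) (hasFDerivAt_snd.cexp)
      (hasFDerivAt_pullback hα)
  rw [h.fderiv]
  simp only [add_apply, smul_apply, smul_eq_mul, ContinuousLinearMap.smulRight_apply,
    ContinuousLinearMap.coe_snd']
  ring

theorem fderiv_coverγ {γ : OneForm} {c : E} (hγ : AnalyticAt ℂ γ (coverMap c)) (X Y : E) :
    fderiv ℂ (coverγ γ) c X Y =
      Complex.exp (-c.2) * (fderiv ℂ (pullback γ) c X Y - X.2 * pullback γ c Y) := by
  have h : HasFDerivAt (coverγ γ) _ c :=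
    HasFDerivAt.smul (c := fun c : E => Complex.exp (-c.2)) (hasFDerivAt_snd.neg.cexp)
      (hasFDerivAt_pullback hγ)
  rw [h.fderiv]
  simp only [add_apply, smul_apply, smul_eq_mul, ContinuousLinearMap.smulRight_apply,
    ContinuousLinearMap.coe_snd', neg_apply, Pi.neg_apply]
  ring

theorem fderiv_coverβ {β : OneForm} {c : E} (X Y : E) :
    fderiv ℂ (coverβ β) c X Y = fderiv ℂ (pullback β) c X Y := by
  rw [show coverβ β = fun c => pullback β c + ContinuousLinearMap.snd ℂ ℂ ℂ from rfl,
    fderiv_add_const]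

theorem extD_pullback {η : OneForm} {c : E} (hη : AnalyticAt ℂ η (coverMap c)) (X Y : E) :
    extD (pullback η) c X Y =
      extD η (coverMap c) (X.1, Complex.exp c.2 * X.2) (Y.1, Complex.exp c.2 * Y.2) := by
  rw [extD, extD, fderiv_pullback hη.differentiableAt, fderiv_pullback hη.differentiableAt]
  ring

/-- The correction `ds` is closed, so torsion-freeness passes to the covering. -/
theorem kappa_cover (α β γ : OneForm) :
    kappa (coverα α) (coverβ β) (coverγ γ) =
      fun c => pullback (kappa α β γ) c + ContinuousLinearMap.snd ℂ ℂ ℂ := by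
  funext c
  have h : Complex.exp (-c.2) * Complex.exp c.2 = 1 := by
    rw [← Complex.exp_add]
    simp
  refine clm_ext_basis ?_ ?_
  · simp only [kappa_apply, coverα, coverβ, coverγ, smul_apply, add_apply, pullback_apply_fst,
      pullback_apply_snd, ContinuousLinearMap.coe_snd', smul_eq_mul]
    linear_combination (2 * γ (coverMap c) (0, 1)) * h
  · simp only [kappa_apply, coverα, coverβ, coverγ, smul_apply, add_apply, pullback_apply_fst,
      pullback_apply_snd, ContinuousLinearMap.coe_snd', smul_eq_mul]
    ring

/-- In the frame `∂_x, ∂_s = y ∂_y` the fibre coordinate becomes `z / y`. This multiplies `α` by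
`y`, divides `γ` by `y` and adds `dy / y = ds` to `β`. -/
theorem IsTorsionFreeRiccati.cover {α β γ : OneForm} {r : ℝ}
    (h : IsTorsionFreeRiccati α β γ (puncturedBall r)) :
    IsTorsionFreeRiccati (coverα α) (coverβ β) (coverγ γ) (coverDomain r) := by
  have hα := fun c (hc : c ∈ coverDomain r) => h.analytic_α _ (coverMap_mem_puncturedBall hc)
  have hβ := fun c (hc : c ∈ coverDomain r) => h.analytic_β _ (coverMap_mem_puncturedBall hc)
  have hγ := fun c (hc : c ∈ coverDomain r) => h.analytic_γ _ (coverMap_mem_puncturedBall hc)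
  have he : ∀ c : E, Complex.exp (-c.2) * Complex.exp c.2 = 1 := fun c => by
    rw [← Complex.exp_add]
    simp
  constructor
  · exact fun c hc => analyticAt_snd.cexp.smul (analyticAt_pullback (hα c hc))
  · exact fun c hc => (analyticAt_pullback (hβ c hc)).add analyticAt_const
  · exact fun c hc => analyticAt_snd.neg.cexp.smul (analyticAt_pullback (hγ c hc))
  · intro c hc X Y
    have e := h.extD_α _ (coverMap_mem_puncturedBall hc) (X.1, Complex.exp c.2 * X.2)
      (Y.1, Complex.exp c.2 * Y.2)
    rw [← extD_pullback (hα c hc)] at e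
    rw [extD] at e ⊢
    rw [fderiv_coverα (hα c hc), fderiv_coverα (hα c hc)]
    simp only [wedge, ← pullback_apply] at e ⊢
    simp only [coverα, coverβ, smul_apply, add_apply, ContinuousLinearMap.coe_snd', smul_eq_mul]
    linear_combination Complex.exp c.2 * e
  · intro c hc X Y
    have e := h.extD_β _ (coverMap_mem_puncturedBall hc) (X.1, Complex.exp c.2 * X.2)
      (Y.1, Complex.exp c.2 * Y.2)
    rw [← extD_pullback (hβ c hc)] at e
    rw [extD] at e ⊢
    rw [fderiv_coverβ, fderiv_coverβ]
    simp only [wedge, ← pullback_apply] at e ⊢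
    simp only [coverα, coverγ, smul_apply, smul_eq_mul]
    linear_combination e + 2 * (pullback α c X * pullback γ c Y -
      pullback α c Y * pullback γ c X) * he c
  · intro c hc X Y
    have e := h.extD_γ _ (coverMap_mem_puncturedBall hc) (X.1, Complex.exp c.2 * X.2)
      (Y.1, Complex.exp c.2 * Y.2)
    rw [← extD_pullback (hγ c hc)] at e
    rw [extD] at e ⊢
    rw [fderiv_coverγ (hγ c hc), fderiv_coverγ (hγ c hc)]
    simp only [wedge, ← pullback_apply] at e ⊢
    simp only [coverγ, coverβ, smul_apply, add_apply, ContinuousLinearMap.coe_snd', smul_eq_mul]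
    linear_combination Complex.exp (-c.2) * e
  · intro c hc X Y
    have e := h.torsion _ (coverMap_mem_puncturedBall hc) (X.1, Complex.exp c.2 * X.2)
      (Y.1, Complex.exp c.2 * Y.2)
    rw [← extD_pullback (h.analytic_kappa _ (coverMap_mem_puncturedBall hc))] at e
    rw [kappa_cover]
    rw [extD] at e ⊢
    rw [fderiv_add_const]
    exact e

theorem kerVec_eq (w : OneForm) :
    kerVec w = fun c => (w c (0, 1), Complex.exp c.2 * -(w c (1, 0))) := by
  funext c
  rw [kerVec, fderiv_coverMap_apply]

theorem fderiv_kerVec {w : OneForm} {c : E} (hw : DifferentiableAt ℂ w c) (X : E) :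
    fderiv ℂ (kerVec w) c X = (fderiv ℂ w c X (0, 1),
      -(Complex.exp c.2 * (fderiv ℂ w c X (1, 0) + X.2 * w c (1, 0)))) := by
  have k := fun Y : E => hw.hasFDerivAt.clm_apply (hasFDerivAt_const (𝕜 := ℂ) Y c)
  have e := (hasFDerivAt_snd (𝕜 := ℂ) (p := c)).cexp
  have h := (k (0, 1)).prodMk (e.mul (k (1, 0)).neg)
  rw [kerVec_eq w]
  refine (congrArg (fun L : E →L[ℂ] E => L X) h.fderiv).trans ?_
  ext
  · simp
  · simp
    ring

/-- The left side uses the frame `∂_x, ∂_y`, the right side the frame `∂_x, ∂_s`; the factor `exp s`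
is the determinant of the change of frame. -/
theorem leaf_expression_eq {w α β γ : OneForm} {c : E} (hw : DifferentiableAt ℂ w c) (X : E) :
    det2 (kerVec w c) (fderiv ℂ (kerVec w) c X) +
      quad α β γ (coverMap c) (fderiv ℂ coverMap c X) (kerVec w c) =
    Complex.exp c.2 * (w c (1, 0) * fderiv ℂ w c X (0, 1) - w c (0, 1) * fderiv ℂ w c X (1, 0) +
      coverα α c X * w c (1, 0) ^ 2 - coverβ β c X * (w c (1, 0) * w c (0, 1)) +
        coverγ γ c X * w c (0, 1) ^ 2) := by
  have he : Complex.exp (-c.2) * Complex.exp c.2 = 1 := by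
    rw [← Complex.exp_add]
    simp
  rw [fderiv_kerVec hw, fderiv_coverMap_apply, kerVec_eq]
  simp only [det2, quad, ← pullback_apply, coverα, coverβ, coverγ, smul_apply, add_apply,
    ContinuousLinearMap.coe_snd', smul_eq_mul]
  linear_combination (-(pullback γ c X) * w c (0, 1) ^ 2) * he

theorem isLeafAt_cover_iff {w α β γ : OneForm} {c : E} (hw : DifferentiableAt ℂ w c) :
    IsLeafAt (coverα α) (coverβ β) (coverγ γ) w c ↔
      ∀ X, det2 (kerVec w c) (fderiv ℂ (kerVec w) c X) +
        quad α β γ (coverMap c) (fderiv ℂ coverMap c X) (kerVec w c) = 0 := by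
  refine forall_congr' fun X => ?_
  rw [leaf_expression_eq hw, mul_eq_zero, or_iff_right (Complex.exp_ne_zero _)]

/-- The coefficients of the equation on the covering are invariant under the deck transformation. -/
theorem monodromy_mem_parallelSpace {α β γ : OneForm} {r : ℝ} {w : OneForm}
    (hw : w ∈ parallelSpace (coverα α) (coverβ β) (coverγ γ) (coverDomain r)) :
    monodromy w ∈ parallelSpace (coverα α) (coverβ β) (coverγ γ) (coverDomain r) := by
  obtain ⟨h1, h2, h3⟩ := hw
  have hp : ∀ (η : OneForm) c X, pullback η (deck c) X = pullback η c X := fun η c X => by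
    rw [pullback_apply, pullback_apply, coverMap_deck, exp_deck]
  have hα : ∀ c X, coverα α (deck c) X = coverα α c X := fun c X => by
    simp only [coverα, smul_apply, exp_deck, hp]
  have hβ : ∀ c X, coverβ β (deck c) X = coverβ β c X := fun c X => by
    simp only [coverβ, add_apply, hp]
  have hγ : ∀ c X, coverγ γ (deck c) X = coverγ γ c X := fun c X => by
    simp only [coverγ, smul_apply, Complex.exp_neg, exp_deck, hp]
  refine ⟨fun c hc => ?_, fun c hc => ?_, fun c hc X => ?_⟩
  · exact (h1 (deck c) (deck_mem_coverDomain.2 hc)).fun_comp (analyticAt_deck c)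
  · exact h2 _ (mt deck_mem_coverDomain.1 hc)
  · have := h3 _ (deck_mem_coverDomain.2 hc) X
    rw [show monodromy w = fun c => w (deck c) from rfl, fderiv_comp_deck]
    simp only [connA_apply, connE_apply, kappa_apply, hα, hβ, hγ] at this ⊢
    exact this

end CoverRiccati

/-! ### The flat pencil of the foliation is the plane of parallel forms. -/

namespace RiccatiFoliation

variable {S : Type*} [TopologicalSpace S] [ChartedSpace E S] [IsManifold 𝓘(ℂ, E) ω S]

theorem isTorsionFreeRiccati {H : RiccatiFoliation S} (hH : H.IsTorsionFree) {p : S}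
    {e : OpenPartialHomeomorph S E} (he : H.IsAdaptedChart p e) {r : ℝ}
    (hball : ball (0 : E) r ⊆ e.target) :
    IsTorsionFreeRiccati (H.α e) (H.β e) (H.γ e) (puncturedBall r) := by
  have key : ∀ c ∈ puncturedBall r, ∃ q ∈ e.source, q ∉ H.polar ∧ e q = c := by
    rintro c ⟨hc, hc2⟩
    refine ⟨e.symm c, e.map_target (hball hc), fun hpol => hc2 ?_, e.right_inv (hball hc)⟩
    have := (he.polar_iff _ (e.map_target (hball hc))).1 hpol
    rwa [e.right_inv (hball hc)] at this
  constructor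
  all_goals
    intro c hc
    obtain ⟨q, hq, hqp, rfl⟩ := key c hc
  · exact (H.analytic e he.mem_atlas q hq hqp).1
  · exact (H.analytic e he.mem_atlas q hq hqp).2.1
  · exact (H.analytic e he.mem_atlas q hq hqp).2.2
  · exact fun X Y => (H.frobenius e he.mem_atlas q hq hqp X Y).1
  · exact fun X Y => (H.frobenius e he.mem_atlas q hq hqp X Y).2.1
  · exact fun X Y => (H.frobenius e he.mem_atlas q hq hqp X Y).2.2
  · exact hH e he.mem_atlas q hq hqp

/-- The flat pencil is the space of forms parallel for the torsion-free connection lifting the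
Riccati equation. -/
theorem isFlatPencil_iff {H : RiccatiFoliation S} {e : OpenPartialHomeomorph S E} {r : ℝ}
    (hr : 0 < r) (h : IsTorsionFreeRiccati (H.α e) (H.β e) (H.γ e) (puncturedBall r))
    (V : Submodule ℂ OneForm) : H.IsFlatPencil e r V ↔
      V = parallelSpace (coverα (H.α e)) (coverβ (H.β e)) (coverγ (H.γ e)) (coverDomain r) := by
  have hΩ := isOpen_coverDomain r
  have hconv := convex_coverDomain hr
  have hnon := coverDomain_nonempty hr
  constructor
  · intro hV
    obtain ⟨w₀, w₁, hspan, hne⟩ := hV.span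
    have m₀ : w₀ ∈ V := by rw [hspan]; exact Submodule.subset_span (by simp)
    have m₁ : w₁ ∈ V := by rw [hspan]; exact Submodule.subset_span (by simp)
    have hd : ∀ w ∈ V, ∀ c ∈ coverDomain r, DifferentiableAt ℂ w c := fun w hw c hc =>
      (hV.analytic w hw c hc).differentiableAt
    have hl : ∀ w ∈ V, ∀ c ∈ coverDomain r,
        IsLeafAt (coverα (H.α e)) (coverβ (H.β e)) (coverγ (H.γ e)) w c := fun w hw c hc =>
      (isLeafAt_cover_iff (hd w hw c hc)).2 (hV.leaf w hw c hc)
    have hp := fun c hc => isParallelAt_of_pencil (hd w₀ m₀ c hc) (hd w₁ m₁ c hc) (hne c hc)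
      (hl w₀ m₀ c hc) (hl w₁ m₁ c hc) (hl _ (V.add_mem m₀ m₁) c hc) (hV.closed w₀ m₀ c hc)
      (hV.closed w₁ m₁ c hc)
    rw [hspan]
    exact (parallelSpace_eq_span h.cover hΩ hconv hnon
      ⟨hV.analytic w₀ m₀, hV.support w₀ m₀, fun c hc => (hp c hc).1⟩
      ⟨hV.analytic w₁ m₁, hV.support w₁ m₁, fun c hc => (hp c hc).2⟩ hne).symm
  · rintro rfl
    obtain ⟨w₀, h₀, w₁, h₁, hne⟩ := exists_basis_parallelSpace h.cover hΩ hconv hnon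
    exact
      { span := ⟨w₀, w₁, parallelSpace_eq_span h.cover hΩ hconv hnon h₀ h₁ hne, hne⟩
        analytic := fun w hw => hw.1
        support := fun w hw => hw.2.1
        closed := fun w hw c hc => (hw.2.2 c hc).closed
        leaf := fun w hw c hc =>
          (isLeafAt_cover_iff (hw.1 c hc).differentiableAt).1 (hw.2.2 c hc).isLeafAt }

end RiccatiFoliation

/-- A linear automorphism of a plane acts on its lines with a fixed point. -/
theorem exists_projectivization_map_fixed {V : Type*} [AddCommGroup V] [Module ℂ V]
    [FiniteDimensional ℂ V] [Nontrivial V] (f : V →ₗ[ℂ] V) (hf : Function.Injective f) :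
    ∃ P : Projectivization ℂ V, Projectivization.map f hf P = P := by
  obtain ⟨a, ha⟩ := Module.End.exists_eigenvalue (K := ℂ) f
  obtain ⟨v, hv⟩ := ha.exists_hasEigenvector
  refine ⟨Projectivization.mk ℂ v hv.2, ?_⟩
  rw [Projectivization.map_mk, Projectivization.mk_eq_mk_iff']
  exact ⟨a, hv.apply_eq_smul.symm⟩

/-! ### Descent from the covering and functions of moderate growth. -/

section Descent

theorem eq_of_coverMap_eq {T : Type*} {f : E → T} (hf : ∀ c, f (deck c) = f c) {c c' : E}
    (h : coverMap c = coverMap c') : f c = f c' := by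
  obtain ⟨h1, h2⟩ := Prod.ext_iff.1 h
  simp only [coverMap] at h1 h2
  obtain ⟨n, hn⟩ := Complex.exp_eq_exp_iff_exists_int.1 h2
  have hper : Function.Periodic (fun s => f (c.1, s)) (2 * Real.pi * Complex.I) := by
    intro s
    have := hf (c.1, s)
    simpa [deck] using this
  have := (hper.int_mul n) c'.2
  rw [← hn] at this
  rw [← Prod.eta c, ← Prod.eta c', ← h1]
  exact this

variable {V : Type*} [NormedAddCommGroup V] [NormedSpace ℂ V]

/-- A holomorphic function on the universal covering, invariant under the deck transformation,
descends. -/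
theorem exists_descent {ε : ℝ} {f : E → V} (hf : AnalyticOnNhd ℂ f (coverDomain ε))
    (hper : ∀ c ∈ coverDomain ε, f (deck c) = f c) :
    ∃ g : E → V, AnalyticOnNhd ℂ g (puncturedBall ε) ∧
      ∀ c ∈ coverDomain ε, f c = g (coverMap c) := by
  classical
  -- Extended by zero, the function is invariant on the whole covering of `{y ≠ 0}`, hence constant
  -- on the fibres of `coverMap`.
  set F : E → V := fun c => if c ∈ coverDomain ε then f c else 0 with hF
  have hFf : ∀ c ∈ coverDomain ε, F c = f c := fun c hc => if_pos hc
  have hFper : ∀ c, F (deck c) = F c := by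
    intro c
    by_cases hc : c ∈ coverDomain ε
    · rw [hFf c hc, hFf _ (deck_mem_coverDomain.2 hc), hper c hc]
    · simp only [hF]
      rw [if_neg hc, if_neg (mt deck_mem_coverDomain.1 hc)]
  have hFa : AnalyticOnNhd ℂ F (coverDomain ε) := fun c hc => (hf c hc).congr (by
    filter_upwards [(isOpen_coverDomain ε).mem_nhds hc] with c' hc' using (hFf c' hc').symm)
  refine ⟨fun c => F (c.1, Complex.log c.2), fun c hc => ?_, fun c hc => ?_⟩
  · obtain ⟨hcb, hc2⟩ := hc
    -- This branch of the logarithm is holomorphic near `c` even if `c.2` is on the cut of the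
    -- principal one; by invariance `F` takes the same value on both branches.
    have hlift : ∀ c' : E, c'.2 ≠ 0 →
        coverMap (c'.1, Complex.log (c'.2 / c.2) + Complex.log c.2) = c' := by
      intro c' hc'
      ext
      · rfl
      · simp only [coverMap]
        rw [Complex.exp_add, Complex.exp_log (div_ne_zero hc' hc2), Complex.exp_log hc2,
          div_mul_cancel₀ _ hc2]
    have hmem : ((c.1, Complex.log (c.2 / c.2) + Complex.log c.2) : E) ∈ coverDomain ε := by
      rw [coverDomain, mem_preimage, hlift c hc2]
      exact hcb
    have hin : AnalyticAt ℂ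
        (fun c' : E => ((c'.1, Complex.log (c'.2 / c.2) + Complex.log c.2) : E)) c := by
      refine analyticAt_fst.prod (AnalyticAt.add (AnalyticAt.clog ?_ ?_) analyticAt_const)
      · exact analyticAt_snd.div analyticAt_const hc2
      · rw [div_self hc2]
        exact Complex.one_mem_slitPlane
    refine (AnalyticAt.fun_comp (g := F) (f := fun c' : E =>
      ((c'.1, Complex.log (c'.2 / c.2) + Complex.log c.2) : E)) (hFa _ hmem) hin).congr ?_
    filter_upwards [isOpen_snd_ne_zero.mem_nhds hc2] with c' hc'
    refine eq_of_coverMap_eq hFper ?_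
    rw [hlift c' hc', coverMap, Complex.exp_log hc']
  · rw [← hFf c hc]
    refine eq_of_coverMap_eq hFper ?_
    simp only [coverMap]
    rw [Complex.exp_log (Complex.exp_ne_zero _)]

/-- Growth estimates hold only on sectors. One turn suffices, and `log (-y) + π i` moves the
argument from `(-π, π]` to `(0, 2π]`. -/
theorem exists_lift {ε : ℝ} {c : E} (hc : c ∈ puncturedBall ε) :
    ∃ c' ∈ coverDomain ε, coverMap c' = c ∧ c'.2.im ∈ Icc 0 (2 * Real.pi) := by
  have hne : -c.2 ≠ 0 := neg_ne_zero.2 hc.2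
  have hmap : coverMap (c.1, Complex.log (-c.2) + Real.pi * Complex.I) = c := by
    ext
    · rfl
    · simp only [coverMap]
      rw [Complex.exp_add, Complex.exp_log hne, Complex.exp_pi_mul_I]
      ring
  refine ⟨(c.1, Complex.log (-c.2) + Real.pi * Complex.I), ?_, hmap, ?_⟩
  · rw [coverDomain, mem_preimage, hmap]
    exact hc.1
  · have h1 := Complex.neg_pi_lt_log_im (-c.2)
    have h2 := Complex.log_im_le_pi (-c.2)
    simp only [Complex.add_im, Complex.mul_im, Complex.ofReal_re, Complex.ofReal_im, Complex.I_re,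
      Complex.I_im]
    constructor <;> linarith

theorem norm_exp_mul (μ s : ℂ) :
    ‖Complex.exp (μ * s)‖ = Real.exp (μ.re * s.re) * Real.exp (-(μ.im * s.im)) := by
  rw [Complex.norm_exp, Complex.mul_re, sub_eq_add_neg, Real.exp_add]

/-- A multivalued holomorphic function with multiplicative monodromy and moderate growth is the
product of a power of `y` and of a holomorphic function not vanishing identically on `{y = 0}`. -/
theorem exists_eq_exp_smul_of_moderate [CompleteSpace V] {ε : ℝ} (hε : 0 < ε) {f : E → V}
    (hf : AnalyticOnNhd ℂ f (coverDomain ε)) {a : ℂ} (ha : a ≠ 0)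
    (hmon : ∀ c ∈ coverDomain ε, f (deck c) = a • f c) {C K : ℝ}
    (hbound : ∀ c ∈ coverDomain ε, c.2.im ∈ Icc 0 (2 * Real.pi) →
      ‖f c‖ ≤ C * Real.exp (-(K * c.2.re)))
    (hne : ∃ c ∈ coverDomain ε, f c ≠ 0) :
    ∃ (μ : ℂ) (g : E → V), AnalyticOnNhd ℂ g (ball 0 ε) ∧
      (∀ c ∈ coverDomain ε, f c = Complex.exp (μ * c.2) • g (coverMap c)) ∧
      ∃ x : ℂ, ((x, 0) : E) ∈ ball (0 : E) ε ∧ g (x, 0) ≠ 0 := by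
  have h2pi : (2 * Real.pi * Complex.I : ℂ) ≠ 0 := Complex.two_pi_I_ne_zero
  -- Since `exp (2πi lam) = a`, multiplication by `exp (-lam s)` removes the monodromy. The further
  -- factor `exp (N s) = y ^ N` is single-valued and, for `N` large, absorbs the growth.
  set lam : ℂ := Complex.log a / (2 * Real.pi * Complex.I) with hlam
  obtain ⟨N, hN⟩ := exists_nat_ge (lam.re + K)
  set ν : ℂ := N - lam with hν
  have hνdeck : ∀ c : E, Complex.exp (ν * (deck c).2) * a = Complex.exp (ν * c.2) := by
    intro c
    have h1 : ν * (deck c).2 = ν * c.2 + (N * (2 * Real.pi * Complex.I) - Complex.log a) := by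
      simp only [deck, Prod.snd_add, hν, hlam]
      field_simp
    rw [h1, Complex.exp_add, Complex.exp_sub, Complex.exp_log ha,
      Complex.exp_nat_mul_two_pi_mul_I]
    field_simp
  obtain ⟨g₁, hg₁, e₁⟩ := exists_descent (f := fun c => Complex.exp (ν * c.2) • f c)
    (fun c hc => (analyticAt_const.mul analyticAt_snd).cexp.smul (hf c hc)) (by
      intro c hc
      rw [hmon c hc, smul_smul, hνdeck])
  have hνre : 0 ≤ ν.re - K := by
    simp only [hν, Complex.sub_re, Complex.natCast_re]
    linarith
  have hb : ∀ c ∈ puncturedBall ε, ‖g₁ c‖ ≤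
      Real.exp ((ν.re - K) * Real.log ε) * Real.exp (|ν.im| * (2 * Real.pi)) * |C| := by
    intro c hc
    obtain ⟨c', hc', rfl, him⟩ := exists_lift hc
    rw [← e₁ c' hc', norm_smul, norm_exp_mul]
    have hre : c'.2.re < Real.log ε := (Real.lt_log_iff_exp_lt hε).2 (mem_coverDomain.1 hc').2
    have h1 := hbound c' hc' him
    have h2 : ‖f c'‖ ≤ |C| * Real.exp (-(K * c'.2.re)) :=
      h1.trans (mul_le_mul_of_nonneg_right (le_abs_self C) (Real.exp_pos _).le)
    have h3 : -(ν.im * c'.2.im) ≤ |ν.im| * (2 * Real.pi) := by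
      have := neg_abs_le ν.im
      have h4 := him.1
      have h5 := him.2
      calc -(ν.im * c'.2.im) ≤ |ν.im| * c'.2.im := by nlinarith
        _ ≤ _ := by gcongr
    calc _ ≤ Real.exp (ν.re * c'.2.re) * Real.exp (|ν.im| * (2 * Real.pi)) *
          (|C| * Real.exp (-(K * c'.2.re))) := by gcongr
      _ = Real.exp ((ν.re - K) * c'.2.re) * Real.exp (|ν.im| * (2 * Real.pi)) * |C| := by
        rw [show (ν.re - K) * c'.2.re = ν.re * c'.2.re + -(K * c'.2.re) by ring, Real.exp_add]
        ring
      _ ≤ _ := by gcongr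
  obtain ⟨g₂, hg₂, e₂⟩ := exists_analytic_extension isOpen_ball (g := g₁)
    (fun c hc hc2 => hg₁ c ⟨hc, hc2⟩) (fun c hc _ => ⟨_, by
      filter_upwards [isOpen_ball.mem_nhds hc] with c' hc' hc2 using hb c' ⟨hc', hc2⟩⟩)
  obtain ⟨k, g, hg, e₃, hx⟩ := exists_eq_pow_snd_smul hg₂ (by
    obtain ⟨c, hc, hfc⟩ := hne
    refine ⟨coverMap c, hc, ?_⟩
    rw [e₂ _ hc (coverMap_snd_ne_zero c), ← e₁ c hc]
    exact smul_ne_zero (Complex.exp_ne_zero _) hfc)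
  -- The exponent `-ν` undoes the auxiliary factor, and `y ^ k` is the largest power of `y` dividing
  -- the holomorphic extension.
  refine ⟨-ν + k, g, hg, fun c hc => ?_, hx⟩
  have h1 := e₁ c hc
  rw [← e₂ _ hc (coverMap_snd_ne_zero c), e₃ _ hc] at h1
  have h2 : (coverMap c).2 ^ k = Complex.exp (k * c.2) := (Complex.exp_nat_mul c.2 k).symm
  rw [add_mul, Complex.exp_add, mul_smul, ← h2, ← h1, smul_smul, ← Complex.exp_add]
  simp

/-- A function whose logarithmic derivative in the direction of the fibres of `x` is bounded has
moderate growth. -/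
theorem exists_moderate_bound {ε ε' K : ℝ} (hε' : 0 < ε') (hlt : ε' < ε) {τ : E → V}
    (hτ : DifferentiableOn ℂ τ (coverDomain ε))
    (hK : ∀ c ∈ coverDomain ε, ‖fderiv ℂ τ c (0, 1)‖ ≤ K * ‖τ c‖) :
    ∃ C, 0 ≤ C ∧ ∀ c ∈ coverDomain ε', c.2.im ∈ Icc 0 (2 * Real.pi) →
      ‖τ c‖ ≤ C * Real.exp (-(K * c.2.re)) := by
  set L := Real.log ε' with hL
  have hexpL : Real.exp L = ε' := Real.exp_log hε'
  let j : ℂ × ℝ → E := fun q => (q.1, L + q.2 * Complex.I)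
  have hj : Continuous j := by fun_prop
  have hjm : MapsTo j (closedBall 0 ε' ×ˢ Icc 0 (2 * Real.pi)) (coverDomain ε) := by
    intro q hq
    rw [mem_coverDomain]
    refine ⟨(mem_closedBall_zero_iff.1 hq.1).trans_lt hlt, ?_⟩
    simpa [j, hexpL] using hlt
  obtain ⟨C₀, hC₀⟩ := ((isCompact_closedBall (0 : ℂ) ε').prod
    (isCompact_Icc (a := (0 : ℝ)) (b := 2 * Real.pi))).exists_bound_of_continuousOn
    (hτ.continuousOn.comp hj.continuousOn hjm)
  have hC₀' : 0 ≤ C₀ := (norm_nonneg _).trans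
    (hC₀ (0, 0) ⟨mem_closedBall_self hε'.le, le_rfl, by positivity⟩)
  refine ⟨C₀ * Real.exp (K * L), by positivity, fun c hc him => ?_⟩
  obtain ⟨hc1, hc2⟩ := mem_coverDomain.1 hc
  have hre : c.2.re < L := (Real.lt_log_iff_exp_lt hε').2 hc2
  -- The path keeps `x` and `arg y` fixed and lowers `Re s` at unit speed, from `|y| = ε'`, where
  -- `τ` is bounded by compactness, down to `c`. Grönwall's inequality along it gives the power of
  -- `|y|`.
  let p : ℝ → E := fun t => (c.1, ((L - t : ℝ) : ℂ) + c.2.im * Complex.I)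
  have hpd : ∀ t, HasDerivAt p (0, -1) t := by
    intro t
    refine (hasDerivAt_const t c.1).prodMk ?_
    have h := (((hasDerivAt_id t).const_sub L).ofReal_comp).add_const (c.2.im * Complex.I)
    simpa using h
  have hpm : ∀ t, 0 ≤ t → p t ∈ coverDomain ε := by
    intro t ht
    rw [mem_coverDomain]
    refine ⟨hc1.trans hlt, ?_⟩
    have : Real.exp (L - t) ≤ Real.exp L := Real.exp_le_exp.2 (by linarith)
    simp only [p, Complex.add_re, Complex.ofReal_re, Complex.mul_re, Complex.I_re, Complex.I_im,
      Complex.ofReal_im, mul_zero, zero_mul, sub_zero, add_zero]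
    linarith
  have hder : ∀ t, 0 ≤ t → HasDerivAt (fun t => τ (p t)) (fderiv ℂ τ (p t) (0, -1)) t := by
    intro t ht
    have h := (hτ.differentiableAt ((isOpen_coverDomain ε).mem_nhds
      (hpm t ht))).hasFDerivAt.restrictScalars ℝ
    exact h.comp_hasDerivAt t (hpd t)
  have hgr := norm_le_gronwallBound_of_norm_deriv_right_le (f := fun t => τ (p t))
    (f' := fun t => fderiv ℂ τ (p t) (0, -1)) (δ := C₀) (K := K) (ε := 0) (a := 0)
    (b := L - c.2.re)
    (fun t ht => (hder t ht.1).continuousAt.continuousWithinAt)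
    (fun t ht => (hder t ht.1).hasDerivWithinAt) (by
      have := hC₀ (c.1, c.2.im) ⟨mem_closedBall_zero_iff.2 hc1.le, him⟩
      simpa [p, j] using this) (by
      intro t ht
      have h : ((0, -1) : E) = -(0, 1) := by simp
      rw [h, map_neg, norm_neg, add_zero]
      exact hK _ (hpm t ht.1)) (L - c.2.re) ⟨by linarith, le_rfl⟩
  have hp : p (L - c.2.re) = c := by
    ext
    · rfl
    · simp only [p, sub_sub_cancel]
      exact Complex.re_add_im _
  simp only [hp, gronwallBound_ε0, sub_zero] at hgr
  refine hgr.trans (le_of_eq ?_)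
  rw [mul_assoc, ← Real.exp_add]
  congr 2
  ring

end Descent

/-! ### Comparison of the given connection with the torsion-free one. -/

section RegularSingular

/-- Allowing every large exponent lets finitely many functions share one. -/
theorem MeromorphicAlong.exists_bound {V : Type*} [NormedAddCommGroup V] [NormedSpace ℂ V]
    [CompleteSpace V] {f : E → V} (hf : MeromorphicAlong f) : ∀ᶠ n : ℕ in Filter.atTop, ∃ M : ℝ,
      ∀ᶠ c in 𝓝 (0 : E), c.2 ≠ 0 → AnalyticAt ℂ f c ∧ ‖c.2‖ ^ n * ‖f c‖ ≤ M := by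
  obtain ⟨m, g, hg, hfg⟩ := hf
  filter_upwards [Filter.eventually_ge_atTop m] with n hn
  refine ⟨‖g 0‖ + 1, ?_⟩
  have hbd : ∀ᶠ c in 𝓝 (0 : E), ‖g c‖ < ‖g 0‖ + 1 :=
    hg.continuousAt.norm.eventually_lt_const (lt_add_one _)
  have hle : ∀ᶠ c in 𝓝 (0 : E), ‖c.2‖ < 1 :=
    (continuous_snd.norm.continuousAt (x := (0 : E))).eventually_lt_const (by simp)
  filter_upwards [hfg.eventually_nhds, hg.eventually_analyticAt, hbd, hle] with c h1 h2 h3 h4 hc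
  constructor
  · have : AnalyticAt ℂ (fun c : E => (c.2 ^ m)⁻¹ • g c) c :=
      ((analyticAt_snd.pow m).inv (pow_ne_zero m hc)).smul h2
    refine this.congr ?_
    filter_upwards [h1, isOpen_snd_ne_zero.mem_nhds hc] with c' h1' hc'
    rw [← h1' hc', inv_smul_smul₀ (pow_ne_zero m hc')]
  · have e := h1.self_of_nhds hc
    calc ‖c.2‖ ^ n * ‖f c‖ ≤ ‖c.2‖ ^ m * ‖f c‖ := by
          gcongr ?_ * _
          exact pow_le_pow_of_le_one (norm_nonneg _) h4.le hn
      _ = ‖g c‖ := by rw [← e, norm_smul, norm_pow]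
      _ ≤ _ := h3.le

/-- A closed form on the universal covering, invariant under the deck transformation, is minus the
logarithmic derivative of a function with multiplicative monodromy. -/
theorem exists_integrating_factor {ε : ℝ} (hε : 0 < ε) {ψ : OneForm}
    (hψ : AnalyticOnNhd ℂ ψ (coverDomain ε))
    (hcl : ∀ c ∈ coverDomain ε, ∀ X Y, extD ψ c X Y = 0)
    (hper : ∀ c ∈ coverDomain ε, ψ (deck c) = ψ c) :
    ∃ h : E → ℂ, (∀ c, h c ≠ 0) ∧ (∀ c ∈ coverDomain ε, HasFDerivAt h (-(h c) • ψ c) c) ∧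
      ∃ b : ℂ, b ≠ 0 ∧ ∀ c ∈ coverDomain ε, h (deck c) = b * h c := by
  have hΩ := isOpen_coverDomain ε
  have hconv := convex_coverDomain hε
  obtain ⟨P, hP⟩ := hconv.exists_forall_hasFDerivAt_of_fderiv_symmetric (𝕜 := ℂ) hΩ
    (fun c hc => ((hψ c hc).differentiableAt.restrictScalars ℝ).differentiableWithinAt) (by
      intro c hc X Y
      rw [((hψ c hc).differentiableAt.hasFDerivAt.restrictScalars ℝ).fderiv]
      exact sub_eq_zero.1 (hcl c hc X Y))
  obtain ⟨c₀, hc₀⟩ := coverDomain_nonempty hε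
  -- As `ψ` is invariant, its primitive `P` changes by a constant under the deck transformation, and
  -- `exp (-P)` is multiplied by a constant.
  have hdeck : ∀ c ∈ coverDomain ε, HasFDerivAt (fun c => P (deck c) - P c) (0 : E →L[ℂ] ℂ) c := by
    intro c hc
    have h1 := hP _ (deck_mem_coverDomain.2 hc)
    have h2 : HasFDerivAt deck (ContinuousLinearMap.id ℂ E) c := (hasFDerivAt_id c).add_const _
    have h3 := (h1.comp c h2).sub (hP c hc)
    rw [hper c hc, ContinuousLinearMap.comp_id, sub_self] at h3
    exact h3
  have hconst : ∀ c ∈ coverDomain ε, P (deck c) - P c = P (deck c₀) - P c₀ := by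
    intro c hc
    exact hΩ.is_const_of_fderiv_eq_zero (𝕜 := ℂ) (f := fun c => P (deck c) - P c)
      hconv.isPreconnected
      (fun c hc => (hdeck c hc).differentiableAt.differentiableWithinAt)
      (fun c hc => (hdeck c hc).fderiv) hc hc₀
  refine ⟨fun c => Complex.exp (-(P c)), fun c => Complex.exp_ne_zero _, fun c hc => ?_,
    Complex.exp (-(P (deck c₀) - P c₀)), Complex.exp_ne_zero _, fun c hc => ?_⟩
  · have e := (hP c hc).neg.cexp
    rw [smul_neg, ← neg_smul] at e
    exact e
  · rw [← Complex.exp_add, ← hconst c hc]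
    ring_nf

variable {α β γ : OneForm} {θ : Fin 2 → Fin 2 → OneForm}

/-- The scalar form by which the connection `d + θ` on the tangent bundle differs from the
torsion-free one, on the universal covering. -/
def scalarForm (α β γ : OneForm) (θ : Fin 2 → Fin 2 → OneForm) : OneForm := fun c =>
  (1 / 2 : ℂ) • (kappa (coverα α) (coverβ β) (coverγ γ) c + ContinuousLinearMap.snd ℂ ℂ ℂ +
    pullback (fun c => θ 0 0 c + θ 1 1 c) c)

/-- Both connections induce the same Riccati equation, so they can differ only by a scalar form,
determined by the traces. Hence a kernel field of a parallel form is flat for `d + θ` up to this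
scalar. -/
theorem fderiv_kerVec_of_isParallelAt {w : OneForm} {c : E} (hd : DifferentiableAt ℂ w c)
    (hp : IsParallelAt (coverα α) (coverβ β) (coverγ γ) w c)
    (hα : α (coverMap c) = -θ 0 1 (coverMap c))
    (hβ : β (coverMap c) = θ 1 1 (coverMap c) - θ 0 0 (coverMap c))
    (hγ : γ (coverMap c) = θ 1 0 (coverMap c)) (X : E) :
    fderiv ℂ (kerVec w) c X =
      (-(pullback (θ 0 0) c X * (kerVec w c).1 + pullback (θ 0 1) c X * (kerVec w c).2) +
          scalarForm α β γ θ c X * (kerVec w c).1,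
        -(pullback (θ 1 0) c X * (kerVec w c).1 + pullback (θ 1 1) c X * (kerVec w c).2) +
          scalarForm α β γ θ c X * (kerVec w c).2) := by
  have he : Complex.exp (-c.2) * Complex.exp c.2 = 1 := by
    rw [← Complex.exp_add]
    simp
  have hT : pullback (fun c => θ 0 0 c + θ 1 1 c) c X = pullback (θ 0 0) c X + pullback (θ 1 1) c X := by
    simp only [pullback_apply, add_apply]
  have hα' : pullback α c X = -pullback (θ 0 1) c X := by
    rw [pullback_apply, hα, neg_apply, pullback_apply]
  have hβ' : pullback β c X = pullback (θ 1 1) c X - pullback (θ 0 0) c X := by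
    rw [pullback_apply, hβ, sub_apply, pullback_apply, pullback_apply]
  have hγ' : pullback γ c X = pullback (θ 1 0) c X := by
    rw [pullback_apply, hγ, pullback_apply]
  have hψ : scalarForm α β γ θ c X = (kappa (coverα α) (coverβ β) (coverγ γ) c X + X.2 +
      (pullback (θ 0 0) c X + pullback (θ 1 1) c X)) / 2 := by
    simp only [scalarForm, smul_apply, add_apply, ContinuousLinearMap.coe_snd', smul_eq_mul, hT]
    ring
  rw [fderiv_kerVec hd, (hp X).1, (hp X).2, connA_apply, connE_apply, kerVec_eq, hψ]
  generalize kappa (coverα α) (coverβ β) (coverγ γ) c X = k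
  simp only [coverα, coverβ, coverγ, smul_apply, add_apply, ContinuousLinearMap.coe_snd',
    smul_eq_mul, hα', hβ', hγ']
  ext
  · ring
  · simp only
    linear_combination (-(pullback (θ 1 0) c X) * w c (0, 1)) * he

/-- The scalar form is closed. -/
theorem extD_scalarForm {r ε : ℝ} (hεr : ε ≤ r)
    (h : IsTorsionFreeRiccati α β γ (puncturedBall r))
    (hθ : ∀ c ∈ puncturedBall ε, ∀ i j, AnalyticAt ℂ (θ i j) c)
    (hflat : ∀ c ∈ puncturedBall ε, ∀ (i j : Fin 2) (X Y : E),
      extD (θ i j) c X Y + ∑ k, wedge (θ i k c) (θ k j c) X Y = 0) :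
    AnalyticOnNhd ℂ (scalarForm α β γ θ) (coverDomain ε) ∧
      (∀ c ∈ coverDomain ε, ∀ X Y, extD (scalarForm α β γ θ) c X Y = 0) ∧
      ∀ c, scalarForm α β γ θ (deck c) = scalarForm α β γ θ c := by
  have hκ := h.cover.analytic_kappa.mono (coverDomain_mono hεr)
  have hT : ∀ c ∈ puncturedBall ε, AnalyticAt ℂ (fun c => θ 0 0 c + θ 1 1 c) c := fun c hc =>
    (hθ c hc 0 0).add (hθ c hc 1 1)
  refine ⟨fun c hc => (((hκ c hc).add analyticAt_const).add
      (analyticAt_pullback (hT _ (coverMap_mem_puncturedBall hc)))).fun_const_smul, ?_, ?_⟩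
  · intro c hc X Y
    have hc' := coverMap_mem_puncturedBall hc
    have d1 := ((hκ c hc).differentiableAt.hasFDerivAt.add_const (ContinuousLinearMap.snd ℂ ℂ ℂ)).add
      (hasFDerivAt_pullback (hT _ hc'))
    have d2 : HasFDerivAt (scalarForm α β γ θ) _ c := d1.const_smul (1 / 2 : ℂ)
    have e1 := h.cover.torsion c (coverDomain_mono hεr hc) X Y
    -- The trace of a flat connection is closed: the wedge products in its two diagonal equations
    -- cancel.
    have e2 : extD (pullback fun c => θ 0 0 c + θ 1 1 c) c X Y = 0 := by
      rw [extD_pullback (hT _ hc')]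
      have f0 := hflat _ hc' 0 0 (X.1, Complex.exp c.2 * X.2) (Y.1, Complex.exp c.2 * Y.2)
      have f1 := hflat _ hc' 1 1 (X.1, Complex.exp c.2 * X.2) (Y.1, Complex.exp c.2 * Y.2)
      have hadd : fderiv ℂ (fun c => θ 0 0 c + θ 1 1 c) (coverMap c) =
          fderiv ℂ (θ 0 0) (coverMap c) + fderiv ℂ (θ 1 1) (coverMap c) :=
        fderiv_fun_add (hθ _ hc' 0 0).differentiableAt (hθ _ hc' 1 1).differentiableAt
      simp only [Fin.sum_univ_two, extD, wedge] at f0 f1 ⊢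
      rw [hadd]
      simp only [add_apply]
      linear_combination f0 + f1
    rw [extD] at e1 e2 ⊢
    rw [d2.fderiv]
    simp only [smul_apply, add_apply, smul_eq_mul]
    linear_combination e1 / 2 + e2 / 2
  · intro c
    have hp : ∀ η : OneForm, pullback η (deck c) = pullback η c := fun η => by
      refine ContinuousLinearMap.ext fun X => ?_
      rw [pullback_apply, pullback_apply, coverMap_deck, exp_deck]
    simp only [scalarForm, kappa_cover, hp]

end RegularSingular

/-! ### Gauge transformation of flat sections. -/

section Gauge

/-- The components, in the frame given by the columns of `G`, of a multivalued vector field. -/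
def gaugeInv (G : Fin 2 → Fin 2 → E → ℂ) (σ : E → ℂ × ℂ) (c : E) : ℂ × ℂ :=
  ((G 1 1 (coverMap c) * (σ c).1 - G 0 1 (coverMap c) * (σ c).2) /
      (G 0 0 (coverMap c) * G 1 1 (coverMap c) - G 0 1 (coverMap c) * G 1 0 (coverMap c)),
    (G 0 0 (coverMap c) * (σ c).2 - G 1 0 (coverMap c) * (σ c).1) /
      (G 0 0 (coverMap c) * G 1 1 (coverMap c) - G 0 1 (coverMap c) * G 1 0 (coverMap c)))

theorem eq_gauge_gaugeInv {G : Fin 2 → Fin 2 → E → ℂ} (σ : E → ℂ × ℂ) {c : E}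
    (hdet : G 0 0 (coverMap c) * G 1 1 (coverMap c) -
      G 0 1 (coverMap c) * G 1 0 (coverMap c) ≠ 0) :
    (σ c).1 = G 0 0 (coverMap c) * (gaugeInv G σ c).1 + G 0 1 (coverMap c) * (gaugeInv G σ c).2 ∧
    (σ c).2 = G 1 0 (coverMap c) * (gaugeInv G σ c).1 + G 1 1 (coverMap c) * (gaugeInv G σ c).2 := by
  simp only [gaugeInv, mul_div_assoc', ← add_div]
  constructor
  all_goals
    rw [eq_div_iff hdet]
    ring

/-- In the logarithmic gauge the equation in the direction `∂_s` has the matrix `-A`, which is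
holomorphic and so bounded near the origin. -/
theorem fderiv_gaugeInv {ε : ℝ} {θ : Fin 2 → Fin 2 → OneForm} {G A B : Fin 2 → Fin 2 → E → ℂ}
    (hG : ∀ c ∈ puncturedBall ε, ∀ i j, AnalyticAt ℂ (G i j) c)
    (hdet : ∀ c ∈ puncturedBall ε, G 0 0 c * G 1 1 c - G 0 1 c * G 1 0 c ≠ 0)
    (hgauge : ∀ c ∈ puncturedBall ε, ∀ (i j : Fin 2) (X : E),
      ∑ k, G i k c * (A k j c * (X.2 / c.2) + B k j c * X.1) =
        ∑ k, θ i k c X * G k j c + fderiv ℂ (G i j) c X)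
    {σ : E → ℂ × ℂ} (hσ : DifferentiableOn ℂ σ (coverDomain ε))
    (hσ' : ∀ c ∈ coverDomain ε, fderiv ℂ σ c (0, 1) =
      (-(pullback (θ 0 0) c (0, 1) * (σ c).1 + pullback (θ 0 1) c (0, 1) * (σ c).2),
        -(pullback (θ 1 0) c (0, 1) * (σ c).1 + pullback (θ 1 1) c (0, 1) * (σ c).2))) :
    DifferentiableOn ℂ (gaugeInv G σ) (coverDomain ε) ∧
    ∀ c ∈ coverDomain ε, fderiv ℂ (gaugeInv G σ) c (0, 1) =
      (-(A 0 0 (coverMap c) * (gaugeInv G σ c).1 + A 0 1 (coverMap c) * (gaugeInv G σ c).2),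
        -(A 1 0 (coverMap c) * (gaugeInv G σ c).1 + A 1 1 (coverMap c) * (gaugeInv G σ c).2)) := by
  have hGd : ∀ c ∈ coverDomain ε, ∀ i j, HasFDerivAt (fun c => G i j (coverMap c))
      ((fderiv ℂ (G i j) (coverMap c)).comp (fderiv ℂ coverMap c)) c := fun c hc i j =>
    ((hG _ (coverMap_mem_puncturedBall hc) i j).differentiableAt.hasFDerivAt).comp c
      (analyticAt_coverMap c).differentiableAt.hasFDerivAt
  have hσd : ∀ c ∈ coverDomain ε, HasFDerivAt σ (fderiv ℂ σ c) c := fun c hc =>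
    (hσ.differentiableAt ((isOpen_coverDomain ε).mem_nhds hc)).hasFDerivAt
  have hτ : ∀ c ∈ coverDomain ε, DifferentiableAt ℂ (gaugeInv G σ) c := by
    intro c hc
    have g := fun i j => (hGd c hc i j).differentiableAt
    have s1 := (hσd c hc).fst.differentiableAt
    have s2 := (hσd c hc).snd.differentiableAt
    have hdet' := hdet _ (coverMap_mem_puncturedBall hc)
    have d := ((g 0 0).fun_mul (g 1 1)).fun_sub ((g 0 1).fun_mul (g 1 0))
    have di := d.fun_inv hdet'
    have n1 := (((g 1 1).fun_mul s1).fun_sub ((g 0 1).fun_mul s2)).fun_mul di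
    have n2 := (((g 0 0).fun_mul s2).fun_sub ((g 1 0).fun_mul s1)).fun_mul di
    refine (n1.prodMk n2).congr_of_eventuallyEq (Filter.Eventually.of_forall fun c' => ?_)
    simp only [gaugeInv, div_eq_mul_inv]
  refine ⟨fun c hc => (hτ c hc).differentiableWithinAt, fun c hc => ?_⟩
  have hc' := coverMap_mem_puncturedBall hc
  have hτd := (hτ c hc).hasFDerivAt
  have hdet' := hdet _ hc'
  obtain ⟨u1, u2⟩ := eq_gauge_gaugeInv σ hdet'
  have ev : ∀ᶠ c' in 𝓝 c, c' ∈ coverDomain ε := (isOpen_coverDomain ε).mem_nhds hc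
  have ev1 : (fun c => (σ c).1) =ᶠ[𝓝 c] fun c => G 0 0 (coverMap c) * (gaugeInv G σ c).1 +
      G 0 1 (coverMap c) * (gaugeInv G σ c).2 := by
    filter_upwards [ev] with c' h'
    exact (eq_gauge_gaugeInv σ (hdet _ (coverMap_mem_puncturedBall h'))).1
  have ev2 : (fun c => (σ c).2) =ᶠ[𝓝 c] fun c => G 1 0 (coverMap c) * (gaugeInv G σ c).1 +
      G 1 1 (coverMap c) * (gaugeInv G σ c).2 := by
    filter_upwards [ev] with c' h'
    exact (eq_gauge_gaugeInv σ (hdet _ (coverMap_mem_puncturedBall h'))).2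
  have d1 := (((hGd c hc 0 0).mul hτd.fst).add ((hGd c hc 0 1).mul hτd.snd)).congr_of_eventuallyEq ev1
  have d2 := (((hGd c hc 1 0).mul hτd.fst).add ((hGd c hc 1 1).mul hτd.snd)).congr_of_eventuallyEq ev2
  have k1 := congrArg (fun L : E →L[ℂ] ℂ => L (0, 1)) ((hσd c hc).fst.unique d1)
  have k2 := congrArg (fun L : E →L[ℂ] ℂ => L (0, 1)) ((hσd c hc).snd.unique d2)
  have hm : fderiv ℂ coverMap c (0, 1) = (0, Complex.exp c.2) := by
    rw [fderiv_coverMap_apply]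
    simp
  have hp : ∀ i j, pullback (θ i j) c (0, 1) = θ i j (coverMap c) (0, Complex.exp c.2) :=
    fun i j => by rw [pullback_apply, mul_one]
  have gg := fun i j => hgauge _ hc' i j (0, Complex.exp c.2)
  -- On `∂_s` the form `dy / y` takes the value one and `dx` the value zero, so `B` drops out.
  have hy : Complex.exp c.2 / (coverMap c).2 = 1 := div_self (Complex.exp_ne_zero _)
  simp only [Fin.sum_univ_two, hy, mul_one, mul_zero, add_zero] at gg
  simp only [ContinuousLinearMap.comp_apply, add_apply, smul_apply, smul_eq_mul, hm,
    ContinuousLinearMap.coe_fst', ContinuousLinearMap.coe_snd', hσ' c hc, hp] at k1 k2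
  generalize fderiv ℂ (gaugeInv G σ) c (0, 1) = τ' at *
  have g00 := gg 0 0
  have g01 := gg 0 1
  have g10 := gg 1 0
  have g11 := gg 1 1
  rw [u1, u2] at k1 k2
  set t := gaugeInv G σ c with ht
  clear_value t
  generalize G 0 0 (coverMap c) = a at *
  generalize G 0 1 (coverMap c) = b at *
  generalize G 1 0 (coverMap c) = p at *
  generalize G 1 1 (coverMap c) = q at *
  ext
  · apply mul_right_cancel₀ hdet'
    linear_combination -q * k1 + b * k2 + q * t.1 * g00 + q * t.2 * g01 - b * t.1 * g10 - b * t.2 * g11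
  · apply mul_right_cancel₀ hdet'
    linear_combination p * k1 - a * k2 - p * t.1 * g00 - p * t.2 * g01 + a * t.1 * g10 + a * t.2 * g11

end Gauge

/-! ### Moderate growth of flat sections. -/

section RegularSingular

theorem exists_uniform_bound (M : Fin 2 → Fin 2 → ℝ) : ∃ M', 0 ≤ M' ∧ ∀ i j, M i j ≤ M' := by
  obtain ⟨N, hN⟩ := (Set.finite_range fun p : Fin 2 × Fin 2 => M p.1 p.2).bddAbove
  exact ⟨max N 0, le_max_right _ _, fun i j =>
    (hN ⟨(i, j), rfl⟩ : M i j ≤ N).trans (le_max_left _ _)⟩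

/-- A common polydisc on which the data of a regular-singular connection are defined and
bounded by powers of `y`. -/
theorem exists_regular_radius {r : ℝ} (hr : 0 < r) {θ : Fin 2 → Fin 2 → OneForm}
    {G A : Fin 2 → Fin 2 → E → ℂ} {P : E → Prop} (hθ : ∀ i j, MeromorphicAlong (θ i j))
    (hG : ∀ i j, MeromorphicAlong (G i j)) (hA : ∀ i j, AnalyticAt ℂ (A i j) 0)
    (hP : ∀ᶠ c in 𝓝 (0 : E), c.2 ≠ 0 → P c) :
    ∃ ε, 0 < ε ∧ ε ≤ r ∧ (∀ c ∈ puncturedBall ε, P c) ∧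
      (∀ c ∈ puncturedBall ε, ∀ i j, AnalyticAt ℂ (θ i j) c) ∧
      (∀ c ∈ puncturedBall ε, ∀ i j, AnalyticAt ℂ (G i j) c) ∧
      ∃ (n : ℕ) (M : ℝ), 0 ≤ M ∧ ∀ c ∈ puncturedBall ε, ∀ i j,
        ‖c.2‖ ^ n * ‖G i j c‖ ≤ M ∧ ‖A i j c‖ ≤ M := by
  obtain ⟨m, hm⟩ := (Filter.eventually_all.2 fun i => Filter.eventually_all.2 fun j =>
    (hθ i j).exists_bound).exists
  obtain ⟨n, hn⟩ := (Filter.eventually_all.2 fun i => Filter.eventually_all.2 fun j =>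
    (hG i j).exists_bound).exists
  choose M₀ hM₀ using hm
  choose M₁ hM₁ using hn
  obtain ⟨M₂, h₂, hM₂⟩ := exists_uniform_bound M₁
  obtain ⟨M₃, h₃, hM₃⟩ := exists_uniform_bound fun i j => ‖A i j 0‖ + 1
  have hA' : ∀ᶠ c in 𝓝 (0 : E), ∀ i j, ‖A i j c‖ < ‖A i j 0‖ + 1 :=
    Filter.eventually_all.2 fun i => Filter.eventually_all.2 fun j =>
      (hA i j).continuousAt.norm.eventually_lt_const (lt_add_one _)
  have hall := ((hA'.and (Filter.eventually_all.2 fun i => Filter.eventually_all.2 fun j =>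
    hM₀ i j)).and (Filter.eventually_all.2 fun i => Filter.eventually_all.2 fun j =>
    hM₁ i j)).and hP
  obtain ⟨δ, hδ, hball⟩ := Metric.eventually_nhds_iff_ball.1 hall
  have key : ∀ c ∈ puncturedBall (min δ r), _ := fun c hc =>
    hball c (ball_subset_ball (min_le_left _ _) hc.1)
  refine ⟨min δ r, lt_min hδ hr, min_le_right _ _, fun c hc => (key c hc).2 hc.2,
    fun c hc i j => ((key c hc).1.1.2 i j hc.2).1, fun c hc i j => ((key c hc).1.2 i j hc.2).1,
    n, max M₂ M₃, h₂.trans (le_max_left _ _), fun c hc i j => ⟨?_, ?_⟩⟩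
  · exact ((key c hc).1.2 i j hc.2).2.trans ((hM₂ i j).trans (le_max_left _ _))
  · exact ((key c hc).1.1.1 i j).le.trans ((hM₃ i j).trans (le_max_right _ _))

/-- Multivalued flat sections of a regular-singular connection have moderate growth. -/
theorem exists_moderate_bound_of_gauge {ε : ℝ} (hε : 0 < ε) {θ : Fin 2 → Fin 2 → OneForm}
    {G A B : Fin 2 → Fin 2 → E → ℂ}
    (hG : ∀ c ∈ puncturedBall ε, ∀ i j, AnalyticAt ℂ (G i j) c)
    (hdet : ∀ c ∈ puncturedBall ε, G 0 0 c * G 1 1 c - G 0 1 c * G 1 0 c ≠ 0)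
    (hgauge : ∀ c ∈ puncturedBall ε, ∀ (i j : Fin 2) (X : E),
      ∑ k, G i k c * (A k j c * (X.2 / c.2) + B k j c * X.1) =
        ∑ k, θ i k c X * G k j c + fderiv ℂ (G i j) c X)
    {n : ℕ} {M : ℝ} (hM : 0 ≤ M)
    (hb : ∀ c ∈ puncturedBall ε, ∀ i j, ‖c.2‖ ^ n * ‖G i j c‖ ≤ M ∧ ‖A i j c‖ ≤ M)
    {σ : E → ℂ × ℂ} (hσ : DifferentiableOn ℂ σ (coverDomain ε))
    (hσ' : ∀ c ∈ coverDomain ε, fderiv ℂ σ c (0, 1) =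
      (-(pullback (θ 0 0) c (0, 1) * (σ c).1 + pullback (θ 0 1) c (0, 1) * (σ c).2),
        -(pullback (θ 1 0) c (0, 1) * (σ c).1 + pullback (θ 1 1) c (0, 1) * (σ c).2))) :
    ∃ C K : ℝ, ∀ c ∈ coverDomain (ε / 2), c.2.im ∈ Icc 0 (2 * Real.pi) →
      ‖σ c‖ ≤ C * Real.exp (-(K * c.2.re)) := by
  obtain ⟨hd, hd'⟩ := fderiv_gaugeInv hG hdet hgauge hσ hσ'
  have hcomb : ∀ (a b : ℂ) (u : ℂ × ℂ) (N : ℝ), ‖a‖ ≤ N → ‖b‖ ≤ N →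
      ‖a * u.1 + b * u.2‖ ≤ 2 * N * ‖u‖ := by
    intro a b u N ha hb
    have hN : 0 ≤ N := (norm_nonneg a).trans ha
    calc ‖a * u.1 + b * u.2‖ ≤ ‖a‖ * ‖u.1‖ + ‖b‖ * ‖u.2‖ := by
          simpa only [norm_mul] using norm_add_le (a * u.1) (b * u.2)
      _ ≤ N * ‖u‖ + N * ‖u‖ := by
          gcongr
          exacts [norm_fst_le u, norm_snd_le u]
      _ = 2 * N * ‖u‖ := by ring
  obtain ⟨C, hC, hbd⟩ := exists_moderate_bound (half_pos hε) (half_lt_self hε)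
    (K := 2 * M) hd (fun c hc => by
      have hA := fun i j => (hb _ (coverMap_mem_puncturedBall hc) i j).2
      rw [hd' c hc, Prod.norm_def]
      simp only [norm_neg]
      exact max_le (hcomb _ _ _ _ (hA 0 0) (hA 0 1)) (hcomb _ _ _ _ (hA 1 0) (hA 1 1)))
  -- In the exponent, `n` bounds the poles of the gauge matrix and `2 * M` the logarithmic
  -- derivative in the new gauge; the factors `2` are from `2 × 2` matrices in the sup norm.
  refine ⟨2 * M * C, n + 2 * M, fun c hc him => ?_⟩
  have hc' := coverMap_mem_puncturedBall (coverDomain_mono (half_le_self hε.le) hc)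
  obtain ⟨u1, u2⟩ := eq_gauge_gaugeInv σ (hdet _ hc')
  have hy : ‖(coverMap c).2‖ = Real.exp c.2.re := Complex.norm_exp _
  have hGb : ∀ i j, ‖G i j (coverMap c)‖ ≤ M * Real.exp (-(n * c.2.re)) := fun i j => by
    have := (hb _ hc' i j).1
    rw [hy, ← Real.exp_nat_mul, mul_comm] at this
    rwa [Real.exp_neg, ← div_eq_mul_inv, le_div_iff₀ (Real.exp_pos _)]
  have hle : ‖σ c‖ ≤ 2 * (M * Real.exp (-(n * c.2.re))) * ‖gaugeInv G σ c‖ := by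
    rw [Prod.norm_def, u1, u2]
    exact max_le (hcomb _ _ _ _ (hGb 0 0) (hGb 0 1)) (hcomb _ _ _ _ (hGb 1 0) (hGb 1 1))
  calc ‖σ c‖ ≤ 2 * (M * Real.exp (-(n * c.2.re))) * (C * Real.exp (-(2 * M * c.2.re))) :=
        hle.trans (mul_le_mul_of_nonneg_left (hbd c hc him) (by positivity))
    _ = 2 * M * C * Real.exp (-((n + 2 * M) * c.2.re)) := by
        rw [show -((n + 2 * M) * c.2.re) = -(n * c.2.re) + -(2 * M * c.2.re) by ring, Real.exp_add]
        ring

end RegularSingular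

/-! ### Extension of the foliation of an eigenform. -/

section ExtendsFoliation

theorem kerVec_ne_zero {w : OneForm} {c : E} (h : w c ≠ 0) : kerVec w c ≠ 0 := by
  intro h0
  rw [kerVec_eq] at h0
  have h1 : w c (0, 1) = 0 := congrArg Prod.fst h0
  have h2 : Complex.exp c.2 * -(w c (1, 0)) = 0 := congrArg Prod.snd h0
  refine h (clm_ext_basis ?_ h1)
  simpa [Complex.exp_ne_zero] using h2

/-- If a multivalued form annihilates a multiple of `g`, where `g` is a vector field without zeros
outside of `{y = 0}` and not identically zero on `{y = 0}`, then its kernel extends as a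
holomorphic foliation. -/
theorem exists_extendsFoliation_of_kerVec {ε : ℝ} {w : OneForm}
    (hw : ∀ c ∈ coverDomain ε, w c ≠ 0) {g : E → ℂ × ℂ} (hg : AnalyticOnNhd ℂ g (ball 0 ε))
    {k : E → ℂ} (hk : ∀ c ∈ coverDomain ε, k c ≠ 0)
    (heq : ∀ c ∈ coverDomain ε, k c • kerVec w c = g (coverMap c))
    {x : ℂ} (hx : ((x, 0) : E) ∈ ball (0 : E) ε) (hgx : g (x, 0) ≠ 0) :
    ∃ (η : OneForm) (ρ : ℝ), 0 < ρ ∧ ρ ≤ ε ∧ ExtendsFoliation w η ρ := by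
  have hε : 0 < ε := pos_of_mem_ball hx
  have hmem : ∀ x : ℂ, x ∈ ball (0 : ℂ) ε → ((x, 0) : E) ∈ ball (0 : E) ε := fun x hx =>
    mem_ball_prod_iff.2 ⟨hx, mem_ball_self hε⟩
  have hg0 : AnalyticOnNhd ℂ (fun x : ℂ => g (x, 0)) (ball 0 ε) := fun x hx =>
    AnalyticAt.fun_comp (g := g) (f := fun x : ℂ => ((x, 0) : E)) (hg _ (hmem x hx))
      (analyticAt_id.prod analyticAt_const)
  -- Since `g` is not identically zero on `{y = 0}`, its zeros there are isolated, and a smaller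
  -- polydisc leaves at most the origin.
  have hne : ∀ᶠ x in 𝓝[≠] (0 : ℂ), g (x, 0) ≠ 0 := by
    refine ((hg0 0 (mem_ball_self hε)).eventually_eq_zero_or_eventually_ne_zero).resolve_left ?_
    intro h0
    exact hgx (hg0.eqOn_zero_of_preconnected_of_eventuallyEq_zero
      (convex_ball (0 : ℂ) ε).isPreconnected (mem_ball_self hε) h0 (mem_ball_prod_iff.1 hx).1)
  obtain ⟨δ, hδ, hδ'⟩ := Metric.eventually_nhds_iff_ball.1 (eventually_nhdsWithin_iff.1 hne)
  -- The form `g₁ dy - g₂ dx`, whose kernel is spanned by `g`.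
  refine ⟨fun c => (g c).1 • ContinuousLinearMap.snd ℂ ℂ ℂ - (g c).2 • ContinuousLinearMap.fst ℂ ℂ ℂ,
    min ε δ, lt_min hε hδ, min_le_left _ _, ?_, ?_, ?_⟩
  · intro c hc
    have := hg c (ball_subset_ball (min_le_left _ _) hc)
    exact ((analyticAt_fst.comp this).smul analyticAt_const).sub
      ((analyticAt_snd.comp this).smul analyticAt_const)
  · intro c hc hc0 hη
    have h1 := congrArg (fun l : E →L[ℂ] ℂ => l (1, 0)) hη
    have h2 := congrArg (fun l : E →L[ℂ] ℂ => l (0, 1)) hη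
    simp at h1 h2
    have hgc : g c = 0 := Prod.ext h2 h1
    by_cases hy : c.2 = 0
    · have hcx : c = (c.1, 0) := Prod.ext rfl hy
      rw [hcx] at hgc
      refine hδ' c.1 (ball_subset_ball (min_le_right _ _) (mem_ball_prod_iff.1 hc).1) ?_ hgc
      intro h
      exact hc0 (Prod.ext h hy)
    · obtain ⟨c', hc', rfl, -⟩ := exists_lift ⟨ball_subset_ball (min_le_left _ _) hc, hy⟩
      rw [← heq c' hc'] at hgc
      exact (smul_ne_zero (hk c' hc') (kerVec_ne_zero (hw c' hc'))) hgc
  · intro c hc X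
    have hc' := coverDomain_mono (min_le_left _ _) hc
    have e := heq c hc'
    rw [kerVec_eq] at e
    have e1 : k c * w c (0, 1) = (g (coverMap c)).1 := congrArg Prod.fst e
    have e2 : k c * (Complex.exp c.2 * -(w c (1, 0))) = (g (coverMap c)).2 := congrArg Prod.snd e
    have : pullback (fun c => (g c).1 • ContinuousLinearMap.snd ℂ ℂ ℂ -
        (g c).2 • ContinuousLinearMap.fst ℂ ℂ ℂ) c X = (k c * Complex.exp c.2) * w c X := by
      rw [pullback_apply, clm_apply_eq (w c), ← e1, ← e2]
      simp
      ring
    rw [this, mul_eq_zero, or_iff_right (mul_ne_zero (hk c hc') (Complex.exp_ne_zero _))]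

variable {α β γ : OneForm} {θ : Fin 2 → Fin 2 → OneForm}

/-- The torsion-free connection is not itself assumed regular-singular. The growth estimate is
therefore applied to a rescaled kernel field, flat for `d + θ`; the rescaling does not change the
foliation. -/
theorem exists_extendsFoliation {r : ℝ} (hr : 0 < r)
    (h : IsTorsionFreeRiccati α β γ (puncturedBall r)) (hθ : ∀ i j, MeromorphicAlong (θ i j))
    (hflat : IsFlatConnection θ)
    (hind : ∀ᶠ c in 𝓝 (0 : E), c.2 ≠ 0 →
      α c = - θ 0 1 c ∧ β c = θ 1 1 c - θ 0 0 c ∧ γ c = θ 1 0 c)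
    (hreg : IsRegularSingularConnection θ) {w : OneForm}
    (hw : w ∈ parallelSpace (coverα α) (coverβ β) (coverγ γ) (coverDomain r)) (hw0 : w ≠ 0)
    {a : ℂ} (ha : a ≠ 0) (hmon : monodromy w = a • w) :
    ∃ (η : OneForm) (ρ : ℝ), 0 < ρ ∧ ρ ≤ r ∧ ExtendsFoliation w η ρ := by
  obtain ⟨G, A, B, hG, hdet, hA, -, hgauge⟩ := hreg
  have hev := ((hflat.and hind).and (hdet.and hgauge)).mono fun c hc (hy : c.2 ≠ 0) =>
    (⟨⟨hc.1.1 hy, hc.1.2 hy⟩, hc.2.1 hy, hc.2.2 hy⟩ : (_ ∧ _) ∧ _ ∧ _)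
  obtain ⟨ε, hε, hεr, hP, hθa, hGa, n, M, hM, hb⟩ := exists_regular_radius hr hθ hG hA hev
  obtain ⟨hψa, hψc, hψp⟩ := extD_scalarForm hεr h hθa fun c hc => (hP c hc).1.1
  -- As `du = -u ψ`, the factor `u` cancels the scalar term in the derivative of the kernel field.
  obtain ⟨u, hu0, hu, b, hb0, hub⟩ := exists_integrating_factor hε hψa hψc fun c _ => hψp c
  have hsub := coverDomain_mono hεr
  have hwd : ∀ c ∈ coverDomain ε, DifferentiableAt ℂ w c := fun c hc =>
    (hw.1 c (hsub hc)).differentiableAt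
  have hvd : ∀ c ∈ coverDomain ε, HasFDerivAt (kerVec w) (fderiv ℂ (kerVec w) c) c := by
    intro c hc
    refine DifferentiableAt.hasFDerivAt ?_
    rw [kerVec_eq]
    exact ((analyticAt_clm_apply (hw.1 c (hsub hc)) _).prod ((analyticAt_snd.cexp).mul
      (analyticAt_clm_apply (hw.1 c (hsub hc)) _).neg)).differentiableAt
  have hσd : ∀ c ∈ coverDomain ε, HasFDerivAt (fun c => u c • kerVec w c)
      (u c • fderiv ℂ (kerVec w) c + (-(u c) • scalarForm α β γ θ c).smulRight (kerVec w c)) c :=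
    fun c hc => (hu c hc).smul (hvd c hc)
  have hσ : DifferentiableOn ℂ (fun c => u c • kerVec w c) (coverDomain ε) := fun c hc =>
    (hσd c hc).differentiableAt.differentiableWithinAt
  obtain ⟨C, K, hbd⟩ := exists_moderate_bound_of_gauge hε hGa (fun c hc => (hP c hc).2.1)
    (fun c hc => (hP c hc).2.2) hM hb hσ (fun c hc => by
      have hc' := (hP _ (coverMap_mem_puncturedBall hc)).1.2
      have e := fderiv_kerVec_of_isParallelAt (hwd c hc) (hw.2.2 c (hsub hc)) hc'.1 hc'.2.1 hc'.2.2
        (0, 1)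
      rw [(hσd c hc).fderiv, add_apply, smul_apply, e,
        ContinuousLinearMap.smulRight_apply, smul_apply]
      ext <;> simp only [Prod.fst_add, Prod.snd_add, Prod.smul_fst, Prod.smul_snd, smul_eq_mul] <;>
        ring)
  have hsub2 : coverDomain (ε / 2) ⊆ coverDomain ε := coverDomain_mono (half_le_self hε.le)
  have hwne : ∀ c ∈ coverDomain (ε / 2), w c ≠ 0 := fun c hc =>
    ne_zero_of_mem_parallelSpace h.cover (isOpen_coverDomain r) (convex_coverDomain hr) hw hw0
      (hsub (hsub2 hc))
  obtain ⟨c₁, hc₁⟩ := coverDomain_nonempty (half_pos hε)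
  obtain ⟨μ, g, hg, hfg, x, hx, hgx⟩ := exists_eq_exp_smul_of_moderate (half_pos hε)
    (f := fun c => u c • kerVec w c)
    ((analyticOnNhd_of_differentiableOn (isOpen_coverDomain ε) hσ).mono hsub2)
    -- The field `u • kerVec w` has multiplier `b * a`: `b` from `u` and `a` from `w`.
    (mul_ne_zero hb0 ha) (fun c hc => by
      have e : ∀ X, w (deck c) X = a * w c X := fun X => by
        rw [← monodromy_apply w c, hmon]
        rfl
      simp only [hub c (hsub2 hc), kerVec_eq, e, exp_deck]
      ext <;> simp only [Prod.smul_fst, Prod.smul_snd, smul_eq_mul] <;> ring) hbd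
    ⟨c₁, hc₁, smul_ne_zero (hu0 c₁) (kerVec_ne_zero (hwne c₁ hc₁))⟩
  obtain ⟨η, ρ, hρ, hρε, hη⟩ := exists_extendsFoliation_of_kerVec hwne hg
    (k := fun c => Complex.exp (-(μ * c.2)) * u c)
    (fun c _ => mul_ne_zero (Complex.exp_ne_zero _) (hu0 c))
    (fun c hc => by
      simp only [mul_smul]
      rw [hfg c hc, smul_smul, ← Complex.exp_add, neg_add_cancel, Complex.exp_zero, one_smul])
    hx hgx
  exact ⟨η, ρ, hρ, hρε.trans ((half_le_self hε.le).trans hεr), hη⟩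

end ExtendsFoliation

/-! ### The transport equation along characteristics. -/

section Characteristics

open scoped NNReal

/-- Picard-Lindelöf, with the information that the solution stays in the given ball. -/
theorem exists_solution_mem_closedBall {V : Type*} [NormedAddCommGroup V] [NormedSpace ℝ V]
    [CompleteSpace V] {f : ℝ → V → V} {tmin tmax : ℝ} {t₀ : Icc tmin tmax} {x₀ x : V}
    {a r L K : ℝ≥0} (hf : IsPicardLindelof f t₀ x₀ a r L K) (hx : x ∈ closedBall x₀ r) :
    ∃ X : ℝ → V, X t₀ = x ∧ (∀ t, X t ∈ closedBall x₀ a) ∧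
      ∀ t ∈ Icc tmin tmax, HasDerivWithinAt X (f t (X t)) (Icc tmin tmax) t := by
  obtain ⟨X, hX⟩ := ODE.FunSpace.exists_isFixedPt_next hf hx
  refine ⟨X.compProj, by rw [ODE.FunSpace.compProj_val, ← hX, ODE.FunSpace.next_apply₀],
    fun t => X.compProj_mem_closedBall hf.mul_max_le, fun t ht => ?_⟩
  refine (ODE.hasDerivWithinAt_picard_Icc t₀.2 hf.continuousOn_uncurry
    X.continuous_compProj.continuousOn (fun _ _ => X.compProj_mem_closedBall hf.mul_max_le)
    x ht).congr_of_mem (fun t' ht' => ?_) ht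
  nth_rw 1 [← hX]
  rw [ODE.FunSpace.compProj_of_mem ht', ODE.FunSpace.next_apply]

/-- Solutions on the universal covering of the transport equation `F_y = (q F)_x`, or more generally
of `F_y = q F_x + m F`, are bounded near `{y = 0}` on sectors. -/
theorem exists_bound_of_transport {δ : ℝ} (hδ : 0 < δ) {q m : E → ℂ} {K Q : ℝ≥0} {M : ℝ}
    (hqL : LipschitzOnWith K q (ball 0 δ)) (hqQ : ∀ c ∈ ball (0 : E) δ, ‖q c‖ ≤ Q)
    (hm : ∀ c ∈ ball (0 : E) δ, ‖m c‖ ≤ M) {F : E → ℂ} (hF : DifferentiableOn ℂ F (coverDomain δ))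
    (hpde : ∀ c ∈ coverDomain δ, fderiv ℂ F c (0, 1) =
      Complex.exp c.2 * (q (coverMap c) * fderiv ℂ F c (1, 0) + m (coverMap c) * F c)) :
    ∃ ε C : ℝ, 0 < ε ∧ ε ≤ δ ∧
      ∀ c ∈ coverDomain ε, c.2.im ∈ Icc 0 (2 * Real.pi) → ‖F c‖ ≤ C := by
  have hM : 0 ≤ M := (norm_nonneg _).trans (hm 0 (mem_ball_self hδ))
  -- A characteristic of speed at most `Q`, followed for a time at most `ε`, moves `x` by at most `δ
  -- / 4`, so it stays in the polydisc of radius `δ`.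
  set ε := δ / (4 * (Q + 1)) with hεdef
  have hQ1 : (0 : ℝ) < 4 * (Q + 1) := by positivity
  have hε : 0 < ε := by positivity
  have hε1 : ε * (4 * (Q + 1)) = δ := div_mul_cancel₀ _ hQ1.ne'
  have hQ0 : (0 : ℝ) ≤ Q := Q.2
  have hε4 : ε ≤ δ / 4 := by nlinarith
  have hQε : Q * ε ≤ δ / 4 := by nlinarith
  let j : ℂ × ℝ → E := fun p => (p.1, Real.log ε + p.2 * Complex.I)
  have hj : Continuous j := by fun_prop
  have hjm : MapsTo j (closedBall 0 (δ / 2) ×ˢ Icc 0 (2 * Real.pi)) (coverDomain δ) := by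
    intro p hp
    rw [mem_coverDomain]
    refine ⟨(mem_closedBall_zero_iff.1 hp.1).trans_lt (by linarith), ?_⟩
    have : Real.exp (Real.log ε) < δ := by rw [Real.exp_log hε]; linarith
    simpa [j] using this
  obtain ⟨C₀, hC₀⟩ := ((isCompact_closedBall (0 : ℂ) (δ / 2)).prod
    (isCompact_Icc (a := (0 : ℝ)) (b := 2 * Real.pi))).exists_bound_of_continuousOn
    (hF.continuousOn.comp hj.continuousOn hjm)
  have hC₀' : 0 ≤ C₀ := (norm_nonneg _).trans
    (hC₀ (0, 0) ⟨mem_closedBall_self (by linarith), le_rfl, by positivity⟩)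
  refine ⟨ε, C₀ * Real.exp (M * ε), hε, by linarith, fun c hc him => ?_⟩
  obtain ⟨hc1, hc2⟩ := mem_coverDomain.1 hc
  set τ := Real.exp c.2.re with hτ
  have hτ0 : 0 < τ := Real.exp_pos _
  set u := Complex.exp (c.2.im * Complex.I) with hu
  have hu1 : ‖u‖ = 1 := Complex.norm_exp_ofReal_mul_I _
  have hy : ∀ t ∈ Icc 0 (ε - τ), ‖((ε - t : ℝ) : ℂ) * u‖ ≤ ε := by
    intro t ht
    rw [norm_mul, hu1, mul_one, Complex.norm_real, Real.norm_of_nonneg (by linarith [ht.2])]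
    linarith [ht.1]
  have hmem : ∀ t ∈ Icc 0 (ε - τ), ∀ x ∈ closedBall c.1 ((δ / 4).toNNReal : ℝ),
      ‖x‖ ≤ δ / 2 ∧ ((x, ((ε - t : ℝ) : ℂ) * u) : E) ∈ ball (0 : E) δ := by
    intro t ht x hx
    rw [Real.coe_toNNReal _ (by linarith), mem_closedBall_iff_norm] at hx
    have hx2 : ‖x‖ ≤ δ / 2 := by
      have := norm_le_norm_add_norm_sub' x c.1
      linarith
    refine ⟨hx2, mem_ball_prod_iff.2 ⟨?_, ?_⟩⟩
    · exact mem_ball_zero_iff.2 (by linarith)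
    · exact mem_ball_zero_iff.2 ((hy t ht).trans_lt (by linarith))
  have hT : 0 ≤ ε - τ := by linarith
  -- The condition is imposed at the final time `ε - τ`: the characteristic ends at `c` and starts
  -- somewhere on `|y| = ε`, with `arg y` constant.
  have hPL : IsPicardLindelof (fun t x => q (x, ((ε - t : ℝ) : ℂ) * u) * u) (tmin := 0)
      (tmax := ε - τ) ⟨ε - τ, hT, le_rfl⟩ c.1 (δ / 4).toNNReal 0 Q K := by
    refine ⟨fun t ht => ?_, fun x hx => ?_, fun t ht x hx => ?_, ?_⟩
    · refine LipschitzOnWith.of_dist_le_mul fun x hx x' hx' => ?_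
      have h := hqL.dist_le_mul _ (hmem t ht x hx).2 _ (hmem t ht x' hx').2
      rw [Prod.dist_eq, dist_self, max_eq_left dist_nonneg] at h
      rwa [dist_eq_norm, ← sub_mul, norm_mul, hu1, mul_one, ← dist_eq_norm]
    · refine ContinuousOn.mul (hqL.continuousOn.comp (by fun_prop) fun t ht => ?_)
        continuousOn_const
      exact (hmem t ht x hx).2
    · rw [norm_mul, hu1, mul_one]
      exact hqQ _ (hmem t ht x hx).2
    · have h4 : ((δ / 4).toNNReal : ℝ) = δ / 4 := Real.coe_toNNReal _ (by linarith)
      simp only [sub_self, sub_zero, max_eq_right hT, NNReal.coe_zero, h4]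
      nlinarith
  obtain ⟨X, hX0, hXm, hXd⟩ := exists_solution_mem_closedBall hPL (mem_closedBall_self le_rfl)
  let p : ℝ → E := fun t => (X t, (Real.log (ε - t) : ℂ) + c.2.im * Complex.I)
  have hpc : ∀ t ∈ Icc 0 (ε - τ), coverMap (p t) = (X t, ((ε - t : ℝ) : ℂ) * u) := by
    intro t ht
    simp only [coverMap, p, Complex.exp_add, ← Complex.ofReal_exp,
      Real.exp_log (show 0 < ε - t by linarith [ht.2]), hu]
  have hpm : ∀ t ∈ Icc 0 (ε - τ), p t ∈ coverDomain δ := by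
    intro t ht
    show coverMap (p t) ∈ ball 0 δ
    rw [hpc t ht]
    exact (hmem t ht _ (hXm t)).2
  have hexp : ∀ t ∈ Icc 0 (ε - τ), Complex.exp (p t).2 = ((ε - t : ℝ) : ℂ) * u := fun t ht =>
    congrArg Prod.snd (hpc t ht)
  have hpd : ∀ t ∈ Icc 0 (ε - τ), HasDerivWithinAt p
      (q (coverMap (p t)) * u, ((-(ε - t)⁻¹ : ℝ) : ℂ)) (Icc 0 (ε - τ)) t := by
    intro t ht
    rw [hpc t ht]
    refine (hXd t ht).prodMk ?_
    have h := ((hasDerivAt_id t).const_sub ε).log (show ε - t ≠ 0 by linarith [ht.2])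
    have h' := (h.ofReal_comp.add_const (c.2.im * Complex.I)).hasDerivWithinAt
      (s := Icc 0 (ε - τ))
    refine h'.congr_deriv ?_
    rw [id, neg_div, one_div]
  -- Along the characteristic the `x`-derivatives of `F` cancel, leaving a linear equation with
  -- bounded coefficient.
  have hder : ∀ t ∈ Icc 0 (ε - τ), HasDerivWithinAt (fun t => F (p t))
      (-(u * m (coverMap (p t)) * F (p t))) (Icc 0 (ε - τ)) t := by
    intro t ht
    have h := (hF.differentiableAt ((isOpen_coverDomain δ).mem_nhds
      (hpm t ht))).hasFDerivAt.restrictScalars ℝ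
    have h' := h.comp_hasDerivWithinAt t (hpd t ht)
    refine h'.congr_deriv ?_
    have ht0 : ((ε - t : ℝ) : ℂ) ≠ 0 := by
      exact_mod_cast (show ε - t ≠ 0 by linarith [ht.2])
    rw [ContinuousLinearMap.coe_restrictScalars', clm_apply_eq, hpde _ (hpm t ht), hexp t ht]
    push_cast at ht0 ⊢
    field_simp
    ring
  have hgr := norm_le_gronwallBound_of_norm_deriv_right_le (f := fun t => F (p t))
    (f' := fun t => -(u * m (coverMap (p t)) * F (p t))) (δ := C₀) (K := M) (ε := 0) (a := 0)
    (b := ε - τ) (fun t ht => (hder t ht).continuousWithinAt)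
    (fun t ht => (hder t (Ico_subset_Icc_self ht)).mono_of_mem_nhdsWithin
      (Icc_mem_nhdsGE_of_mem ht)) (by
      have := hC₀ (X 0, c.2.im) ⟨mem_closedBall_zero_iff.2
        (hmem 0 ⟨le_rfl, hT⟩ _ (hXm 0)).1, him⟩
      simpa [p, j] using this) (by
      intro t ht
      rw [norm_neg, norm_mul, norm_mul, hu1, one_mul, add_zero]
      gcongr
      exact hm _ (hpm t (Ico_subset_Icc_self ht))) (ε - τ) ⟨hT, le_rfl⟩
  have hp : p (ε - τ) = c := by
    ext
    · exact hX0
    · simp only [p, sub_sub_cancel, hτ, Real.log_exp]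
      exact Complex.re_add_im _
  simp only [hp, gronwallBound_ε0, sub_zero] at hgr
  refine hgr.trans (mul_le_mul_of_nonneg_left (Real.exp_le_exp.2 ?_) hC₀')
  exact mul_le_mul_of_nonneg_left (by linarith) hM

end Characteristics

/-! ### Holomorphic extension of a form with transversal kernel. -/

section Transversal

open scoped NNReal

theorem eq_zero_of_eq_zero_on_puncturedBall {V : Type*} [NormedAddCommGroup V] {ε : ℝ} {φ : E → V}
    (hφ : ContinuousOn φ (ball 0 ε)) (h0 : ∀ c ∈ puncturedBall ε, φ c = 0) :
    ∀ c ∈ ball (0 : E) ε, φ c = 0 := by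
  have hd : Dense {c : E | c.2 ≠ 0} := (dense_compl_singleton (0 : ℂ)).preimage isOpenMap_snd
  exact Set.EqOn.of_subset_closure (f := φ) (g := fun _ => 0) (s := puncturedBall ε) h0 hφ
    continuousOn_const inter_subset_left (hd.open_subset_closure_inter isOpen_ball)

theorem hasFDerivAt_oneForm_apply {w : OneForm} {c : E} (hw : DifferentiableAt ℂ w c) (X : E) :
    HasFDerivAt (fun c => w c X) ((ContinuousLinearMap.apply ℂ ℂ X).comp (fderiv ℂ w c)) c :=
  (ContinuousLinearMap.apply ℂ ℂ X).hasFDerivAt.comp c hw.hasFDerivAt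

/-- The slope of a foliation transversal to `{y = 0}`. -/
theorem exists_slope {ρ : ℝ} (hρ : 0 < ρ) {η : OneForm} (hη : AnalyticOnNhd ℂ η (ball 0 ρ))
    (htr : IsTransversal η) :
    ∃ (δ : ℝ) (q : E → ℂ) (K Q : ℝ≥0) (M : ℝ), 0 < δ ∧ δ ≤ ρ ∧ AnalyticOnNhd ℂ q (ball 0 δ) ∧
      (∀ c ∈ ball (0 : E) δ, η c (1, 0) ≠ 0) ∧
      (∀ c ∈ ball (0 : E) δ, η c (0, 1) = q c * η c (1, 0)) ∧
      LipschitzOnWith K q (ball 0 δ) ∧ (∀ c ∈ ball (0 : E) δ, ‖q c‖ ≤ Q) ∧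
      ∀ c ∈ ball (0 : E) δ, ‖fderiv ℂ q c (1, 0)‖ ≤ M := by
  have h0 := hη 0 (mem_ball_self hρ)
  have h1 := analyticAt_clm_apply h0 (1, 0)
  let q : E → ℂ := fun c => η c (0, 1) / η c (1, 0)
  have hq : AnalyticAt ℂ q 0 := (analyticAt_clm_apply h0 (0, 1)).div h1 htr
  have hm : AnalyticAt ℂ (fun c => fderiv ℂ q c (1, 0)) 0 := analyticAt_clm_apply hq.fderiv (1, 0)
  obtain ⟨K, t, ht, hK⟩ := (hq.contDiffAt (n := 1)).exists_lipschitzOnWith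
  have hall := (((hq.eventually_analyticAt.and (h1.continuousAt.eventually_ne htr)).and
    (show ∀ᶠ c in 𝓝 (0 : E), c ∈ t from ht)).and
    (hq.continuousAt.norm.eventually_lt_const (lt_add_one _))).and
    (hm.continuousAt.norm.eventually_lt_const (lt_add_one _))
  obtain ⟨δ, hδ, hb⟩ := Metric.eventually_nhds_iff_ball.1 hall
  have hb' : ∀ c ∈ ball (0 : E) (min δ ρ), _ := fun c hc =>
    hb c (ball_subset_ball (min_le_left _ _) hc)
  refine ⟨min δ ρ, q, K, ⟨‖q 0‖ + 1, by positivity⟩, _, lt_min hδ hρ, min_le_right _ _,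
    fun c hc => (hb' c hc).1.1.1.1, fun c hc => (hb' c hc).1.1.1.2, fun c hc => ?_,
    hK.mono fun c hc => (hb' c hc).1.1.2, fun c hc => (hb' c hc).1.2.le,
    fun c hc => (hb' c hc).2.le⟩
  exact (div_mul_cancel₀ _ (hb' c hc).1.1.1.2).symm

/-- A closed multivalued form with multiplicative monodromy whose kernel is transversal to `{y = 0}`
extends holomorphically. -/
theorem exists_closed_extension {ρ : ℝ} (hρ : 0 < ρ) {w η : OneForm}
    (hwa : AnalyticOnNhd ℂ w (coverDomain ρ)) (hwne : ∀ c ∈ coverDomain ρ, w c ≠ 0)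
    (hcl : ∀ c ∈ coverDomain ρ, ∀ X Y, extD w c X Y = 0) {a : ℂ} (ha : a ≠ 0)
    (hmon : monodromy w = a • w) (hη : ExtendsFoliation w η ρ) (htr : IsTransversal η) :
    ∃ (ξ : OneForm) (ε : ℝ), 0 < ε ∧ ε ≤ ρ ∧ AnalyticOnNhd ℂ ξ (ball 0 ε) ∧
      (∀ c ∈ ball (0 : E) ε, ξ c ≠ 0) ∧ (∀ c ∈ ball (0 : E) ε, ∀ X Y : E, extD ξ c X Y = 0) ∧
      ∀ c ∈ coverDomain ε, w c = pullback ξ c := by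
  obtain ⟨δ, q, K, Q, M, hδ, hδρ, hq, hη1, hηq, hK, hQ, hM⟩ := exists_slope hρ hη.1 htr
  have hsub := coverDomain_mono hδρ
  -- The field `q ∂_x - ∂_y`, multiplied by `y` and written in the coordinates `(x, s)`, lies in the
  -- kernel of `η`, hence in that of `w`.
  have hwq : ∀ c ∈ coverDomain δ,
      w c (0, 1) = Complex.exp c.2 * q (coverMap c) * w c (1, 0) := by
    intro c hc
    have h : w c (Complex.exp c.2 * q (coverMap c), -1) = 0 := by
      rw [hη.2.2 c (hsub hc), pullback_apply, clm_apply_eq, hηq _ hc]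
      ring
    rw [clm_apply_eq] at h
    linear_combination -h
  have hf0 : ∀ c ∈ coverDomain δ, w c (1, 0) ≠ 0 := fun c hc h0 =>
    hwne c (hsub hc) (clm_ext_basis h0 (by rw [hwq c hc, h0, mul_zero]; rfl))
  have hwd : ∀ c ∈ coverDomain δ, DifferentiableAt ℂ w c := fun c hc =>
    (hwa c (hsub hc)).differentiableAt
  have hfa : AnalyticOnNhd ℂ (fun c => w c (1, 0)) (coverDomain δ) := fun c hc =>
    analyticAt_clm_apply (hwa c (hsub hc)) _
  have hqd : ∀ c ∈ coverDomain δ, HasFDerivAt (fun c => q (coverMap c))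
      ((fderiv ℂ q (coverMap c)).comp (fderiv ℂ coverMap c)) c := fun c hc =>
    (hq _ hc).differentiableAt.hasFDerivAt.comp c
      (analyticAt_coverMap c).differentiableAt.hasFDerivAt
  -- With `F = w (∂_x)`, closedness is `F_y = (q F)_x`, written with `∂_s = y ∂_y`.
  have hpde : ∀ c ∈ coverDomain δ, fderiv ℂ (fun c => w c (1, 0)) c (0, 1) = Complex.exp c.2 *
      (q (coverMap c) * fderiv ℂ (fun c => w c (1, 0)) c (1, 0) +
        fderiv ℂ q (coverMap c) (1, 0) * w c (1, 0)) := by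
    intro c hc
    have h1 := hasFDerivAt_oneForm_apply (hwd c hc) (1, 0)
    have h2 := hasFDerivAt_oneForm_apply (hwd c hc) (0, 1)
    have he : HasFDerivAt (fun c : E => Complex.exp c.2)
        (Complex.exp c.2 • ContinuousLinearMap.snd ℂ ℂ ℂ) c :=
      (hasFDerivAt_snd (𝕜 := ℂ) (p := c)).cexp
    have h3 := ((he.mul (hqd c hc)).mul h1).congr_of_eventuallyEq
      (Filter.mem_of_superset ((isOpen_coverDomain δ).mem_nhds hc) hwq)
    have h4 := congrArg (fun l : E →L[ℂ] ℂ => l (1, 0)) (h2.unique h3)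
    have h5 := (extD_eq_zero_iff w c).1 (hcl c (hsub hc))
    simp only [ContinuousLinearMap.comp_apply, add_apply, smul_apply, smul_eq_mul,
      ContinuousLinearMap.apply_apply, fderiv_coverMap_apply, mul_zero, add_zero,
      ContinuousLinearMap.coe_snd', Pi.mul_apply] at h4
    rw [h1.fderiv, ContinuousLinearMap.comp_apply, ContinuousLinearMap.comp_apply,
      ContinuousLinearMap.apply_apply, ContinuousLinearMap.apply_apply, ← h5, h4]
    ring
  obtain ⟨ε₁, C₁, hε₁, hε₁δ, hC₁⟩ := exists_bound_of_transport hδ hK hQ hM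
    hfa.differentiableOn hpde
  -- The inverse `1 / F` solves the same equation with `m = q_x` replaced by `-q_x`; its bound keeps
  -- `F` away from zero.
  obtain ⟨ε₂, C₂, hε₂, -, hC₂⟩ := exists_bound_of_transport hδ hK hQ
    (m := fun c => -fderiv ℂ q c (1, 0)) (by simpa using hM) (F := fun c => (w c (1, 0))⁻¹)
    (hfa.differentiableOn.fun_inv hf0) (by
      intro c hc
      have h1 := (hfa c hc).differentiableAt.hasFDerivAt
      have h2 := (hasDerivAt_inv (hf0 c hc)).comp_hasFDerivAt c h1
      have h3 : fderiv ℂ (fun c => (w c (1, 0))⁻¹) c = _ := h2.fderiv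
      have := hf0 c hc
      rw [h3, smul_apply, smul_apply, hpde c hc, smul_eq_mul, smul_eq_mul]
      field_simp
      ring)
  set ε := min ε₁ ε₂ with hεdef
  have hε : 0 < ε := lt_min hε₁ hε₂
  have hεδ : ε ≤ δ := (min_le_left _ _).trans hε₁δ
  have hs := coverDomain_mono hεδ
  have hball : ball (0 : E) ε ⊆ ball 0 δ := ball_subset_ball hεδ
  obtain ⟨c₁, hc₁⟩ := coverDomain_nonempty hε
  obtain ⟨μ, g, hg, hfg, x, hx, hgx⟩ := exists_eq_exp_smul_of_moderate hε
    (hfa.mono hs) ha (fun c _ => by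
      rw [← monodromy_apply w c, hmon]
      rfl) (C := C₁) (K := 0)
    (fun c hc him => by simpa using hC₁ c (coverDomain_mono (min_le_left _ _) hc) him)
    ⟨c₁, hc₁, hf0 c₁ (hs hc₁)⟩
  simp only [smul_eq_mul] at hfg
  -- The transport equation for `y ^ μ g`, multiplied by `y` and freed from `y ^ μ`. By continuity
  -- it holds on `{y = 0}` too, where only `μ * g` remains.
  have hgpde : ∀ c ∈ puncturedBall ε, μ * g c + c.2 * fderiv ℂ g c (0, 1) -
      c.2 * (q c * fderiv ℂ g c (1, 0) + fderiv ℂ q c (1, 0) * g c) = 0 := by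
    intro c' hc'
    obtain ⟨c, hc, rfl, -⟩ := exists_lift hc'
    have hgd := (hg _ hc).differentiableAt.hasFDerivAt.comp c
      (analyticAt_coverMap c).differentiableAt.hasFDerivAt
    have he : HasFDerivAt (fun c : E => Complex.exp (μ * c.2))
        (Complex.exp (μ * c.2) • (μ • ContinuousLinearMap.snd ℂ ℂ ℂ)) c :=
      ((hasFDerivAt_snd (𝕜 := ℂ) (p := c)).const_mul μ).cexp
    have h1 := (he.mul hgd).congr_of_eventuallyEq
      (Filter.mem_of_superset ((isOpen_coverDomain ε).mem_nhds hc) hfg)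
    have h2 := hpde c (hs hc)
    rw [hfg c hc, h1.fderiv] at h2
    simp only [ContinuousLinearMap.comp_apply, add_apply, smul_apply, smul_eq_mul,
      fderiv_coverMap_apply, mul_zero, add_zero, ContinuousLinearMap.coe_snd', mul_one,
      Function.comp_apply] at h2
    have h3 : fderiv ℂ g (coverMap c) (0, Complex.exp c.2) =
        Complex.exp c.2 * fderiv ℂ g (coverMap c) (0, 1) := by
      rw [clm_apply_eq]
      ring
    rw [h3] at h2
    apply mul_left_cancel₀ (Complex.exp_ne_zero (μ * c.2))
    show _ * (_ + Complex.exp c.2 * _ - Complex.exp c.2 * _) = _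
    linear_combination h2
  have hcg := hg.continuousOn
  have hcq : ContinuousOn q (ball 0 ε) := hq.continuousOn.mono hball
  have hcg' : ∀ X, ContinuousOn (fun c => fderiv ℂ g c X) (ball 0 ε) := fun X =>
    hg.fderiv.continuousOn.clm_apply continuousOn_const
  have hcq' : ContinuousOn (fun c => fderiv ℂ q c (1, 0)) (ball 0 ε) :=
    (hq.fderiv.continuousOn.mono hball).clm_apply continuousOn_const
  have hμ : μ = 0 := by
    have h := eq_zero_of_eq_zero_on_puncturedBall
      (((continuousOn_const.mul hcg).add (continuousOn_snd.mul (hcg' _))).sub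
        (continuousOn_snd.mul ((hcq.mul (hcg' _)).add (hcq'.mul hcg)))) hgpde _ hx
    simpa [hgx] using h
  simp only [hμ, zero_mul, Complex.exp_zero, one_mul] at hfg
  have hC₂pos : 0 < C₂ := by
    obtain ⟨c, hc, -, him⟩ := exists_lift (coverMap_mem_puncturedBall hc₁)
    exact (norm_pos_iff.2 (inv_ne_zero (hf0 c (hs hc)))).trans_le
      (hC₂ c (coverDomain_mono (min_le_right _ _) hc) him)
  have hgne : ∀ c ∈ ball (0 : E) ε, g c ≠ 0 := by
    intro c hc h0
    -- Truncation at zero turns the inequality `‖g‖ ≥ C₂⁻¹` into the vanishing of a continuous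
    -- function, which extends from `{y ≠ 0}` by density.
    have h := eq_zero_of_eq_zero_on_puncturedBall (φ := fun c => min (‖g c‖ - C₂⁻¹) 0)
      (ContinuousOn.inf (hcg.norm.sub continuousOn_const) continuousOn_const) (fun c' hc' => ?_) c hc
    · rw [h0, norm_zero, zero_sub, min_eq_left (by simpa using hC₂pos.le)] at h
      exact (inv_pos.2 hC₂pos).ne' (neg_eq_zero.1 h)
    · obtain ⟨c, hc, rfl, him⟩ := exists_lift hc'
      have h := hC₂ c (coverDomain_mono (min_le_right _ _) hc) him
      rw [norm_inv, hfg c hc] at h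
      have hpos : 0 < ‖g (coverMap c)‖ := by
        rw [← hfg c hc]
        exact norm_pos_iff.2 (hf0 c (hs hc))
      exact min_eq_right (sub_nonneg.2 ((inv_le_comm₀ hpos hC₂pos).1 h))
  let ξ : OneForm := fun c =>
    g c • ContinuousLinearMap.fst ℂ ℂ ℂ + (q c * g c) • ContinuousLinearMap.snd ℂ ℂ ℂ
  have hξa : AnalyticOnNhd ℂ ξ (ball 0 ε) := fun c hc =>
    ((hg c hc).smul analyticAt_const).add (((hq c (hball hc)).mul (hg c hc)).smul analyticAt_const)
  have hξ1 : ∀ c, ξ c (1, 0) = g c := fun c => by simp [ξ]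
  have hξ2 : ∀ c, ξ c (0, 1) = q c * g c := fun c => by simp [ξ]
  have hwξ : ∀ c ∈ coverDomain ε, w c = pullback ξ c := by
    intro c hc
    apply clm_ext_basis
    · rw [pullback_apply_fst, hξ1, hfg c hc]
    · rw [pullback_apply_snd, hξ2, hwq c (hs hc), hfg c hc, mul_assoc]
  refine ⟨ξ, ε, hε, hεδ.trans hδρ, hξa, fun c hc h0 => hgne c hc ?_, fun c hc X Y => ?_, hwξ⟩
  · rw [← hξ1, h0]
    rfl
  · refine eq_zero_of_eq_zero_on_puncturedBall (φ := fun c => extD ξ c X Y)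
      (((hξa.fderiv.continuousOn.clm_apply continuousOn_const).clm_apply continuousOn_const).sub
      ((hξa.fderiv.continuousOn.clm_apply continuousOn_const).clm_apply continuousOn_const))
      (fun c' hc' => ?_) c hc
    obtain ⟨c, hc, rfl, -⟩ := exists_lift hc'
    -- These vectors are the preimages of `X` and `Y` under the derivative of `coverMap`.
    have h := hcl c (hsub (hs hc)) (X.1, (Complex.exp c.2)⁻¹ * X.2)
      (Y.1, (Complex.exp c.2)⁻¹ * Y.2)
    have hev : w =ᶠ[𝓝 c] pullback ξ :=
      Filter.mem_of_superset ((isOpen_coverDomain ε).mem_nhds hc) hwξ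
    rw [extD, hev.fderiv_eq] at h
    have h' := (extD_pullback (hξa _ hc) _ _).symm.trans h
    simpa only [mul_inv_cancel_left₀ (Complex.exp_ne_zero _)] using h'

end Transversal

/-! ### Fixed points of the projective monodromy and the main theorem. -/

theorem monodromy_eq_smul_of_projMonodromy_eq {V : Submodule ℂ OneForm}
    {hV : ∀ w ∈ V, monodromy w ∈ V} {w : V} (hw : w ≠ 0)
    (h : projMonodromy V hV (Projectivization.mk ℂ w hw) = Projectivization.mk ℂ w hw) :
    ∃ a : ℂ, a ≠ 0 ∧ monodromy w = a • (w : OneForm) := by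
  rw [projMonodromy, Projectivization.map_mk, Projectivization.mk_eq_mk_iff] at h
  obtain ⟨a, ha⟩ := h
  exact ⟨a, a.ne_zero, (congrArg Subtype.val ha).symm⟩

theorem exists_projMonodromy_eq {V : Submodule ℂ OneForm} (hV : ∀ w ∈ V, monodromy w ∈ V)
    {w₀ w₁ : OneForm} (hspan : V = Submodule.span ℂ {w₀, w₁}) (h₀ : w₀ ≠ 0) :
    ∃ P : Projectivization ℂ V, projMonodromy V hV P = P := by
  have : FiniteDimensional ℂ V := by
    rw [hspan]
    exact FiniteDimensional.span_of_finite ℂ (by simp)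
  have : Nontrivial V := ⟨⟨w₀, by rw [hspan]; exact Submodule.subset_span (by simp)⟩, 0,
    fun h => h₀ (congrArg Subtype.val h)⟩
  exact exists_projectivization_map_fixed _ _

end AffineSurface

end

theorem mainTheorem6 {S : Type*} [TopologicalSpace S] [ChartedSpace AffineSurface.E S]
    [IsManifold 𝓘(ℂ, AffineSurface.E) ω S] (H : AffineSurface.RiccatiFoliation S)
    (hH : H.IsTorsionFree) (p : S) (e : OpenPartialHomeomorph S AffineSurface.E)
    (he : H.IsAdaptedChart p e) (hreg : H.IsRegularSingularIn e)
    (r : ℝ) (hr : 0 < r) (hball : Metric.ball (0 : AffineSurface.E) r ⊆ e.target) :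
    (∃! V : Submodule ℂ AffineSurface.OneForm, H.IsFlatPencil e r V) ∧
    ∀ V : Submodule ℂ AffineSurface.OneForm, H.IsFlatPencil e r V →
      ∃ hV : ∀ w ∈ V, AffineSurface.monodromy w ∈ V,
        (∃ P : Projectivization ℂ V, AffineSurface.projMonodromy V hV P = P) ∧
        ∀ P : Projectivization ℂ V, AffineSurface.projMonodromy V hV P = P →
          ∀ (w : V) (hw : w ≠ 0), Projectivization.mk ℂ w hw = P →
            (∃ a : ℂ, a ≠ 0 ∧ AffineSurface.monodromy w = a • (w : AffineSurface.OneForm)) ∧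
            (∃ η : AffineSurface.OneForm, ∃ ρ : ℝ, 0 < ρ ∧ ρ ≤ r ∧
              AffineSurface.ExtendsFoliation w η ρ) ∧
            (∀ (η : AffineSurface.OneForm) (ρ : ℝ), 0 < ρ → ρ ≤ r →
              AffineSurface.ExtendsFoliation w η ρ → AffineSurface.IsTransversal η →
                ∃ (ξ : AffineSurface.OneForm) (ε : ℝ), 0 < ε ∧ ε ≤ r ∧
                  AnalyticOnNhd ℂ ξ (Metric.ball 0 ε) ∧
                  (∀ c ∈ Metric.ball (0 : AffineSurface.E) ε, ξ c ≠ 0) ∧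
                  (∀ c ∈ Metric.ball (0 : AffineSurface.E) ε, ∀ X Y : AffineSurface.E,
                    AffineSurface.extD ξ c X Y = 0) ∧
                  ∀ c ∈ AffineSurface.coverDomain ε,
                    (w : AffineSurface.OneForm) c = AffineSurface.pullback ξ c) := by
  open AffineSurface in
  have h := H.isTorsionFreeRiccati hH he hball
  have hiff := RiccatiFoliation.isFlatPencil_iff (e := e) hr h
  refine ⟨⟨_, (hiff _).2 rfl, fun V hV => (hiff V).1 hV⟩, fun V hVp => ?_⟩
  obtain ⟨w₀, w₁, hspan, hwedge⟩ := hVp.span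
  obtain ⟨c₀, hc₀⟩ := coverDomain_nonempty hr
  have hw₀ : w₀ ≠ 0 := fun h0 => hwedge c₀ hc₀ (by simp [h0, wedge])
  have hVeq := (hiff V).1 hVp
  have hV : ∀ w ∈ V, monodromy w ∈ V := by
    rw [hVeq]
    exact fun w hw => monodromy_mem_parallelSpace hw
  refine ⟨hV, exists_projMonodromy_eq hV hspan hw₀, ?_⟩
  rintro P hP w hw rfl
  obtain ⟨a, ha, hmon⟩ := monodromy_eq_smul_of_projMonodromy_eq hw hP
  have hwV : (w : OneForm) ∈ parallelSpace (coverα (H.α e)) (coverβ (H.β e)) (coverγ (H.γ e))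
      (coverDomain r) := hVeq ▸ w.2
  have hw0 : (w : OneForm) ≠ 0 := fun h0 => hw (Subtype.ext h0)
  refine ⟨⟨a, ha, hmon⟩, ?_, fun η ρ hρ hρr hη htr => ?_⟩
  · obtain ⟨θ, hθ, hflat, hind, hrs⟩ := hreg
    exact exists_extendsFoliation hr h hθ hflat hind hrs hwV hw0 ha hmon
  · have hs := coverDomain_mono hρr
    obtain ⟨ξ, ε, hε, hερ, hξ⟩ := exists_closed_extension hρ (fun c hc => hwV.1 c (hs hc))
      (fun c hc => ne_zero_of_mem_parallelSpace h.cover (isOpen_coverDomain r)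
        (convex_coverDomain hr) hwV hw0 (hs hc))
      (fun c hc => (hwV.2.2 c (hs hc)).closed) ha hmon hη htr
    exact ⟨ξ, ε, hε, hερ.trans hρr, hξ⟩
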